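/- **Setting.** Let $d,n\ge 1$, $\nu_0\in(0,1]$, $\eta\in(0,1)$, $b>0$. Let $\psi_1,\dots,\psi_n$ be $C^1$ diffeomorphisms of $\mathbb R^d$ onto itself with $\nu_0$-Hölder derivatives and Lipschitz constants at most $\eta$ (F1), and let $G\subset\mathbb R^d$ be the unique non-empty compact set with $G=\bigcup_i\psi_i(G)$. Put $\mathcal F=\bigcup_{i\ne j}\psi_i(G)\cap\psi_j(G)$, let $\sigma$ be the shift on $\Sigma=\{1,\dots,n\}^{\mathbb N}$ and let $\Phi:\Sigma\to G$, $\{\Phi(x)\}=\bigcap_l\psi_{x_0}\circ\dots\circ\psi_{x_l}(G)$, be the coding map. Assume: * (F2) $\psi_i(G)\cap\psi_j(G)$ is finite for $i\neq j$; * (F3) $\bigcup_{j\ge1}\sigma^j(\Phi^{-1}(\mathcal F))$ is finite; * (F4) there are disjoint open sets $\mathcal O_1,\dots,\mathcal O_n$ with $G\cap\mathcal O_i=\psi_i(G)\setminus\bigcup_{j\ne i}(\psi_i(G)\cap\psi_j(G))$; the map $F:G\to G$ is $F=\psi_i^{-1}$ on $G\cap\mathcal O_i$, and at each point of $\mathcal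 F$ its value is an arbitrary one of the fixed points of $\psi_1,\dots,\psi_n$; * (ND) for all $x\in G$ and $v,v_0\in\mathbb R^d$ there is $i$ with $|(D\psi_i(x)v,v_0)|\ge b\|v\|\,\|v_0\|$. Let $M^d$ be the space of symmetric $d\times d$ matrices with $(A,B)_{HS}=\operatorname{tr}({}^tAB)$ and norm $\|\cdot\|_{HS}$. For an $M^d$-valued Borel measure $\tau$ on $G$ let $\|\tau\|$ be its total variation for $\|\cdot\|_{HS}$ and $\tau=T\|\tau\|$ its polar decomposition; put $\int_B(A,d\tau)_{HS}=\int_B(A_x,T_x)_{HS}\,d\|\tau\|(x)$ and $\int_G(u,d\tau\,v)=\int_G(u(x),T_xv(x))\,d\|\tau\|(x)$. The pairing $\langle A,\tau\rangle=\int_G(A,d\tau)_{HS}$ identifies the $M^d$-valued Borel measures with the dual of $C(G,M^d)$. Let $$(\mathcal L_GA)(x)=\sum_{i=1}^n{}^tD\psi_i(x)\,A(\psi_i(x))\,D\psi_i(x),\qquad A\in C(G,M^d),$$ and let $\mathcal L_G^*$ be the adjoint of $\mathcal L_G$ for this pairing. **Theorem.** There is $\omega>0$, depending only on $b$ and on the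 fixed data $d,n,\nu_0,\eta$, such that the following holds for every system as above with $$\operatorname{diam}(G)^{\nu_0}\,\|D\psi_i(x)-D\psi_i(y)\|_{HS}\le\omega\,\|x-y\|^{\nu_0}\qquad\forall x,y\in G,\ \forall i$$ (that is, the $\nu_0$-Hölder seminorms of the $D\psi_i$ on $G$ are small once the norm of $\mathbb R^d$ is rescaled so that $\operatorname{diam}G\le1$; this always holds if the $\psi_i$ are affine). 1. There are $\beta>0$ and $Q_G\in C(G,M^d)$ with $\mathcal L_GQ_G=\beta Q_G$; $Q_G$ is $\nu_0$-Hölder and $Q_G(x)$ is positive definite for all $x\in G$. The eigenvalue $\beta$ is simple: every $A\in C(G,M^d)$ with $\mathcal L_GA=\beta A$, and more generally with $(\mathcal L_G-\beta)^kA=0$ for some $k$, is a multiple of $Q_G$. 2. There is an $M^d$-valued Borel measure $\tau_G\ne0$ on $G$ with $\mathcal L_G^*\tau_G=\beta\tau_G$, and $\tau_G(B)$ is positive semidefinite for every Borel set $B$. Every $M^d$-valued Borel measure $\sigma$ with $\mathcal L_G^*\sigma=\beta\sigma$ is a multiple of $\tau_G$. 3. The finite positive measure $\kappa_G=(Q_G,\tau_G)_{HS}$,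 $\kappa_G(B)=\int_B(Q_G,d\tau_G)_{HS}$, and the measure $\|\tau_G\|$ are mutually absolutely continuous, and $\kappa_G$ is $F$-invariant and ergodic for $F$. 4. The form $\mathcal E(f,g)=\int_G(\nabla f,d\tau_G\nabla g)$ on $C^1(\mathbb R^d)$ satisfies $\mathcal E(f,g)=\frac1\beta\sum_{i=1}^n\mathcal E(f\circ\psi_i,g\circ\psi_i)$ for all $f,g\in C^1(\mathbb R^d)$. 5. If the maps $\psi_i$ are affine, then for all $l\ge0$ and $x_0,\dots,x_{l-1}\in\{1,\dots,n\}$, with $\psi=\psi_{x_0}\circ\dots\circ\psi_{x_{l-1}}$, $$\tau_G(\psi(G))=\beta^{-l}\,D\psi\cdot\tau_G(G)\cdot{}^tD\psi .$$ -/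

import Mathlib

open MeasureTheory Set
open scoped NNReal Matrix

noncomputable section

/-- Euclidean space `ℝᵈ`. -/
abbrev Euc (d : ℕ) : Type := EuclideanSpace ℝ (Fin d)

/-! ### Symmetric matrices and the Hilbert–Schmidt structure -/

/-- The space `Mᵈ` of symmetric `d × d` real matrices. -/
def symMat (d : ℕ) : Submodule ℝ (Matrix (Fin d) (Fin d) ℝ) where
  carrier := {A | A.IsSymm}
  add_mem' := fun ha hb => ha.add hb
  zero_mem' := Matrix.isSymm_zero
  smul_mem' := fun c _ h => h.smul c

/-- `(A, B)_HS = tr (ᵗA B)`. -/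
def hsInner {d : ℕ} (A B : Matrix (Fin d) (Fin d) ℝ) : ℝ := (Aᵀ * B).trace

/-- `‖A‖_HS`. -/
def hsNorm {d : ℕ} (A : Matrix (Fin d) (Fin d) ℝ) : ℝ := Real.sqrt (hsInner A A)

/-- The Jacobian matrix `Df(x)` in the standard basis. -/
def jac {d : ℕ} (f : Euc d → Euc d) (x : Euc d) : Matrix (Fin d) (Fin d) ℝ :=
  (Matrix.toEuclideanCLM (n := Fin d) (𝕜 := ℝ)).symm (fderiv ℝ f x)

/-! ### Matrix-valued measures -/

section MatrixMeasure

variable {X : Type*} [MeasurableSpace X] {d : ℕ}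

/-- A symmetric matrix as the vector of its entries; the Euclidean norm of this vector is the
Hilbert–Schmidt norm of the matrix. -/
def entriesHom (d : ℕ) : symMat d →+ EuclideanSpace ℝ (Fin d × Fin d) where
  toFun A := WithLp.toLp 2 fun p => (A : Matrix (Fin d) (Fin d) ℝ) p.1 p.2
  map_zero' := by ext p; simp
  map_add' A B := by ext p; simp

theorem norm_entriesHom (A : symMat d) :
    ‖entriesHom d A‖ = hsNorm (A : Matrix (Fin d) (Fin d) ℝ) := by
  rw [EuclideanSpace.norm_eq, hsNorm, hsInner]
  congr 1
  simp only [entriesHom, AddMonoidHom.coe_mk, ZeroHom.coe_mk, Real.norm_eq_abs, sq_abs,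
    Fintype.sum_prod_type, Matrix.trace, Matrix.diag_apply, Matrix.mul_apply,
    Matrix.transpose_apply]
  rw [Finset.sum_comm]
  simp only [sq]

theorem continuous_entriesHom : Continuous (entriesHom d) := by
  refine (PiLp.continuous_toLp 2 _).comp (continuous_pi fun p => ?_)
  exact (continuous_apply_apply p.1 p.2).comp continuous_subtype_val

/-- The entry in position `(j, k)` of a symmetric matrix. -/
def entryHom (j k : Fin d) : symMat d →+ ℝ where
  toFun A := (A : Matrix (Fin d) (Fin d) ℝ) j k
  map_zero' := by simp
  map_add' A B := by simp

theorem continuous_entryHom (j k : Fin d) : Continuous (entryHom j k) :=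
  (continuous_apply_apply j k).comp continuous_subtype_val

/-- The total variation measure `‖τ‖` of an `Mᵈ`-valued measure, with respect to the
Hilbert–Schmidt norm. -/
def totalVar (τ : VectorMeasure X (symMat d)) : Measure X :=
  (τ.mapRange (entriesHom d) continuous_entriesHom).variation

/-- The matrix field `T` in the polar decomposition `τ = T ‖τ‖`: entry by entry, the
Radon–Nikodym derivative of `τ` with respect to `‖τ‖`. -/
def polar (τ : VectorMeasure X (symMat d)) (x : X) : Matrix (Fin d) (Fin d) ℝ :=
  Matrix.of fun j k =>
    SignedMeasure.rnDeriv (τ.mapRange (entryHom j k) (continuous_entryHom j k)) (totalVar τ) x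

/-- `∫_B (A, dτ)_HS = ∫_B (A_x, T_x)_HS d‖τ‖(x)`. -/
def hsIntegralOn (B : Set X) (A : X → Matrix (Fin d) (Fin d) ℝ)
    (τ : VectorMeasure X (symMat d)) : ℝ :=
  ∫ x in B, hsInner (A x) (polar τ x) ∂(totalVar τ)

/-- `∫ (u, dτ v) = ∫ (u(x), T_x v(x)) d‖τ‖(x)`. -/
def formIntegral (u v : X → Euc d) (τ : VectorMeasure X (symMat d)) : ℝ :=
  ∫ x, inner ℝ (u x) (Matrix.toEuclideanCLM (n := Fin d) (𝕜 := ℝ) (polar τ x) (v x))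
    ∂(totalVar τ)

end MatrixMeasure

/-! ### Words, cells and the coding -/

section Coding

variable {d n : ℕ}

/-- `ψ_{x₀} ∘ ⋯ ∘ ψ_{x_{l-1}}` for the word `x₀ … x_{l-1}`. -/
def wordMap (ψ : Fin n → Euc d → Euc d) : List (Fin n) → Euc d → Euc d
  | [] => id
  | i :: w => ψ i ∘ wordMap ψ w

/-- The cell `ψ_{x₀} ∘ ⋯ ∘ ψ_{x_{l-1}} (G)`. -/
def cell (ψ : Fin n → Euc d → Euc d) (G : Set (Euc d)) (w : List (Fin n)) : Set (Euc d) :=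
  wordMap ψ w '' G

/-- `⋃_{i ≠ j} ψ_i(G) ∩ ψ_j(G)`. -/
def critSet (ψ : Fin n → Euc d → Euc d) (G : Set (Euc d)) : Set (Euc d) :=
  ⋃ (i : Fin n) (j : Fin n) (_ : i ≠ j), ψ i '' G ∩ ψ j '' G

/-- The set `⋂_l ψ_{w₀ … w_l}(G)`; for contractions and compact non-empty `G` with
`ψ_i(G) ⊆ G` it is a singleton `{Φ(w)}`, where `Φ` is the coding map. -/
def codedSet (ψ : Fin n → Euc d → Euc d) (G : Set (Euc d)) (w : ℕ → Fin n) : Set (Euc d) :=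
  ⋂ l : ℕ, cell ψ G (List.ofFn fun k : Fin (l + 1) => w k)

/-- The sequences `w` whose coded point `Φ(w)` lies in the critical set. -/
def critCodes (ψ : Fin n → Euc d → Euc d) (G : Set (Euc d)) : Set (ℕ → Fin n) :=
  {w | (codedSet ψ G w ∩ critSet ψ G).Nonempty}

/-- The shift on sequences. -/
def shift (w : ℕ → Fin n) : ℕ → Fin n := fun k => w (k + 1)

end Coding

/-! ### Fractals -/

/-- A post-critically finite fractal `G ⊆ ℝᵈ` generated by `n` contracting `C^{1,ν}`
diffeomorphisms of `ℝᵈ` with common Lipschitz constant `η`, with the open sets `O_i` that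
separate its first-level cells and with the expanding map `F : G → G` whose inverse branches
are the `ψ_i`. -/
structure FractalSystem (d n : ℕ) (ν η : ℝ≥0) where
  /-- The maps `ψ_i`. -/
  ψ : Fin n → Euc d → Euc d
  /-- The fractal. -/
  G : Set (Euc d)
  /-- The separating open sets. -/
  O : Fin n → Set (Euc d)
  /-- The expanding map. -/
  F : G → G
  /-- Each `ψ_i` is a `C¹` diffeomorphism of `ℝᵈ` onto itself, ... -/
  contDiff : ∀ i, ContDiff ℝ 1 (ψ i)
  diffeo : ∀ i, ∃ φ : Euc d → Euc d,
    ContDiff ℝ 1 φ ∧ Function.LeftInverse φ (ψ i) ∧ Function.RightInverse φ (ψ i)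
  /-- ... with `ν`-Hölder derivative ... -/
  holder : ∀ i, ∃ C : ℝ≥0, HolderWith C ν (fderiv ℝ (ψ i))
  /-- ... and Lipschitz constant at most `η`. -/
  lipschitz : ∀ i, LipschitzWith η (ψ i)
  /-- `G` is the attractor. -/
  isCompact : IsCompact G
  nonempty : G.Nonempty
  self_similar : G = ⋃ i, ψ i '' G
  /-- Different first-level cells have finite intersection. -/
  finite_inter : ∀ i j, i ≠ j → (ψ i '' G ∩ ψ j '' G).Finite
  /-- Post-critical finiteness. -/
  pcf : (⋃ (j : ℕ) (_ : 1 ≤ j), shift^[j] '' critCodes ψ G).Finite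
  /-- The sets `O_i` are open, disjoint, and separate the cells off the critical set. -/
  isOpen_O : ∀ i, IsOpen (O i)
  disjoint_O : ∀ i j, i ≠ j → Disjoint (O i) (O j)
  inter_O : ∀ i, G ∩ O i = ψ i '' G \ ⋃ (j : Fin n) (_ : i ≠ j), ψ i '' G ∩ ψ j '' G
  /-- `F = ψ_i⁻¹` on `G ∩ O_i`. -/
  F_of_mem_O : ∀ (i : Fin n) (x : G), (x : Euc d) ∈ O i → ψ i (F x) = x
  /-- On the critical set `F` takes arbitrary values among the fixed points of the `ψ_j`. -/
  F_of_mem_crit : ∀ x : G, (x : Euc d) ∈ critSet ψ G → ∃ j, ψ j (F x) = F x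

namespace FractalSystem

variable {d n : ℕ} {ν η : ℝ≥0} (S : FractalSystem d n ν η)

theorem mapsTo (i : Fin n) : MapsTo (S.ψ i) S.G S.G := by
  intro x hx
  rw [S.self_similar]
  exact mem_iUnion.2 ⟨i, mem_image_of_mem _ hx⟩

/-- `ψ_i` as a map `G → G`. -/
def ψG (i : Fin n) : S.G → S.G := (S.mapsTo i).restrict

theorem continuous_ψG (i : Fin n) : Continuous (S.ψG i) :=
  (S.contDiff i).continuous.continuousOn.mapsToRestrict (S.mapsTo i)

theorem continuous_jac (i : Fin n) : Continuous fun x : S.G => jac (S.ψ i) x := by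
  have h : Continuous fun x : S.G => fderiv ℝ (S.ψ i) x :=
    ((S.contDiff i).continuous_fderiv one_ne_zero).comp continuous_subtype_val
  exact (LinearMap.continuous_of_finiteDimensional
    ((Matrix.toEuclideanCLM (n := Fin d) (𝕜 := ℝ)).symm.toAlgEquiv.toLinearMap)).comp h

/-- The matrix Ruelle operator on `C(G, Mᵈ)`:
`(L A)(x) = ∑_i ᵗDψ_i(x) A(ψ_i(x)) Dψ_i(x)`. -/
def ruelle : C(S.G, symMat d) →ₗ[ℝ] C(S.G, symMat d) where
  toFun A :=
    { toFun := fun x =>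
        ⟨∑ i, (jac (S.ψ i) x)ᵀ * (A (S.ψG i x) : Matrix (Fin d) (Fin d) ℝ) * jac (S.ψ i) x,
          Submodule.sum_mem _ fun i _ => by
            have h : (A (S.ψG i x) : Matrix (Fin d) (Fin d) ℝ).IsSymm := (A (S.ψG i x)).2
            change (_ : Matrix (Fin d) (Fin d) ℝ)ᵀ = _
            rw [Matrix.transpose_mul, Matrix.transpose_mul, Matrix.transpose_transpose, h.eq,
              Matrix.mul_assoc]⟩
      continuous_toFun := by
        refine Continuous.subtype_mk (continuous_finsetSum _ fun i _ => ?_) _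
        exact ((S.continuous_jac i).matrix_transpose.matrix_mul
          (continuous_subtype_val.comp (A.continuous.comp (S.continuous_ψG i)))).matrix_mul
          (S.continuous_jac i) }
  map_add' A B := by
    ext x : 2
    simp [Matrix.mul_add, Matrix.add_mul, Finset.sum_add_distrib]
  map_smul' c A := by
    ext x : 2
    simp [Finset.smul_sum]

/-- The duality coupling `⟨A, τ⟩ = ∫_G (A, dτ)_HS` between `C(G, Mᵈ)` and the `Mᵈ`-valued Borel
measures on `G`. -/
def pairing (A : C(S.G, symMat d)) (τ : VectorMeasure S.G (symMat d)) : ℝ :=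
  hsIntegralOn univ (fun x => (A x : Matrix (Fin d) (Fin d) ℝ)) τ

/-- `ρ = L* τ`, where `L*` is the adjoint of the Ruelle operator:
`⟨A, ρ⟩ = ⟨L A, τ⟩` for all `A ∈ C(G, Mᵈ)`. -/
def IsAdjointImage (τ ρ : VectorMeasure S.G (symMat d)) : Prop :=
  ∀ A : C(S.G, symMat d), S.pairing A ρ = S.pairing (S.ruelle A) τ

/-- `κ` is the scalar measure `(Q, τ)_HS`. -/
def IsHSMeasure (Q : C(S.G, symMat d)) (τ : VectorMeasure S.G (symMat d))
    (κ : Measure S.G) : Prop :=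
  IsFiniteMeasure κ ∧ ∀ B : Set S.G, MeasurableSet B →
    κ.real B = hsIntegralOn B (fun x => (Q x : Matrix (Fin d) (Fin d) ℝ)) τ

/-- The form `E(f, g) = ∫_G (∇f, dτ ∇g)`. -/
def energy (τ : VectorMeasure S.G (symMat d)) (f g : Euc d → ℝ) : ℝ :=
  formIntegral (fun x : S.G => gradient f x) (fun x : S.G => gradient g x) τ

/-- Quantitative nondegeneracy with constant `b`. -/
def Nondegenerate (b : ℝ) : Prop :=
  ∀ x ∈ S.G, ∀ v v₀ : Euc d, ∃ i, b * ‖v‖ * ‖v₀‖ ≤ |inner ℝ (fderiv ℝ (S.ψ i) x v) v₀|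

/-- After rescaling the norm of `ℝᵈ` so that `G` has diameter at most one, the `ν`-Hölder
seminorms of the `Dψ_i` on `G` are at most `ω`: the seminorm for the norm `‖·‖ / diam G`
is `(diam G) ^ ν` times the seminorm for `‖·‖`. -/
def HolderSmall (ω : ℝ) : Prop :=
  ∀ i, ∀ x ∈ S.G, ∀ y ∈ S.G,
    Metric.diam S.G ^ (ν : ℝ) * hsNorm (jac (S.ψ i) x - jac (S.ψ i) y) ≤ ω * dist x y ^ (ν : ℝ)

/-- All the maps `ψ_i` are affine. -/
def IsAffine : Prop := ∀ i, ∃ f : Euc d →ᵃ[ℝ] Euc d, ⇑f = S.ψ i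

end FractalSystem

end

/-! Everything rests on a Perron–Frobenius theorem for L = `ruelle`, proved by contracting a cone in
the manner of Birkhoff. The cone `logHolderCone` consists of the positive semidefinite fields A with
A(x) ≤ e^{ρ(x,y)} A(y) as quadratic forms, where ρ = `relDist` ≤ 1. Composition with ψ_i shrinks ρ
by the factor η^ν, while the variation of Dψ_i costs an error of order ωρ tr A. Nondegeneracy bounds
L A from below by a multiple of tr A times the identity, so for small ω this error is absorbed, and
L A satisfies the cone inequality with θρ in place of ρ for some θ < 1 (`quad_ruelle_le_exp_mul`).
Moreover L A lies between two multiples of tr A(x₀) times the identity (`le_quad_ruelle`,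
`quad_ruelle_le`). Together these facts give the image of the cone finite projective diameter
(`exists_contractsCone`).

An operator that contracts a cone has an eigenvector Q in it, and β⁻ᵏ Lᵏ A tends to a multiple of Q
for A in the cone (`exists_eigenvector`, `exists_tendsto`). Differences of cone elements include all
products of a Lipschitz function and a constant matrix, whose span is dense. The operators β⁻ᵏ Lᵏ
are uniformly bounded by comparison with Q, so β⁻ᵏ Lᵏ A → c(A) Q for every continuous A, with a
positive functional c (`exists_isSpectralData`).

The functional c carries the rest. From c ∘ L = β c and c(Q) = 1 follows the simplicity of β. Riesz'
theorem on rank one fields v ᵗv, followed by polarization, represents c by a positive matrix measure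
τ (`exists_eigenmeasure`). If L*σ = βσ, then ⟨A, σ⟩ = ⟨β⁻ᵏ Lᵏ A, σ⟩ → c(A) ⟨Q, σ⟩, so σ is a
multiple of τ.

The density of κ = (Q, τ)_HS, multiplied by β, splits into contributions of the branches ψ_i, each
at least a fixed proportion of that density. If there are two branches or more, none takes
everything, and a point with finitely many codes has mass zero (`hsMeasure_singleton`). By
post-critical finiteness the critical set is therefore null, and F ∘ ψ_i = id almost everywhere.
Invariance of κ is then L Q = β Q integrated, and ergodicity is uniqueness of τ applied to its
restriction to an invariant set. Self-similarity of the form is L*τ = βτ tested on symmetric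
products of gradients; the formula on cells is the same identity tested on indicators. -/

/-! ### Quadratic forms of symmetric matrices -/

section Quad

variable {d : ℕ}

/-- The quadratic form of a matrix. -/
def quad (A : Matrix (Fin d) (Fin d) ℝ) (v : Fin d → ℝ) : ℝ := v ⬝ᵥ A *ᵥ v

theorem quad_add (A B : Matrix (Fin d) (Fin d) ℝ) (v : Fin d → ℝ) :
    quad (A + B) v = quad A v + quad B v := by
  simp [quad, Matrix.add_mulVec, dotProduct_add]

theorem quad_sub (A B : Matrix (Fin d) (Fin d) ℝ) (v : Fin d → ℝ) :
    quad (A - B) v = quad A v - quad B v := by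
  simp [quad, Matrix.sub_mulVec, dotProduct_sub]

theorem quad_smul (c : ℝ) (A : Matrix (Fin d) (Fin d) ℝ) (v : Fin d → ℝ) :
    quad (c • A) v = c * quad A v := by
  simp [quad, Matrix.smul_mulVec, dotProduct_smul]

theorem quad_sum {ι : Type*} (s : Finset ι) (A : ι → Matrix (Fin d) (Fin d) ℝ) (v : Fin d → ℝ) :
    quad (∑ i ∈ s, A i) v = ∑ i ∈ s, quad (A i) v := by
  simp [quad, Matrix.sum_mulVec, dotProduct_sum]

theorem quad_one (v : Fin d → ℝ) : quad 1 v = v ⬝ᵥ v := by simp [quad]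

theorem quad_conj (A D : Matrix (Fin d) (Fin d) ℝ) (v : Fin d → ℝ) :
    quad (Dᵀ * A * D) v = quad A (D *ᵥ v) := by
  simp only [quad]
  rw [← Matrix.mulVec_mulVec, ← Matrix.mulVec_mulVec, Matrix.dotProduct_mulVec,
    Matrix.vecMul_transpose]

theorem dotProduct_self_nonneg' (v : Fin d → ℝ) : 0 ≤ v ⬝ᵥ v := by
  rw [dotProduct]; exact Finset.sum_nonneg fun i _ => mul_self_nonneg _

theorem sq_dotProduct_le (v w : Fin d → ℝ) : (v ⬝ᵥ w) ^ 2 ≤ (v ⬝ᵥ v) * (w ⬝ᵥ w) := by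
  have := Finset.sum_mul_sq_le_sq_mul_sq Finset.univ v w
  simpa [dotProduct, sq] using this

theorem trace_eq_sum_quad (A : Matrix (Fin d) (Fin d) ℝ) :
    A.trace = ∑ j, quad A (Pi.single j 1) := by
  simp [Matrix.trace, quad]

theorem continuous_quad : Continuous fun p : Matrix (Fin d) (Fin d) ℝ × (Fin d → ℝ) =>
    quad p.1 p.2 := by
  unfold quad
  fun_prop

theorem posSemidef_of_quad {A : Matrix (Fin d) (Fin d) ℝ} (hs : A.IsSymm)
    (h : ∀ v, 0 ≤ quad A v) : A.PosSemidef := by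
  refine Matrix.PosSemidef.of_dotProduct_mulVec_nonneg ?_ fun v => by simpa [quad] using h v
  rw [Matrix.IsHermitian, Matrix.conjTranspose_eq_transpose_of_trivial]; exact hs

theorem posDef_of_quad {A : Matrix (Fin d) (Fin d) ℝ} (hs : A.IsSymm)
    (h : ∀ v, v ≠ 0 → 0 < quad A v) : A.PosDef := by
  refine Matrix.PosDef.of_dotProduct_mulVec_pos ?_ fun v hv => by simpa [quad] using h v hv
  rw [Matrix.IsHermitian, Matrix.conjTranspose_eq_transpose_of_trivial]; exact hs

open scoped MatrixOrder in
theorem exists_eq_transpose_mul_self {A : Matrix (Fin d) (Fin d) ℝ} (hs : A.IsSymm)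
    (h : ∀ v, 0 ≤ quad A v) : ∃ B : Matrix (Fin d) (Fin d) ℝ, A = Bᵀ * B := by
  obtain ⟨B, hB⟩ :=
    CStarAlgebra.nonneg_iff_eq_star_mul_self.mp (posSemidef_of_quad hs h).nonneg
  exact ⟨B, by rw [hB, Matrix.star_eq_conjTranspose,
    Matrix.conjTranspose_eq_transpose_of_trivial]⟩

/-- A positive semidefinite form is a sum of squares of linear forms. -/
theorem exists_sum_sq {A : Matrix (Fin d) (Fin d) ℝ} (hs : A.IsSymm) (h : ∀ v, 0 ≤ quad A v) :
    ∃ B : Fin d → Fin d → ℝ, (∀ v, quad A v = ∑ k, (B k ⬝ᵥ v) ^ 2) ∧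
      A.trace = ∑ k, B k ⬝ᵥ B k := by
  obtain ⟨B, rfl⟩ := exists_eq_transpose_mul_self hs h
  refine ⟨B, fun v => ?_, ?_⟩
  · rw [quad, ← Matrix.mulVec_mulVec, Matrix.dotProduct_mulVec,
      Matrix.vecMul_transpose]
    simp only [dotProduct, Matrix.mulVec, sq]
  · simp only [Matrix.trace, Matrix.diag_apply, Matrix.mul_apply, Matrix.transpose_apply,
      dotProduct]
    rw [Finset.sum_comm]

theorem trace_nonneg_of_quad {A : Matrix (Fin d) (Fin d) ℝ} (h : ∀ v, 0 ≤ quad A v) :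
    0 ≤ A.trace := by
  rw [trace_eq_sum_quad]; exact Finset.sum_nonneg fun j _ => h _

theorem quad_le_trace_mul {A : Matrix (Fin d) (Fin d) ℝ} (hs : A.IsSymm) (h : ∀ v, 0 ≤ quad A v)
    (v : Fin d → ℝ) : quad A v ≤ A.trace * (v ⬝ᵥ v) := by
  obtain ⟨B, hB, ht⟩ := exists_sum_sq hs h
  rw [hB, ht, Finset.sum_mul]
  exact Finset.sum_le_sum fun k _ => sq_dotProduct_le _ _

/-- Expand each square of `exists_sum_sq` and use Cauchy–Schwarz. The error is measured by the trace
and not by `quad A w`, since A may degenerate at w; nondegeneracy will compensate for this after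
summation over the branches. -/
theorem quad_add_le {A : Matrix (Fin d) (Fin d) ℝ} (hs : A.IsSymm) (h : ∀ v, 0 ≤ quad A v)
    {w u : Fin d → ℝ} {p q s : ℝ} (hp : 0 ≤ p) (hq : 0 ≤ q) (hs0 : 0 ≤ s)
    (hw : w ⬝ᵥ w ≤ p ^ 2 * s) (hu : u ⬝ᵥ u ≤ q ^ 2 * s) :
    quad A (w + u) ≤ quad A w + A.trace * ((2 * p * q + q ^ 2) * s) := by
  obtain ⟨B, hB, ht⟩ := exists_sum_sq hs h
  rw [hB, hB, ht, Finset.sum_mul, ← Finset.sum_add_distrib]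
  refine Finset.sum_le_sum fun k _ => ?_
  have hk := dotProduct_self_nonneg' (B k)
  have h1 : (B k ⬝ᵥ w) ^ 2 ≤ (B k ⬝ᵥ B k) * (p ^ 2 * s) :=
    (sq_dotProduct_le _ _).trans (mul_le_mul_of_nonneg_left hw hk)
  have h2 : (B k ⬝ᵥ u) ^ 2 ≤ (B k ⬝ᵥ B k) * (q ^ 2 * s) :=
    (sq_dotProduct_le _ _).trans (mul_le_mul_of_nonneg_left hu hk)
  have h3 : (B k ⬝ᵥ w) * (B k ⬝ᵥ u) ≤ (B k ⬝ᵥ B k) * (p * q * s) := by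
    refine le_trans (le_abs_self _) (abs_le_of_sq_le_sq ?_ (by positivity))
    calc ((B k ⬝ᵥ w) * (B k ⬝ᵥ u)) ^ 2 = (B k ⬝ᵥ w) ^ 2 * (B k ⬝ᵥ u) ^ 2 := by ring
      _ ≤ ((B k ⬝ᵥ B k) * (p ^ 2 * s)) * ((B k ⬝ᵥ B k) * (q ^ 2 * s)) :=
        mul_le_mul h1 h2 (sq_nonneg _) (by positivity)
      _ = _ := by ring
  rw [dotProduct_add]
  nlinarith

/-- With A = ᵗB B, every row of B selects its own branch from the nondegeneracy hypothesis, and the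
other terms are dropped. Even a form A of rank one thus becomes definite after one step. -/
theorem le_sum_quad_of_nondegenerate {n : ℕ} {A : Matrix (Fin d) (Fin d) ℝ} (hs : A.IsSymm)
    (h : ∀ v, 0 ≤ quad A v) {b : ℝ} (D : Fin n → Matrix (Fin d) (Fin d) ℝ) (v : Fin d → ℝ)
    (hD : ∀ u : Fin d → ℝ, ∃ i, b ^ 2 * (v ⬝ᵥ v) * (u ⬝ᵥ u) ≤ (u ⬝ᵥ D i *ᵥ v) ^ 2) :
    b ^ 2 * A.trace * (v ⬝ᵥ v) ≤ ∑ i, quad A (D i *ᵥ v) := by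
  obtain ⟨B, hB, ht⟩ := exists_sum_sq hs h
  simp only [hB]
  rw [Finset.sum_comm, ht, Finset.mul_sum, Finset.sum_mul]
  refine Finset.sum_le_sum fun k _ => ?_
  obtain ⟨i, hi⟩ := hD (B k)
  calc _ = b ^ 2 * (v ⬝ᵥ v) * (B k ⬝ᵥ B k) := by ring
    _ ≤ _ := hi
    _ ≤ _ := Finset.single_le_sum (f := fun i => (B k ⬝ᵥ D i *ᵥ v) ^ 2)
        (fun i _ => sq_nonneg _) (Finset.mem_univ i)

/-- Polarization: the entries of a symmetric matrix in terms of its quadratic form. -/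
theorem entry_eq_quad {A : Matrix (Fin d) (Fin d) ℝ} (hs : A.IsSymm) (j k : Fin d) :
    A j k = (quad A (Pi.single j 1 + Pi.single k 1) - quad A (Pi.single j 1)
      - quad A (Pi.single k 1)) / 2 := by
  have : A k j = A j k := hs.apply j k
  simp [quad, Matrix.mulVec_add, dotProduct_add, add_dotProduct, this]
  ring

theorem abs_entry_le_of_quad {A : Matrix (Fin d) (Fin d) ℝ} (hs : A.IsSymm) {c : ℝ}
    (h : ∀ v, |quad A v| ≤ c * (v ⬝ᵥ v)) (j k : Fin d) : |A j k| ≤ 4 * c := by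
  have h1 := abs_le.1 (h (Pi.single j 1 + Pi.single k 1))
  have h2 := abs_le.1 (h (Pi.single j 1))
  have h3 := abs_le.1 (h (Pi.single k 1))
  simp only [dotProduct_add, add_dotProduct, single_dotProduct, Pi.single_eq_same, one_mul,
    mul_one] at h1 h2 h3
  have hc : 0 ≤ c := by linarith
  have e1 : ∀ i l : Fin d, (Pi.single i 1 : Fin d → ℝ) l ≤ 1 := fun i l => by
    rw [Pi.single_apply]; split_ifs <;> norm_num
  have e2 := mul_le_mul_of_nonneg_left (e1 j k) hc
  have e3 := mul_le_mul_of_nonneg_left (e1 k j) hc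
  -- The vector e_j + e_k has square norm at most 4, with equality for j = k; the factor 4 in the
  -- bound is not sharp.
  rw [entry_eq_quad hs, abs_le]
  constructor <;> linarith

theorem abs_quad_le_of_entry {A : Matrix (Fin d) (Fin d) ℝ} {c : ℝ}
    (h : ∀ j k, |A j k| ≤ c) (v : Fin d → ℝ) : |quad A v| ≤ d * c * (v ⬝ᵥ v) := by
  have e : quad A v = ∑ j, ∑ k, v j * A j k * v k := by
    simp only [quad, dotProduct, Matrix.mulVec, Finset.mul_sum, mul_assoc]
  rw [e]
  calc |∑ j, ∑ k, v j * A j k * v k| ≤ ∑ j, ∑ k, |v j * A j k * v k| :=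
        (Finset.abs_sum_le_sum_abs _ _).trans
          (Finset.sum_le_sum fun j _ => Finset.abs_sum_le_sum_abs _ _)
    _ ≤ ∑ j : Fin d, ∑ k : Fin d, c * ((v j ^ 2 + v k ^ 2) / 2) := by
        refine Finset.sum_le_sum fun j _ => Finset.sum_le_sum fun k _ => ?_
        have h1 := h j k
        have h0 := abs_nonneg (A j k)
        rw [abs_mul, abs_mul]
        have h2 : |v j| * |v k| ≤ (v j ^ 2 + v k ^ 2) / 2 := by
          nlinarith [sq_nonneg (|v j| - |v k|), sq_abs (v j), sq_abs (v k)]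
        calc |v j| * |A j k| * |v k| = |A j k| * (|v j| * |v k|) := by ring
          _ ≤ c * ((v j ^ 2 + v k ^ 2) / 2) := mul_le_mul h1 h2 (by positivity) (h0.trans h1)
    _ = d * c * (v ⬝ᵥ v) := by
        simp only [← Finset.mul_sum, ← Finset.sum_div, Finset.sum_add_distrib, Finset.sum_const,
          Finset.card_univ, Fintype.card_fin, nsmul_eq_mul, dotProduct, ← sq]
        ring

/-! ### The Hilbert–Schmidt product and norm. -/

theorem hsInner_eq_sum (A B : Matrix (Fin d) (Fin d) ℝ) :
    hsInner A B = ∑ j, ∑ k, A j k * B j k := by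
  simp only [hsInner, Matrix.trace, Matrix.diag_apply, Matrix.mul_apply, Matrix.transpose_apply]
  rw [Finset.sum_comm]

theorem hsNorm_sq (A : Matrix (Fin d) (Fin d) ℝ) : hsNorm A ^ 2 = ∑ j, ∑ k, A j k ^ 2 := by
  have h : hsInner A A = ∑ j, ∑ k, A j k ^ 2 := by simp only [hsInner_eq_sum, sq]
  rw [hsNorm, Real.sq_sqrt, h]
  rw [h]; positivity

theorem hsNorm_nonneg (A : Matrix (Fin d) (Fin d) ℝ) : 0 ≤ hsNorm A := Real.sqrt_nonneg _

theorem hsNorm_le_of_entry {A : Matrix (Fin d) (Fin d) ℝ} {c : ℝ} (hc : 0 ≤ c)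
    (h : ∀ j k, |A j k| ≤ c) : hsNorm A ≤ d * c := by
  refine abs_le_of_sq_le_sq' ?_ (by positivity) |>.2
  rw [hsNorm_sq]
  calc ∑ j, ∑ k, A j k ^ 2 ≤ ∑ j : Fin d, ∑ k : Fin d, c ^ 2 :=
        Finset.sum_le_sum fun j _ => Finset.sum_le_sum fun k _ => sq_le_sq' (by
          linarith [(abs_le.1 (h j k)).1]) (abs_le.1 (h j k)).2
    _ = _ := by simp; ring

/-- The Hilbert–Schmidt norm dominates the operator norm. -/
theorem mulVec_dotProduct_self_le (A : Matrix (Fin d) (Fin d) ℝ) (v : Fin d → ℝ) :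
    (A *ᵥ v) ⬝ᵥ (A *ᵥ v) ≤ hsNorm A ^ 2 * (v ⬝ᵥ v) := by
  rw [hsNorm_sq, dotProduct, Finset.sum_mul]
  refine Finset.sum_le_sum fun j _ => ?_
  have := sq_dotProduct_le (A j) v
  simpa [Matrix.mulVec, dotProduct, sq] using this

theorem hsInner_vecMulVec (v : Fin d → ℝ) (A : Matrix (Fin d) (Fin d) ℝ) :
    hsInner (Matrix.vecMulVec v v) A = quad A v := by
  simp only [hsInner_eq_sum, quad, dotProduct, Matrix.mulVec, Matrix.vecMulVec_apply,
    Finset.mul_sum]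
  exact Finset.sum_congr rfl fun j _ => Finset.sum_congr rfl fun k _ => by ring

/-- Cyclicity of the trace. This is the pointwise form of the adjoint of the Ruelle operator. -/
theorem hsInner_conj (A D T : Matrix (Fin d) (Fin d) ℝ) :
    hsInner (Dᵀ * A * D) T = hsInner A (D * T * Dᵀ) := by
  simp only [hsInner, Matrix.transpose_mul, Matrix.transpose_transpose]
  rw [Matrix.mul_assoc, Matrix.trace_mul_comm, ← Matrix.mul_assoc, ← Matrix.mul_assoc]

theorem quad_conj' (T D : Matrix (Fin d) (Fin d) ℝ) (v : Fin d → ℝ) :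
    quad (D * T * Dᵀ) v = quad T (Dᵀ *ᵥ v) := by
  simpa using quad_conj T Dᵀ v

/-- The Hilbert–Schmidt product of positive semidefinite matrices, bounded below. -/
theorem mul_trace_le_hsInner {A T : Matrix (Fin d) (Fin d) ℝ} {m : ℝ} (hT : T.IsSymm)
    (hT0 : ∀ v, 0 ≤ quad T v) (hA : ∀ v, m * (v ⬝ᵥ v) ≤ quad A v) :
    m * T.trace ≤ hsInner A T := by
  obtain ⟨B, rfl⟩ := exists_eq_transpose_mul_self hT hT0
  have e1 : (Bᵀ * B).trace = ∑ k, B k ⬝ᵥ B k := by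
    simp only [Matrix.trace, Matrix.diag_apply, Matrix.mul_apply, Matrix.transpose_apply,
      dotProduct]
    rw [Finset.sum_comm]
  have e2 : hsInner A (Bᵀ * B) = ∑ k, quad A (B k) := by
    have h1 : hsInner A (Bᵀ * B) = (B * A * Bᵀ).trace := by
      have := hsInner_conj A Bᵀ 1
      rw [Matrix.transpose_transpose, Matrix.mul_one] at this
      rw [← this, hsInner, Matrix.mul_one, Matrix.trace_transpose]
    rw [h1, trace_eq_sum_quad]
    refine Finset.sum_congr rfl fun k _ => ?_
    rw [quad_conj']
    congr 1
    ext l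
    simp
  rw [e1, e2, Finset.mul_sum]
  exact Finset.sum_le_sum fun k _ => hA _

theorem hsInner_add_left (A B T : Matrix (Fin d) (Fin d) ℝ) :
    hsInner (A + B) T = hsInner A T + hsInner B T := by
  simp [hsInner, Matrix.add_mul]

theorem hsInner_smul_left (a : ℝ) (A T : Matrix (Fin d) (Fin d) ℝ) :
    hsInner (a • A) T = a * hsInner A T := by
  simp [hsInner]

theorem hsInner_sum_left {ι : Type*} (s : Finset ι) (A : ι → Matrix (Fin d) (Fin d) ℝ)
    (T : Matrix (Fin d) (Fin d) ℝ) : hsInner (∑ i ∈ s, A i) T = ∑ i ∈ s, hsInner (A i) T := by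
  simp [hsInner, Matrix.transpose_sum, Finset.sum_mul, Matrix.trace_sum]

theorem hsInner_comm (A B : Matrix (Fin d) (Fin d) ℝ) : hsInner A B = hsInner B A := by
  simp only [hsInner_eq_sum, mul_comm]

/-- The matrix with a one in positions `(j, k)` and `(k, j)`, halved. -/
noncomputable def symUnit (j k : Fin d) : symMat d :=
  ⟨(1 / 2 : ℝ) • (Matrix.single j k 1 + Matrix.single k j 1), by
    change (_ : Matrix (Fin d) (Fin d) ℝ)ᵀ = _
    rw [Matrix.transpose_smul, Matrix.transpose_add, Matrix.transpose_single,
      Matrix.transpose_single, add_comm]⟩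

theorem hsInner_symUnit {T : Matrix (Fin d) (Fin d) ℝ} (hT : T.IsSymm) (j k : Fin d) :
    hsInner (symUnit j k : Matrix (Fin d) (Fin d) ℝ) T = T j k := by
  have h : ∀ a b : Fin d, hsInner (Matrix.single a b 1) T = T a b := fun a b => by
    rw [hsInner_eq_sum, Finset.sum_eq_single a, Finset.sum_eq_single b]
    · simp
    · intro k _ hk; simp [hk.symm]
    · simp
    · intro j _ hj; simp [hj.symm]
    · simp
  change hsInner ((1 / 2 : ℝ) • (Matrix.single j k 1 + Matrix.single k j 1)) T = _
  rw [hsInner_smul_left, hsInner_add_left, h, h, hT.apply j k]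
  ring

theorem sum_smul_symUnit {s : Fin d → Fin d → ℝ} (hs : ∀ j k, s j k = s k j) (p q : Fin d) :
    ((∑ j, ∑ k, s j k • symUnit j k : symMat d) : Matrix (Fin d) (Fin d) ℝ) p q = s p q := by
  have h1 : ((∑ j, ∑ k, s j k • symUnit j k : symMat d) : Matrix (Fin d) (Fin d) ℝ) =
      ∑ j, ∑ k, s j k • (symUnit j k : Matrix (Fin d) (Fin d) ℝ) := by
    simp only [AddSubmonoidClass.coe_finsetSum, Submodule.coe_smul]
  -- The entry is a pairing with `symUnit p q`. By symmetry of the pairing each summand becomes an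
  -- entry of `symUnit p q`, and the sum becomes the pairing of `symUnit p q` with the matrix s.
  rw [← hsInner_symUnit (∑ j, ∑ k, s j k • symUnit j k : symMat d).2 p q, hsInner_comm, h1]
  simp only [hsInner_sum_left, hsInner_smul_left, hsInner_symUnit (symUnit p q).2]
  have h2 := hsInner_symUnit (T := Matrix.of s) (Matrix.IsSymm.ext fun j k => hs _ _) p q
  rw [hsInner_comm, hsInner_eq_sum] at h2
  exact h2

end Quad


/-! ### Contraction of a cone by a linear operator -/

section ConeContraction

open Filter Topology

variable {E : Type*} [NormedAddCommGroup E] [NormedSpace ℝ E]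

/-- The operator `L` maps the closed convex cone `K` into a part of `K` of finite projective
diameter; `ℓ` is a functional that controls the norm on `K`. -/
structure ContractsCone (L : E →L[ℝ] E) (ℓ : E →L[ℝ] ℝ) (K : Set E) (C b ε : ℝ) : Prop where
  isClosed : IsClosed K
  add_mem : ∀ U ∈ K, ∀ V ∈ K, U + V ∈ K
  smul_mem : ∀ c : ℝ, 0 ≤ c → ∀ U ∈ K, c • U ∈ K
  map_mem : ∀ U ∈ K, L U ∈ K
  pos_C : 0 < C
  norm_le : ∀ U ∈ K, ‖U‖ ≤ C * ℓ U
  pos_b : 0 < b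
  le_map : ∀ U ∈ K, b * ℓ U ≤ ℓ (L U)
  pos_ε : 0 < ε
  ε_lt_one : ε < 1
  gap : ∀ U ∈ K, ∀ V ∈ K, ℓ (L V) • L U - (ε * ℓ (L U)) • L V ∈ K

namespace ContractsCone

variable {L : E →L[ℝ] E} {ℓ : E →L[ℝ] ℝ} {K : Set E} {C b ε : ℝ}

theorem nonneg (h : ContractsCone L ℓ K C b ε) {U : E} (hU : U ∈ K) : 0 ≤ ℓ U := by
  have := (norm_nonneg U).trans (h.norm_le U hU)
  exact nonneg_of_mul_nonneg_right this h.pos_C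

theorem map_pos (h : ContractsCone L ℓ K C b ε) {U : E} (hU : U ∈ K) (h0 : 0 < ℓ U) :
    0 < ℓ (L U) :=
  (mul_pos h.pos_b h0).trans_le (h.le_map U hU)

theorem pow_mem (h : ContractsCone L ℓ K C b ε) {U : E} (hU : U ∈ K) (n : ℕ) :
    (L ^ n) U ∈ K := by
  induction n with
  | zero => simpa
  | succ n ih => rw [pow_succ']; exact h.map_mem _ ih

theorem pow_pos (h : ContractsCone L ℓ K C b ε) {U : E} (hU : U ∈ K) (h0 : 0 < ℓ U) (n : ℕ) :
    0 < ℓ ((L ^ n) U) := by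
  induction n with
  | zero => simpa
  | succ n ih => rw [pow_succ']; exact h.map_pos (h.pow_mem hU n) ih

theorem le_div (h : ContractsCone L ℓ K C b ε) {A B : E} {t : ℝ} (hB : 0 < ℓ B)
    (ht : A - t • B ∈ K) : t ≤ ℓ A / ℓ B := by
  have := h.nonneg ht
  rw [map_sub, map_smul, smul_eq_mul] at this
  rw [le_div_iff₀ hB]; linarith

theorem div_le (h : ContractsCone L ℓ K C b ε) {A B : E} {T : ℝ} (hB : 0 < ℓ B)
    (hT : T • B - A ∈ K) : ℓ A / ℓ B ≤ T := by
  have := h.nonneg hT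
  rw [map_sub, map_smul, smul_eq_mul] at this
  rw [div_le_iff₀ hB]; linarith

/-- One contraction step: `gap`, applied to A - tB and B and divided by ℓ(LB), raises t to t + ε(r -
t), where r = ℓ(LA)/ℓ(LB). Applied to TB - A and B, it lowers T to T - ε(T - r). The interval [t, T]
shrinks by the factor 1 - ε, wherever r lies in it. -/
theorem map_sub_mem (h : ContractsCone L ℓ K C b ε) {A B : E} {t T : ℝ} (hBK : B ∈ K)
    (hB : 0 < ℓ B) (ht : A - t • B ∈ K) (hT : T • B - A ∈ K) :
    ∃ t' T', t ≤ t' ∧ T' - t' = (1 - ε) * (T - t) ∧ L A - t' • L B ∈ K ∧ T' • L B - L A ∈ K := by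
  have hp := h.map_pos hBK hB
  set r := ℓ (L A) / ℓ (L B) with hr
  have e0 : ℓ (L A) = r * ℓ (L B) := by rw [hr]; field_simp
  have h1 := h.smul_mem _ (inv_nonneg.2 hp.le) _ (h.gap _ ht _ hBK)
  have h2 := h.smul_mem _ (inv_nonneg.2 hp.le) _ (h.gap _ hT _ hBK)
  have htr : t ≤ r := h.le_div hp (by simpa using h.map_mem _ ht)
  refine ⟨t + ε * (r - t), T - ε * (T - r), ?_, by ring, ?_, ?_⟩
  · have := mul_nonneg h.pos_ε.le (sub_nonneg.2 htr); linarith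
  · convert h1 using 1
    simp only [map_sub, map_smul, smul_eq_mul, e0]
    match_scalars <;> field_simp <;> ring
  · convert h2 using 1
    simp only [map_sub, map_smul, smul_eq_mul, e0]
    match_scalars <;> field_simp

/-- Two orbits in the cone are comparable, with a ratio of exponentially small oscillation. -/
theorem exists_ratio_bounds (h : ContractsCone L ℓ K C b ε) {U V : E} (hU : U ∈ K) (hV : V ∈ K)
    (hU0 : 0 < ℓ U) (hV0 : 0 < ℓ V) : ∃ t₀ M : ℝ, 0 < t₀ ∧ 0 ≤ M ∧ ∀ n : ℕ, ∃ t T : ℝ, t₀ ≤ t ∧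
      T - t = (1 - ε) ^ n * M ∧ (L ^ (n + 1)) U - t • (L ^ (n + 1)) V ∈ K ∧
        T • (L ^ (n + 1)) V - (L ^ (n + 1)) U ∈ K := by
  have hU1 := h.map_pos hU hU0
  have hV1 := h.map_pos hV hV0
  have hε := h.pos_ε
  set r := ℓ (L U) / ℓ (L V) with hr
  have hr0 : 0 < r := div_pos hU1 hV1
  -- The initial bounds are `gap` for (U, V) and for (V, U). They hold only after one application of
  -- L, whence the exponents n + 1.
  have m1 : L U - (ε * r) • L V ∈ K := by
    convert h.smul_mem _ (inv_nonneg.2 hV1.le) _ (h.gap _ hU _ hV) using 1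
    match_scalars <;> field_simp <;> rw [hr] <;> field_simp
  have m2 : (r / ε) • L V - L U ∈ K := by
    convert h.smul_mem _ (inv_nonneg.2 (mul_pos hε hV1).le) _ (h.gap _ hV _ hU) using 1
    match_scalars <;> field_simp <;> rw [hr] <;> field_simp
  refine ⟨ε * r, r / ε - ε * r, mul_pos hε hr0, ?_, fun n => ?_⟩
  · have a1 := h.le_div hV1 m1
    have a2 := h.div_le hV1 m2
    linarith
  · induction n with
    | zero => exact ⟨ε * r, r / ε, le_rfl, by simp, by simpa using m1, by simpa using m2⟩
    | succ n ih =>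
      obtain ⟨t, T, h0, h1, h2, h3⟩ := ih
      obtain ⟨t', T', g0, g1, g2, g3⟩ :=
        h.map_sub_mem (h.pow_mem hV _) (h.pow_pos hV hV0 _) h2 h3
      rw [pow_succ' L (n + 1)]
      exact ⟨t', T', h0.trans g0, by rw [g1, h1]; ring, g2, g3⟩

/-- Write A - rB = (A - tB) - (r - t)B with r = ℓ(A)/ℓ(B). Both terms lie in the cone, where ℓ
dominates the norm. -/
theorem norm_sub_le (h : ContractsCone L ℓ K C b ε) {A B : E} {t T : ℝ} (hBK : B ∈ K)
    (hB : 0 < ℓ B) (ht : A - t • B ∈ K) (hT : T • B - A ∈ K) :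
    ‖A - (ℓ A / ℓ B) • B‖ ≤ 2 * C * (T - t) * ℓ B := by
  have h1 := h.le_div hB ht
  have h2 := h.div_le hB hT
  set r := ℓ A / ℓ B with hr
  have e0 : ℓ A = r * ℓ B := by rw [hr]; field_simp
  have h3 := h.norm_le _ ht
  have h4 := h.norm_le _ hBK
  rw [map_sub, map_smul, smul_eq_mul, e0] at h3
  have hC := h.pos_C
  calc ‖A - r • B‖ = ‖(A - t • B) - (r - t) • B‖ := by congr 1; module
    _ ≤ ‖A - t • B‖ + ‖(r - t) • B‖ := _root_.norm_sub_le _ _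
    _ ≤ C * (r * ℓ B - t * ℓ B) + (r - t) * (C * ℓ B) := by
        rw [norm_smul, Real.norm_of_nonneg (sub_nonneg.2 h1)]
        exact add_le_add h3 (mul_le_mul_of_nonneg_left h4 (sub_nonneg.2 h1))
    _ = 2 * C * (r - t) * ℓ B := by ring
    _ ≤ 2 * C * (T - t) * ℓ B := by gcongr

/-- An operator that contracts a cone has an eigenvector in the cone. -/
theorem exists_eigenvector [CompleteSpace E] (h : ContractsCone L ℓ K C b ε) {e : E} (he : e ∈ K)
    (he0 : 0 < ℓ e) : ∃ β : ℝ, 0 < β ∧ ∃ Q ∈ K, ℓ Q = 1 ∧ L Q = β • Q := by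
  -- The orbit of e is compared with the orbit of L e, that is, with itself one step later.
  obtain ⟨t₀, M, ht₀, hM, hb⟩ :=
    h.exists_ratio_bounds he (h.map_mem e he) he0 (h.map_pos he he0)
  have hC := h.pos_C
  set u : ℕ → E := fun n => (ℓ ((L ^ (n + 1)) e))⁻¹ • (L ^ (n + 1)) e with hu
  have hp : ∀ n, 0 < ℓ ((L ^ n) e) := h.pow_pos he he0
  have huK : ∀ n, u n ∈ K := fun n => h.smul_mem _ (inv_nonneg.2 (hp _).le) _ (h.pow_mem he _)
  have hu1 : ∀ n, ℓ (u n) = 1 := fun n => by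
    simp only [hu, map_smul, smul_eq_mul]; exact inv_mul_cancel₀ (hp _).ne'
  -- In the limit this identity becomes the eigenvalue equation, with eigenvalue ℓ(L Q).
  have hsucc : ∀ n, L (u n) = ℓ (L (u n)) • u (n + 1) := fun n => by
    have e1 : L (u n) = (ℓ ((L ^ (n + 1)) e))⁻¹ • (L ^ (n + 2)) e := by
      simp only [hu, map_smul]; rw [pow_succ' L (n + 1)]; rfl
    rw [e1, map_smul, smul_eq_mul, hu, smul_smul]
    congr 1
    rw [mul_assoc, mul_inv_cancel₀ (hp _).ne', mul_one]
  have hcau : CauchySeq u := by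
    refine cauchySeq_of_le_geometric (1 - ε) (2 * C * M / t₀) (by linarith [h.pos_ε])
      fun n => ?_
    obtain ⟨t, T, g0, g1, g2, g3⟩ := hb n
    have eL : (L ^ (n + 1)) (L e) = (L ^ (n + 2)) e := by rw [pow_succ L (n + 1)]; rfl
    rw [eL] at g2 g3
    set A := (L ^ (n + 1)) e with hA
    set B := (L ^ (n + 2)) e with hB
    have hA0 : 0 < ℓ A := hp _
    have hB0 : 0 < ℓ B := hp _
    have k1 := h.norm_sub_le (h.pow_mem he _) hB0 g2 g3
    have k2 := h.le_div hB0 g2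
    have e2 : u n - u (n + 1) = (ℓ A)⁻¹ • (A - (ℓ A / ℓ B) • B) := by
      change (ℓ A)⁻¹ • A - (ℓ B)⁻¹ • B = _
      match_scalars <;> field_simp
    rw [dist_eq_norm, e2, norm_smul, Real.norm_of_nonneg (inv_nonneg.2 hA0.le)]
    -- The uniform lower bound t₀ of the ratios controls the factor ℓ(B)/ℓ(A) left by the
    -- normalization.
    have k3 : t₀ * ℓ B ≤ ℓ A := by
      have := g0.trans k2
      rwa [le_div_iff₀ hB0] at this
    rw [inv_mul_le_iff₀ hA0]
    refine k1.trans ?_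
    rw [g1]
    have hM' : 0 ≤ 2 * C * M / t₀ * (1 - ε) ^ n := by
      have : 0 ≤ 1 - ε := by linarith [h.ε_lt_one]
      positivity
    calc 2 * C * ((1 - ε) ^ n * M) * ℓ B = 2 * C * M / t₀ * (1 - ε) ^ n * (t₀ * ℓ B) := by
          field_simp
      _ ≤ 2 * C * M / t₀ * (1 - ε) ^ n * ℓ A := mul_le_mul_of_nonneg_left k3 hM'
      _ = _ := by ring
  obtain ⟨Q, hQ⟩ := cauchySeq_tendsto_of_complete hcau
  have hQK : Q ∈ K := h.isClosed.mem_of_tendsto hQ (Eventually.of_forall huK)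
  have hQ1 : ℓ Q = 1 := by
    refine tendsto_nhds_unique ((ℓ.continuous.tendsto Q).comp hQ) ?_
    simp only [Function.comp_def, hu1]; exact tendsto_const_nhds
  refine ⟨ℓ (L Q), h.map_pos hQK (by rw [hQ1]; exact one_pos), Q, hQK, hQ1, ?_⟩
  have l1 : Tendsto (fun n => L (u n)) atTop (𝓝 (L Q)) := (L.continuous.tendsto Q).comp hQ
  have l2 : Tendsto (fun n => ℓ (L (u n)) • u (n + 1)) atTop (𝓝 (ℓ (L Q) • Q)) :=
    ((ℓ.continuous.tendsto _).comp l1).smul (hQ.comp (tendsto_add_atTop_nat 1))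
  exact tendsto_nhds_unique l1 (l2.congr fun n => (hsucc n).symm)

/-- Normalized orbits in the cone converge to multiples of the eigenvector. -/
theorem exists_tendsto (h : ContractsCone L ℓ K C b ε) {Q : E} (hQ : Q ∈ K) (hQ1 : ℓ Q = 1)
    {β : ℝ} (hβ : 0 < β) (hL : L Q = β • Q) {A : E} (hA : A ∈ K) :
    ∃ c : ℝ, Tendsto (fun n => (β ^ n)⁻¹ • (L ^ n) A) atTop (𝓝 (c • Q)) := by
  have hLn : ∀ n, (L ^ n) Q = β ^ n • Q := fun n => by
    induction n with
    | zero => simp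
    | succ n ih =>
      rw [pow_succ', mul_apply_eq_comp, ih, map_smul, hL, smul_smul, pow_succ]
  rcases (h.nonneg hA).eq_or_lt with h0 | h0
  · have hA0 : A = 0 := by
      have := h.norm_le A hA
      rw [← h0, mul_zero] at this
      exact norm_le_zero_iff.1 this
    exact ⟨0, by simp [hA0]⟩
  obtain ⟨t₀, M, ht₀, hM, hb⟩ := h.exists_ratio_bounds hA hQ h0 (by rw [hQ1]; exact one_pos)
  set a : ℕ → E := fun n => (β ^ n)⁻¹ • (L ^ n) A with ha
  have hβn : ∀ n, 0 < β ^ n := fun n => _root_.pow_pos hβ n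
  have step : ∀ n, L (a n) = β • a (n + 1) := fun n => by
    simp only [ha, map_smul, smul_smul]
    rw [pow_succ' L n, mul_apply_eq_comp]
    congr 1
    rw [pow_succ]
    field_simp
  -- Since β⁻¹ L preserves the cone and fixes Q, the bounds found at time n + 1 persist. All later
  -- values ℓ(a m) lie in one interval of length (1 - ε)ⁿ M, which makes them a Cauchy sequence.
  have key : ∀ n, ∃ t T : ℝ, T - t = (1 - ε) ^ n * M ∧ ∀ m, n + 1 ≤ m →
      a m - t • Q ∈ K ∧ T • Q - a m ∈ K := fun n => by
    obtain ⟨t, T, -, g1, g2, g3⟩ := hb n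
    refine ⟨t, T, g1, fun m hm => ?_⟩
    induction m, hm using Nat.le_induction with
    | base =>
      rw [hLn] at g2 g3
      constructor
      · convert h.smul_mem _ (inv_nonneg.2 (hβn (n + 1)).le) _ g2 using 1
        match_scalars <;> field_simp
      · convert h.smul_mem _ (inv_nonneg.2 (hβn (n + 1)).le) _ g3 using 1
        match_scalars <;> field_simp
    | succ m _ ih =>
      constructor
      · convert h.smul_mem _ (inv_nonneg.2 hβ.le) _ (h.map_mem _ ih.1) using 1
        rw [map_sub, step, map_smul, hL]
        match_scalars <;> field_simp
      · convert h.smul_mem _ (inv_nonneg.2 hβ.le) _ (h.map_mem _ ih.2) using 1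
        rw [map_sub, step, map_smul, hL]
        match_scalars <;> field_simp
  have hQ0 : 0 < ℓ Q := by rw [hQ1]; exact one_pos
  have hgeo : Tendsto (fun n => (1 - ε) ^ n * M) atTop (𝓝 0) := by
    have := tendsto_pow_atTop_nhds_zero_of_lt_one (r := 1 - ε) (by linarith [h.ε_lt_one])
      (by linarith [h.pos_ε])
    simpa using this.mul_const M
  have hcau : CauchySeq fun n => ℓ (a n) := by
    refine Metric.cauchySeq_iff'.2 fun δ hδ => ?_
    obtain ⟨n, hn⟩ := (hgeo.eventually (gt_mem_nhds hδ)).exists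
    obtain ⟨t, T, g1, g2⟩ := key n
    refine ⟨n + 1, fun m hm => ?_⟩
    have p1 := h.le_div hQ0 (g2 m hm).1
    have p2 := h.div_le hQ0 (g2 m hm).2
    have p3 := h.le_div hQ0 (g2 _ le_rfl).1
    have p4 := h.div_le hQ0 (g2 _ le_rfl).2
    rw [hQ1, div_one] at p1 p2 p3 p4
    rw [Real.dist_eq, abs_lt]
    constructor <;> linarith
  obtain ⟨c, hc⟩ := cauchySeq_tendsto_of_complete hcau
  refine ⟨c, ?_⟩
  have hd : Tendsto (fun n => a n - ℓ (a n) • Q) atTop (𝓝 0) := by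
    rw [← tendsto_add_atTop_iff_nat 1]
    refine squeeze_zero_norm (fun n => ?_) (by simpa using hgeo.const_mul (2 * C))
    obtain ⟨t, T, g1, g2⟩ := key n
    have := h.norm_sub_le hQ hQ0 (g2 _ le_rfl).1 (g2 _ le_rfl).2
    rw [hQ1, div_one, mul_one, g1] at this
    exact this
  simpa using hd.add (hc.smul_const Q)

end ContractsCone

end ConeContraction


/-! ### The sup norm on symmetric matrices -/

section SymMatNorm

/-- The sup norm of the entries, as a norm on the symmetric matrices that is compatible with their
uniform structure. -/
@[reducible]
noncomputable def symMatNormedAddCommGroup (d : ℕ) : NormedAddCommGroup (symMat d) where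
  toAddCommGroup := inferInstance
  norm A := ‖fun j k => (A : Matrix (Fin d) (Fin d) ℝ) j k‖
  toMetricSpace := @MetricSpace.replaceUniformity (symMat d) instUniformSpaceSubtype
    (MetricSpace.induced (fun (A : symMat d) (j k : Fin d) => (A : Matrix (Fin d) (Fin d) ℝ) j k)
      (fun _ _ h => Subtype.ext h) inferInstance) rfl
  dist_eq A B := by
    have h : ∀ f g : Fin d → Fin d → ℝ, dist f g = ‖-f + g‖ := fun f g => dist_eq_norm_neg_add f g
    exact h _ _

attribute [local instance] symMatNormedAddCommGroup

/-- The normed space structure that belongs to `symMatNormedAddCommGroup`. -/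
@[reducible]
noncomputable def symMatNormedSpace (d : ℕ) : NormedSpace ℝ (symMat d) where
  norm_smul_le c A := by
    change ‖c • fun j k => (A : Matrix (Fin d) (Fin d) ℝ) j k‖ ≤ _
    exact norm_smul_le _ _

attribute [local instance] symMatNormedSpace

instance symMat_completeSpace (d : ℕ) : CompleteSpace (symMat d) := FiniteDimensional.complete ℝ _

theorem symMat_norm_le_iff {d : ℕ} {A : symMat d} {r : ℝ} (hr : 0 ≤ r) :
    ‖A‖ ≤ r ↔ ∀ j k, |(A : Matrix (Fin d) (Fin d) ℝ) j k| ≤ r := by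
  change ‖fun j k => (A : Matrix (Fin d) (Fin d) ℝ) j k‖ ≤ r ↔ _
  simp [pi_norm_le_iff_of_nonneg hr]

end SymMatNorm

/-- The constant of the cone contraction, for scalars. -/
theorem sub_le_exp_mul_sub {α α' γ γ' ρ θ R : ℝ} (hα' : 0 ≤ α') (hγ' : 0 ≤ γ')
    (hρ : 0 ≤ ρ) (hρ1 : ρ ≤ 1) (hθ : 0 ≤ θ) (hθ1 : θ < 1) (hR : 0 < R)
    (h1 : α ≤ Real.exp (θ * ρ) * α') (h2 : γ' ≤ Real.exp (θ * ρ) * γ) (h3 : γ' ≤ R * α') :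
    α - (1 - θ) / (2 * Real.exp 1 * R) * γ ≤
      Real.exp ρ * (α' - (1 - θ) / (2 * Real.exp 1 * R) * γ') := by
  set ε := (1 - θ) / (2 * Real.exp 1 * R) with hε
  have he := Real.exp_pos 1
  have hε0 : 0 < ε := div_pos (by linarith) (by positivity)
  -- The claim is ε(e^ρ γ' - γ) ≤ e^ρ α' - α. The right side is at least (e^ρ - e^{θρ}) α', and the
  -- left side is at most ε(e^ρ - e^{-θρ}) γ'. Both differences of exponentials are linear in ρ up
  -- to constants, so the comparison γ' ≤ R α' and the choice of ε finish the argument.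
  have e1 : (1 - θ) * ρ ≤ Real.exp ρ - Real.exp (θ * ρ) := by
    have a1 : Real.exp ρ = Real.exp (θ * ρ) * Real.exp ((1 - θ) * ρ) := by
      rw [← Real.exp_add]; ring_nf
    have a2 := Real.add_one_le_exp ((1 - θ) * ρ)
    have a3 : 1 ≤ Real.exp (θ * ρ) := Real.one_le_exp (by positivity)
    have a4 : 0 ≤ (1 - θ) * ρ := mul_nonneg (by linarith) hρ
    nlinarith
  have e2 : Real.exp ρ - Real.exp (-(θ * ρ)) ≤ 2 * Real.exp 1 * ρ := by
    have a1 := Real.add_one_le_exp (-(θ * ρ))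
    have a2 : θ * ρ ≤ ρ := by nlinarith
    have a3 : Real.exp ρ - 1 ≤ Real.exp 1 * ρ := by
      have b1 := Real.add_one_le_exp (-ρ)
      have b2 : Real.exp ρ * Real.exp (-ρ) = 1 := by rw [← Real.exp_add]; simp
      have b3 : Real.exp ρ ≤ Real.exp 1 := Real.exp_le_exp.2 hρ1
      have b4 := Real.exp_pos ρ
      nlinarith
    have a4 : 1 ≤ Real.exp 1 := Real.one_le_exp zero_le_one
    nlinarith
  have h2' : Real.exp (-(θ * ρ)) * γ' ≤ γ := by
    rw [Real.exp_neg, inv_mul_le_iff₀ (Real.exp_pos _)]; exact h2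
  have l1 : Real.exp ρ * γ' - γ ≤ 2 * Real.exp 1 * ρ * γ' := by
    nlinarith [mul_le_mul_of_nonneg_right e2 hγ']
  have l2 : (1 - θ) * ρ * α' ≤ Real.exp ρ * α' - α := by
    nlinarith [mul_le_mul_of_nonneg_right e1 hα']
  have l3 : ε * (2 * Real.exp 1 * ρ * γ') ≤ (1 - θ) * ρ * α' := by
    calc ε * (2 * Real.exp 1 * ρ * γ') ≤ ε * (2 * Real.exp 1 * ρ * (R * α')) := by gcongr
      _ = _ := by rw [hε]; field_simp
  have l4 := mul_le_mul_of_nonneg_left l1 hε0.le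
  linarith

namespace FractalSystem

variable {d n : ℕ} {ν η : ℝ≥0} (S : FractalSystem d n ν η)

instance compactSpace : CompactSpace S.G := isCompact_iff_compactSpace.1 S.isCompact

instance nonempty_G : Nonempty S.G := S.nonempty.to_subtype

/-! ### Derivatives of the maps -/

theorem jac_mulVec (f : Euc d → Euc d) (x : Euc d) (v : Fin d → ℝ) :
    jac f x *ᵥ v = (fderiv ℝ f x (WithLp.toLp 2 v)).ofLp := by
  have := Matrix.ofLp_toEuclideanCLM (n := Fin d) (𝕜 := ℝ) (jac f x) (WithLp.toLp 2 v)
  rw [jac, StarAlgEquiv.apply_symm_apply] at this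
  exact this.symm

theorem dotProduct_self_eq_norm_sq (v : Euc d) : v.ofLp ⬝ᵥ v.ofLp = ‖v‖ ^ 2 := by
  rw [EuclideanSpace.real_norm_sq_eq]; simp [dotProduct, sq]

theorem jac_mulVec_le (i : Fin n) (x : Euc d) (v : Fin d → ℝ) :
    (jac (S.ψ i) x *ᵥ v) ⬝ᵥ (jac (S.ψ i) x *ᵥ v) ≤ (η : ℝ) ^ 2 * (v ⬝ᵥ v) := by
  rw [jac_mulVec, dotProduct_self_eq_norm_sq]
  have h1 : v ⬝ᵥ v = ‖(WithLp.toLp 2 v : Euc d)‖ ^ 2 := by rw [← dotProduct_self_eq_norm_sq]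
  rw [h1, ← mul_pow]
  gcongr
  refine (ContinuousLinearMap.le_opNorm _ _).trans ?_
  gcongr
  exact norm_fderiv_le_of_lipschitz ℝ (S.lipschitz i)

variable {S} in
theorem Nondegenerate.exists_le {b : ℝ} (hb : 0 ≤ b) (h : S.Nondegenerate b) (x : S.G)
    (v u : Fin d → ℝ) :
    ∃ i, b ^ 2 * (v ⬝ᵥ v) * (u ⬝ᵥ u) ≤ (u ⬝ᵥ jac (S.ψ i) x *ᵥ v) ^ 2 := by
  obtain ⟨i, hi⟩ := h x x.2 (WithLp.toLp 2 v) (WithLp.toLp 2 u)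
  refine ⟨i, ?_⟩
  have h1 : ∀ v : Fin d → ℝ, v ⬝ᵥ v = ‖(WithLp.toLp 2 v : Euc d)‖ ^ 2 := fun v => by
    rw [← dotProduct_self_eq_norm_sq]
  rw [EuclideanSpace.inner_eq_star_dotProduct, star_trivial, ← jac_mulVec] at hi
  rw [h1 v, h1 u, ← mul_pow, ← mul_pow, ← sq_abs (u ⬝ᵥ _)]
  gcongr

/-! ### The rescaled distance -/

/-- The distance of `ℝᵈ` rescaled to give `G` diameter at most one, to the power `ν`. -/
noncomputable def relDist (x y : S.G) : ℝ := (dist x y / Metric.diam S.G) ^ (ν : ℝ)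

theorem relDist_nonneg (x y : S.G) : 0 ≤ S.relDist x y := by
  unfold relDist; positivity

theorem dist_le_diam (x y : S.G) : dist x y ≤ Metric.diam S.G :=
  Metric.dist_le_diam_of_mem S.isCompact.isBounded x.2 y.2

theorem div_diam_le_one (x y : S.G) : dist x y / Metric.diam S.G ≤ 1 :=
  div_le_one_of_le₀ (S.dist_le_diam x y) Metric.diam_nonneg

theorem relDist_le_one (x y : S.G) : S.relDist x y ≤ 1 :=
  Real.rpow_le_one (by positivity) (S.div_diam_le_one x y) ν.2

theorem relDist_comm (x y : S.G) : S.relDist x y = S.relDist y x := by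
  simp [relDist, dist_comm]

/-- As t ≤ t^ν for 0 ≤ t ≤ 1, a Lipschitz function is Hölder for the rescaled distance. If G is a
single point, its diameter is zero and so is the distance. -/
theorem dist_le_relDist (hν1 : ν ≤ 1) (x y : S.G) :
    dist x y ≤ Metric.diam S.G * S.relDist x y := by
  have h : dist x y = Metric.diam S.G * (dist x y / Metric.diam S.G) := by
    rcases eq_or_ne (Metric.diam S.G) 0 with h0 | h0
    · have := S.dist_le_diam x y
      rw [h0] at this ⊢
      rw [zero_mul]; exact le_antisymm this dist_nonneg
    · field_simp
  refine h.le.trans (mul_le_mul_of_nonneg_left ?_ Metric.diam_nonneg)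
  exact Real.self_le_rpow_of_le_one (by positivity) (S.div_diam_le_one x y) (by exact_mod_cast hν1)

theorem relDist_ψG_le (i : Fin n) (x y : S.G) :
    S.relDist (S.ψG i x) (S.ψG i y) ≤ (η : ℝ) ^ (ν : ℝ) * S.relDist x y := by
  rw [relDist, relDist, ← Real.mul_rpow NNReal.zero_le_coe (by positivity), ← mul_div_assoc]
  refine Real.rpow_le_rpow (by positivity) ?_ ν.2
  gcongr
  exact (S.lipschitz i).dist_le_mul x y

variable {S} in
theorem HolderSmall.hsNorm_le {ω : ℝ} (hω : S.HolderSmall ω) (i : Fin n)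
    (x y : S.G) : hsNorm (jac (S.ψ i) x - jac (S.ψ i) y) ≤ ω * S.relDist x y := by
  -- Only off the diagonal is the diameter known to be positive, so that one can divide by its
  -- power.
  rcases eq_or_ne x y with rfl | hxy
  · rcases eq_or_ne (ν : ℝ) 0 with h0 | h0
    · have := hω i x x.2 x x.2
      simp only [h0, Real.rpow_zero, one_mul, mul_one] at this
      simpa [relDist, h0] using this
    · simp [relDist, hsNorm, hsInner, Real.zero_rpow h0]
  · have hd : 0 < Metric.diam S.G := (dist_pos.2 hxy).trans_le (S.dist_le_diam x y)
    have h1 := hω i x x.2 y y.2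
    have h2 : 0 < Metric.diam S.G ^ (ν : ℝ) := Real.rpow_pos_of_pos hd _
    rw [relDist, Real.div_rpow dist_nonneg hd.le, ← mul_div_assoc, le_div_iff₀ h2, mul_comm]
    exact h1

/-! ### The cone of log-Hölder positive functions -/

theorem isSymm_apply (A : C(S.G, symMat d)) (x : S.G) :
    (A x : Matrix (Fin d) (Fin d) ℝ).IsSymm := (A x).2

theorem coe_ruelle (A : C(S.G, symMat d)) (x : S.G) :
    (S.ruelle A x : Matrix (Fin d) (Fin d) ℝ) =
      ∑ i, (jac (S.ψ i) x)ᵀ * (A (S.ψG i x) : Matrix (Fin d) (Fin d) ℝ) * jac (S.ψ i) x := rfl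

theorem quad_ruelle (A : C(S.G, symMat d)) (x : S.G) (v : Fin d → ℝ) :
    quad (S.ruelle A x : Matrix (Fin d) (Fin d) ℝ) v =
      ∑ i, quad (A (S.ψG i x) : Matrix (Fin d) (Fin d) ℝ) (jac (S.ψ i) x *ᵥ v) := by
  rw [coe_ruelle, quad_sum]
  exact Finset.sum_congr rfl fun i _ => quad_conj _ _ _

/-- The cone of the positive semidefinite functions whose logarithm is `ν`-Hölder with constant
one, in the sense of quadratic forms and for the rescaled distance. -/
def logHolderCone : Set C(S.G, symMat d) :=
  {A | (∀ x v, 0 ≤ quad (A x : Matrix (Fin d) (Fin d) ℝ) v) ∧ ∀ x y v,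
    quad (A x : Matrix (Fin d) (Fin d) ℝ) v ≤
      Real.exp (S.relDist x y) * quad (A y : Matrix (Fin d) (Fin d) ℝ) v}

variable {S}

theorem quad_le_exp_one_mul {A : C(S.G, symMat d)} (hA : A ∈ S.logHolderCone) (x y : S.G)
    (v : Fin d → ℝ) : quad (A x : Matrix (Fin d) (Fin d) ℝ) v ≤
      Real.exp 1 * quad (A y : Matrix (Fin d) (Fin d) ℝ) v :=
  (hA.2 x y v).trans (mul_le_mul_of_nonneg_right
    (Real.exp_le_exp.2 (S.relDist_le_one x y)) (hA.1 y v))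

theorem trace_le_exp_one_mul {A : C(S.G, symMat d)} (hA : A ∈ S.logHolderCone) (x y : S.G) :
    (A x : Matrix (Fin d) (Fin d) ℝ).trace ≤
      Real.exp 1 * (A y : Matrix (Fin d) (Fin d) ℝ).trace := by
  rw [trace_eq_sum_quad, trace_eq_sum_quad, Finset.mul_sum]
  exact Finset.sum_le_sum fun j _ => quad_le_exp_one_mul hA x y _

/-- The trace dominates a positive form, the derivatives have norm at most one, and values of A at
different points differ by a factor of at most e. With `le_quad_ruelle` this makes the images of all
cone elements comparable to one another. -/
theorem quad_ruelle_le {A : C(S.G, symMat d)} (hη : η ≤ 1) (hA : A ∈ S.logHolderCone) (x z : S.G)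
    (v : Fin d → ℝ) : quad (S.ruelle A x : Matrix (Fin d) (Fin d) ℝ) v ≤
      Real.exp 1 * n * (A z : Matrix (Fin d) (Fin d) ℝ).trace * (v ⬝ᵥ v) := by
  rw [quad_ruelle]
  have ht := trace_nonneg_of_quad (hA.1 z)
  have hv := dotProduct_self_nonneg' v
  calc _ ≤ ∑ i : Fin n, Real.exp 1 * ((A z : Matrix (Fin d) (Fin d) ℝ).trace * (v ⬝ᵥ v)) := by
        refine Finset.sum_le_sum fun i _ => (quad_le_exp_one_mul hA _ z _).trans ?_
        gcongr
        refine (quad_le_trace_mul (S.isSymm_apply A z) (hA.1 z) _).trans ?_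
        gcongr
        refine (S.jac_mulVec_le i x v).trans ?_
        have : (η : ℝ) ^ 2 ≤ 1 := pow_le_one₀ η.2 (by exact_mod_cast hη)
        nlinarith
    _ = _ := by simp; ring

/-- The values A(ψ_i x) are replaced by the single form A(z), at the cost of a factor e.
Nondegeneracy then applies to one form and all branches. -/
theorem le_quad_ruelle {A : C(S.G, symMat d)} {b : ℝ} (hb : 0 ≤ b) (hN : S.Nondegenerate b)
    (hA : A ∈ S.logHolderCone) (x z : S.G) (v : Fin d → ℝ) :
    Real.exp (-1) * b ^ 2 * (A z : Matrix (Fin d) (Fin d) ℝ).trace * (v ⬝ᵥ v) ≤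
      quad (S.ruelle A x : Matrix (Fin d) (Fin d) ℝ) v := by
  rw [quad_ruelle]
  calc _ = Real.exp (-1) * (b ^ 2 * (A z : Matrix (Fin d) (Fin d) ℝ).trace * (v ⬝ᵥ v)) := by ring
    _ ≤ Real.exp (-1) * ∑ i, quad (A z : Matrix (Fin d) (Fin d) ℝ) (jac (S.ψ i) x *ᵥ v) := by
        gcongr
        exact le_sum_quad_of_nondegenerate (S.isSymm_apply A z) (hA.1 z) _ v
          (hN.exists_le hb x v)
    _ ≤ _ := by
        rw [Finset.mul_sum]
        refine Finset.sum_le_sum fun i _ => ?_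
        rw [Real.exp_neg, inv_mul_le_iff₀ (Real.exp_pos _)]
        exact quad_le_exp_one_mul hA _ _ _

/-- The improved Hölder constant η^ν + s: the first term comes from the contraction of distances,
the second from the variation of the derivatives. The hypothesis `hs` is the smallness of ω that
lets s pay for the latter. -/
theorem quad_ruelle_le_exp_mul {A : C(S.G, symMat d)} {b ω s : ℝ} (hη : η ≤ 1) (hb : 0 < b)
    (hN : S.Nondegenerate b) (hω0 : 0 ≤ ω) (hω1 : ω ≤ 1) (hω : S.HolderSmall ω)
    (hs : 3 * n * ω * Real.exp 2 ≤ s * b ^ 2) (hA : A ∈ S.logHolderCone) (x y : S.G)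
    (v : Fin d → ℝ) : quad (S.ruelle A x : Matrix (Fin d) (Fin d) ℝ) v ≤
      Real.exp (((η : ℝ) ^ (ν : ℝ) + s) * S.relDist x y) *
        quad (S.ruelle A y : Matrix (Fin d) (Fin d) ℝ) v := by
  set ρ := S.relDist x y with hρ
  have hρ0 : 0 ≤ ρ := S.relDist_nonneg x y
  have hρ1 : ρ ≤ 1 := S.relDist_le_one x y
  have hv := dotProduct_self_nonneg' v
  set t := (A y : Matrix (Fin d) (Fin d) ℝ).trace with ht
  have ht0 : 0 ≤ t := trace_nonneg_of_quad (hA.1 y)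
  have hη1 : (η : ℝ) ≤ 1 := by exact_mod_cast hη
  have h1 : ∀ i, quad (A (S.ψG i x) : Matrix (Fin d) (Fin d) ℝ) (jac (S.ψ i) x *ᵥ v) ≤
      Real.exp ((η : ℝ) ^ (ν : ℝ) * ρ) *
        (quad (A (S.ψG i y) : Matrix (Fin d) (Fin d) ℝ) (jac (S.ψ i) y *ᵥ v) +
          Real.exp 1 * t * (3 * ω * ρ * (v ⬝ᵥ v))) := fun i => by
    refine (hA.2 _ (S.ψG i y) _).trans ?_
    refine mul_le_mul (Real.exp_le_exp.2 (S.relDist_ψG_le i x y)) ?_ (hA.1 _ _)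
      (Real.exp_pos _).le
    -- The vector is moved from x to y. Its change has norm at most ωρ‖v‖, and 2ωρ + (ωρ)² ≤ 3ωρ
    -- because ωρ ≤ 1.
    have e1 : jac (S.ψ i) x *ᵥ v =
        jac (S.ψ i) y *ᵥ v + (jac (S.ψ i) x - jac (S.ψ i) y) *ᵥ v := by
      rw [Matrix.sub_mulVec]; abel
    rw [e1]
    refine (quad_add_le (S.isSymm_apply A _) (hA.1 _) (p := 1) (q := ω * ρ) zero_le_one
      (by positivity) hv ?_ ?_).trans ?_
    · refine (S.jac_mulVec_le i y v).trans ?_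
      have : (η : ℝ) ^ 2 ≤ 1 ^ 2 := pow_le_pow_left₀ η.2 hη1 2
      exact mul_le_mul_of_nonneg_right this hv
    · refine (mulVec_dotProduct_self_le _ _).trans (mul_le_mul_of_nonneg_right ?_ hv)
      exact pow_le_pow_left₀ (hsNorm_nonneg _) (hω.hsNorm_le i x y) 2
    · gcongr
      · exact trace_le_exp_one_mul hA _ _
      · have : ω * ρ ≤ 1 := mul_le_one₀ hω1 hρ0 hρ1
        nlinarith [mul_nonneg hω0 hρ0]
  have h2 := le_quad_ruelle hb.le hN hA y y v
  -- The total error is absorbed by the lower bound `h2` for L A at y. The remaining factor 1 + sρ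
  -- is at most e^{sρ}.
  have h3 : ∑ i : Fin n, Real.exp 1 * t * (3 * ω * ρ * (v ⬝ᵥ v)) ≤
      s * ρ * quad (S.ruelle A y : Matrix (Fin d) (Fin d) ℝ) v := by
    have hs0 : 0 ≤ s := by
      have : 0 ≤ s * b ^ 2 := le_trans (by positivity) hs
      exact nonneg_of_mul_nonneg_left this (by positivity)
    refine le_trans ?_ (mul_le_mul_of_nonneg_left h2 (mul_nonneg hs0 hρ0))
    have e2 : Real.exp 2 = Real.exp 1 * Real.exp 1 := by rw [← Real.exp_add]; norm_num
    have e3 : Real.exp (-1) * Real.exp 1 = 1 := by rw [← Real.exp_add]; simp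
    have k := mul_le_mul_of_nonneg_right hs
      (show 0 ≤ Real.exp (-1) * (ρ * t * (v ⬝ᵥ v)) by positivity)
    simp only [Finset.sum_const, Finset.card_univ, Fintype.card_fin, nsmul_eq_mul]
    calc _ = (Real.exp (-1) * Real.exp 1) * Real.exp 1 * (3 * n * ω) * (ρ * t * (v ⬝ᵥ v)) := by
          rw [e3]; ring
      _ = 3 * n * ω * Real.exp 2 * (Real.exp (-1) * (ρ * t * (v ⬝ᵥ v))) := by rw [e2]; ring
      _ ≤ _ := k
      _ = _ := by rw [ht]; ring
  have hq0 : 0 ≤ quad (S.ruelle A y : Matrix (Fin d) (Fin d) ℝ) v := le_trans (by positivity) h2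
  rw [quad_ruelle]
  refine (Finset.sum_le_sum fun i _ => h1 i).trans ?_
  rw [← Finset.mul_sum, Finset.sum_add_distrib, ← quad_ruelle, add_mul, Real.exp_add,
    mul_assoc (Real.exp _) (Real.exp _)]
  refine mul_le_mul_of_nonneg_left ?_ (Real.exp_pos _).le
  have := Real.add_one_le_exp (s * ρ)
  nlinarith

end FractalSystem


/-! ### Convergence of the normalized iterates of the Ruelle operator -/

section Convergence

open Filter Topology

attribute [local instance] symMatNormedAddCommGroup symMatNormedSpace

/-- Uniformly bounded operators that converge on a dense set to multiples of a vector do so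
everywhere. -/
theorem exists_tendsto_smul_of_dense {E : Type*} [NormedAddCommGroup E] [NormedSpace ℝ E]
    [CompleteSpace E] {p : ℕ → E →L[ℝ] E} {C : ℝ} (hp : ∀ k A, ‖p k A‖ ≤ C * ‖A‖) {Q : E}
    {D : Set E} (hD : Dense D)
    (h : ∀ A ∈ D, ∃ c : ℝ, Tendsto (fun k => p k A) atTop (𝓝 (c • Q))) (A : E) :
    ∃ c : ℝ, Tendsto (fun k => p k A) atTop (𝓝 (c • Q)) := by
  -- Uniform boundedness makes one approximation of A good for all k at once, so the Cauchy property
  -- passes to A. The limit stays a multiple of Q because the line through Q is closed.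
  have hdense : ∀ δ > 0, ∃ A' ∈ D, ∀ k, ‖p k A - p k A'‖ ≤ δ := fun δ hδ => by
    obtain ⟨A', hA', hlt⟩ := Metric.dense_iff.1 hD A (δ / (|C| + 1)) (by positivity)
    refine ⟨A', hlt, fun k => ?_⟩
    rw [← map_sub]
    refine (hp k _).trans ?_
    rw [Metric.mem_ball, dist_comm, dist_eq_norm, lt_div_iff₀ (by positivity)] at hA'
    nlinarith [le_abs_self C, norm_nonneg (A - A')]
  have hcau : CauchySeq fun k => p k A := by
    refine Metric.cauchySeq_iff'.2 fun δ hδ => ?_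
    obtain ⟨A', hA', hk⟩ := hdense (δ / 4) (by positivity)
    obtain ⟨c, hc⟩ := h A' hA'
    obtain ⟨N, hN⟩ := Metric.cauchySeq_iff'.1 hc.cauchySeq (δ / 2) (by positivity)
    refine ⟨N, fun m hm => ?_⟩
    have h1 := hk m
    have h2 := hk N
    have h3 := hN m hm
    rw [dist_eq_norm] at h3 ⊢
    have e : p m A - p N A = (p m A - p m A') + (p m A' - p N A') - (p N A - p N A') := by abel
    rw [e]
    have h4 := norm_sub_le ((p m A - p m A') + (p m A' - p N A')) (p N A - p N A')
    have h5 := norm_add_le (p m A - p m A') (p m A' - p N A')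
    linarith
  obtain ⟨B, hB⟩ := cauchySeq_tendsto_of_complete hcau
  have hBQ : B ∈ Submodule.span ℝ {Q} := by
    have hcl : IsClosed (Submodule.span ℝ {Q} : Set E) := Submodule.closed_of_finiteDimensional _
    rw [← SetLike.mem_coe, ← hcl.closure_eq, Metric.mem_closure_iff]
    intro δ hδ
    obtain ⟨A', hA', hk⟩ := hdense (δ / 2) (by positivity)
    obtain ⟨c, hc⟩ := h A' hA'
    refine ⟨c • Q, Submodule.smul_mem _ _ (Submodule.mem_span_singleton_self Q), ?_⟩
    have := le_of_tendsto' (hB.sub hc).norm hk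
    rw [dist_eq_norm]; linarith
  obtain ⟨c, rfl⟩ := Submodule.mem_span_singleton.1 hBQ
  exact ⟨c, hB⟩

/-- The Lipschitz functions, as a subalgebra of the continuous functions. -/
def lipschitzSubalgebra (X : Type*) [MetricSpace X] [CompactSpace X] : Subalgebra ℝ C(X, ℝ) where
  carrier := {f | ∃ K : ℝ, 0 ≤ K ∧ ∀ x y, |f x - f y| ≤ K * dist x y}
  mul_mem' := by
    rintro f g ⟨K, hK, hf⟩ ⟨K', hK', hg⟩
    refine ⟨‖f‖ * K' + ‖g‖ * K, by positivity, fun x y => ?_⟩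
    have e : (f * g) x - (f * g) y = f x * (g x - g y) + g y * (f x - f y) := by
      simp only [ContinuousMap.mul_apply]; ring
    rw [e]
    refine (abs_add_le _ _).trans ?_
    rw [abs_mul, abs_mul, add_mul, mul_assoc, mul_assoc]
    exact add_le_add (mul_le_mul (f.norm_coe_le_norm x) (hg x y) (abs_nonneg _) (norm_nonneg _))
      (mul_le_mul (g.norm_coe_le_norm y) (hf x y) (abs_nonneg _) (norm_nonneg _))
  add_mem' := by
    rintro f g ⟨K, hK, hf⟩ ⟨K', hK', hg⟩
    refine ⟨K + K', by positivity, fun x y => ?_⟩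
    have e : (f + g) x - (f + g) y = (f x - f y) + (g x - g y) := by
      simp only [ContinuousMap.add_apply]; ring
    rw [e, add_mul]
    exact (abs_add_le _ _).trans (add_le_add (hf x y) (hg x y))
  algebraMap_mem' r := ⟨0, le_rfl, fun x y => by simp⟩

/-- Stone–Weierstrass: the distance to a point is Lipschitz and separates that point from every
other one. -/
theorem dense_lipschitzSubalgebra (X : Type*) [MetricSpace X] [CompactSpace X] :
    Dense (lipschitzSubalgebra X : Set C(X, ℝ)) := by
  have h := ContinuousMap.subalgebra_topologicalClosure_eq_top_of_separatesPoints
    (lipschitzSubalgebra X) (fun x y hxy => by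
      refine ⟨fun z => dist z x, ⟨⟨fun z => dist z x, by fun_prop⟩, ⟨1, zero_le_one,
        fun z w => ?_⟩, rfl⟩, ?_⟩
      · simpa using abs_dist_sub_le z w x
      · simpa using hxy.symm)
  rw [dense_iff_closure_eq]
  have := congrArg (fun A : Subalgebra ℝ C(X, ℝ) => (A : Set C(X, ℝ))) h
  simpa using this

namespace FractalSystem

variable {d n : ℕ} {ν η : ℝ≥0} (S : FractalSystem d n ν η)

/-! ### Continuity of the Ruelle operator and contraction of the cone. -/

theorem continuous_ruelle : Continuous S.ruelle := by
  refine ContinuousMap.continuous_of_continuous_uncurry _ ?_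
  refine Continuous.subtype_mk (continuous_finsetSum _ fun i _ => ?_) _
  have h2 : Continuous fun p : C(S.G, symMat d) × S.G => p.1 (S.ψG i p.2) :=
    ContinuousEval.continuous_eval.comp
      (continuous_fst.prodMk ((S.continuous_ψG i).comp continuous_snd))
  exact (((S.continuous_jac i).comp continuous_snd).matrix_transpose.matrix_mul
    (continuous_subtype_val.comp h2)).matrix_mul ((S.continuous_jac i).comp continuous_snd)

theorem continuous_coe_eval (x : S.G) :
    Continuous fun A : C(S.G, symMat d) => (A x : Matrix (Fin d) (Fin d) ℝ) :=
  continuous_subtype_val.comp (ContinuousEvalConst.continuous_eval_const x)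

/-- The trace of the value at a point, as a functional. -/
noncomputable def traceAt (x : S.G) : C(S.G, symMat d) →L[ℝ] ℝ where
  toFun A := (A x : Matrix (Fin d) (Fin d) ℝ).trace
  map_add' A B := by simp
  map_smul' c A := by simp
  cont := (S.continuous_coe_eval x).matrix_trace

/-- The function `x ↦ f(x) M` for a symmetric matrix `M`. -/
def smulConst (f : C(S.G, ℝ)) (M : symMat d) : C(S.G, symMat d) where
  toFun x := f x • M
  continuous_toFun := Continuous.subtype_mk
    (f.continuous.smul (continuous_const (y := (M : Matrix (Fin d) (Fin d) ℝ)))) _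

theorem coe_smulConst (f : C(S.G, ℝ)) (M : symMat d) (x : S.G) :
    (S.smulConst f M x : Matrix (Fin d) (Fin d) ℝ) = f x • (M : Matrix (Fin d) (Fin d) ℝ) := rfl

theorem continuous_smulConst (M : symMat d) : Continuous fun f => S.smulConst f M := by
  refine ContinuousMap.continuous_of_continuous_uncurry _ ?_
  exact Continuous.subtype_mk (Continuous.smul (f := fun p : C(S.G, ℝ) × S.G => p.1 p.2)
    (ContinuousEval.continuous_eval)
    (continuous_const (y := (M : Matrix (Fin d) (Fin d) ℝ)))) _

/-- The identity matrix, as a symmetric matrix. -/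
def symOne (d : ℕ) : symMat d := ⟨1, Matrix.isSymm_one⟩

variable {S}

theorem smulConst_one_mem_logHolderCone {t : ℝ} (ht : 0 ≤ t) :
    S.smulConst (ContinuousMap.const _ t) (symOne d) ∈ S.logHolderCone := by
  have h : ∀ x v, quad (S.smulConst (ContinuousMap.const _ t) (symOne d) x :
      Matrix (Fin d) (Fin d) ℝ) v = t * (v ⬝ᵥ v) := fun x v => by
    rw [coe_smulConst, quad_smul]; simp [symOne, quad_one]
  refine ⟨fun x v => ?_, fun x y v => ?_⟩
  · rw [h]; exact mul_nonneg ht (dotProduct_self_nonneg' v)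
  · rw [h, h]
    exact le_mul_of_one_le_left (mul_nonneg ht (dotProduct_self_nonneg' v))
      (Real.one_le_exp (S.relDist_nonneg x y))

/-- A Lipschitz function becomes log-Hölder after adding a large constant. -/
theorem exists_smulConst_add_mem_logHolderCone (hν1 : ν ≤ 1) {f : C(S.G, ℝ)}
    (hf : f ∈ lipschitzSubalgebra S.G) (M : symMat d) :
    ∃ t : ℝ, 0 ≤ t ∧ S.smulConst f M + S.smulConst (ContinuousMap.const _ t) (symOne d) ∈
      S.logHolderCone := by
  obtain ⟨K, hK, hf⟩ := hf
  set s : ℝ := d * ‖M‖ with hs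
  have hs0 : 0 ≤ s := by positivity
  have hM : ∀ v, |quad (M : Matrix (Fin d) (Fin d) ℝ) v| ≤ s * (v ⬝ᵥ v) :=
    abs_quad_le_of_entry ((symMat_norm_le_iff (norm_nonneg M)).1 le_rfl)
  -- The term ‖f‖s makes the form positive; the other term leaves a margin that dominates the
  -- oscillation of f M.
  set t : ℝ := K * Metric.diam S.G * s + ‖f‖ * s with ht
  have hD : 0 ≤ Metric.diam S.G := Metric.diam_nonneg
  refine ⟨t, by positivity, ?_⟩
  have h : ∀ x v, quad ((S.smulConst f M + S.smulConst (ContinuousMap.const _ t) (symOne d)) x :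
      Matrix (Fin d) (Fin d) ℝ) v = f x * quad (M : Matrix (Fin d) (Fin d) ℝ) v + t * (v ⬝ᵥ v) :=
    fun x v => by
      have : ((S.smulConst f M + S.smulConst (ContinuousMap.const _ t) (symOne d)) x :
        Matrix (Fin d) (Fin d) ℝ) = f x • (M : Matrix (Fin d) (Fin d) ℝ) + t • 1 := rfl
      rw [this, quad_add, quad_smul, quad_smul, quad_one]
  have hlow : ∀ x v, K * Metric.diam S.G * s * (v ⬝ᵥ v) ≤
      f x * quad (M : Matrix (Fin d) (Fin d) ℝ) v + t * (v ⬝ᵥ v) := fun x v => by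
    have h1 : |f x * quad (M : Matrix (Fin d) (Fin d) ℝ) v| ≤ ‖f‖ * (s * (v ⬝ᵥ v)) := by
      rw [abs_mul]
      exact mul_le_mul (f.norm_coe_le_norm x) (hM v) (abs_nonneg _) (norm_nonneg _)
    have h2 := (abs_le.1 h1).1
    rw [ht]; linarith
  refine ⟨fun x v => ?_, fun x y v => ?_⟩
  · rw [h]
    refine le_trans ?_ (hlow x v)
    have := dotProduct_self_nonneg' v
    positivity
  · rw [h, h]
    have hv := dotProduct_self_nonneg' v
    set a := f y * quad (M : Matrix (Fin d) (Fin d) ℝ) v + t * (v ⬝ᵥ v) with ha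
    have h1 : (f x - f y) * quad (M : Matrix (Fin d) (Fin d) ℝ) v ≤
        (K * (Metric.diam S.G * S.relDist x y)) * (s * (v ⬝ᵥ v)) := by
      refine (le_abs_self _).trans ?_
      rw [abs_mul]
      refine mul_le_mul ((hf x y).trans ?_) (hM v) (abs_nonneg _) ?_
      · exact mul_le_mul_of_nonneg_left (S.dist_le_relDist hν1 x y) hK
      · have := S.relDist_nonneg x y; positivity
    have h2 := mul_le_mul_of_nonneg_left (hlow y v) (S.relDist_nonneg x y)
    have h3 := Real.add_one_le_exp (S.relDist x y)
    have h4 : 0 ≤ a := le_trans (by positivity) (hlow y v)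
    have h5 := mul_le_mul_of_nonneg_right h3 h4
    have e : f x * quad (M : Matrix (Fin d) (Fin d) ℝ) v + t * (v ⬝ᵥ v) =
      (f x - f y) * quad (M : Matrix (Fin d) (Fin d) ℝ) v + a := by rw [ha]; ring
    rw [e]
    linarith

theorem isClosed_logHolderCone : IsClosed S.logHolderCone := by
  have hc : ∀ x v, Continuous fun A : C(S.G, symMat d) =>
      quad (A x : Matrix (Fin d) (Fin d) ℝ) v := fun x v =>
    continuous_quad.comp ((S.continuous_coe_eval x).prodMk continuous_const)
  have e : S.logHolderCone = (⋂ x, ⋂ v, {A | 0 ≤ quad (A x : Matrix (Fin d) (Fin d) ℝ) v}) ∩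
      ⋂ x, ⋂ y, ⋂ v, {A | quad (A x : Matrix (Fin d) (Fin d) ℝ) v ≤
        Real.exp (S.relDist x y) * quad (A y : Matrix (Fin d) (Fin d) ℝ) v} := by
    ext A; simp [logHolderCone]
  rw [e]
  refine IsClosed.inter (isClosed_iInter fun x => isClosed_iInter fun v => ?_)
    (isClosed_iInter fun x => isClosed_iInter fun y => isClosed_iInter fun v => ?_)
  · exact isClosed_le continuous_const (hc x v)
  · exact isClosed_le (hc x v) (continuous_const.mul (hc y v))

variable (S) in
/-- The Ruelle operator as a continuous linear map. -/
noncomputable def ruelleCLM : C(S.G, symMat d) →L[ℝ] C(S.G, symMat d) :=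
  ⟨S.ruelle, S.continuous_ruelle⟩

theorem ruelleCLM_apply (A : C(S.G, symMat d)) : S.ruelleCLM A = S.ruelle A := rfl

theorem ruelleCLM_pow_apply (k : ℕ) (A : C(S.G, symMat d)) :
    (S.ruelleCLM ^ k) A = (S.ruelle ^ k) A := by
  induction k with
  | zero => rfl
  | succ k ih => rw [pow_succ', pow_succ', mul_apply_eq_comp, ih]; rfl

/-- The Ruelle operator contracts the cone of log-Hölder functions. -/
theorem exists_contractsCone (hd : 0 < d) (hη : η ≤ 1) {b ω s : ℝ} (hb : 0 < b)
    (hN : S.Nondegenerate b) (hω0 : 0 ≤ ω) (hω1 : ω ≤ 1) (hω : S.HolderSmall ω)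
    (hs : 3 * n * ω * Real.exp 2 ≤ s * b ^ 2) (hs0 : 0 ≤ s) (hs1 : (η : ℝ) ^ (ν : ℝ) + s < 1)
    (x₀ : S.G) :
    ∃ C b' ε, ContractsCone S.ruelleCLM (S.traceAt x₀) S.logHolderCone C b' ε := by
  set θ := (η : ℝ) ^ (ν : ℝ) + s with hθ
  have hθ0 : 0 ≤ θ := add_nonneg (Real.rpow_nonneg NNReal.zero_le_coe _) hs0
  set c₁ := Real.exp (-1) * b ^ 2 with hc₁
  have hc₁0 : 0 < c₁ := by positivity
  set c₂ := Real.exp 1 * n with hc₂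
  have hc₂0 : 0 ≤ c₂ := by positivity
  -- R bounds the ratio of two normalized images: c₂/c₁ enters once from the forms and once from the
  -- traces. The summand 1 gives R ≥ 1, whence positivity.
  set R := c₂ ^ 2 / c₁ ^ 2 + 1 with hR
  have hR1 : 1 ≤ R := le_add_of_nonneg_left (by positivity)
  have hd' : (0 : ℝ) < d := by exact_mod_cast hd
  have htr : ∀ A x, S.traceAt x A = (A x : Matrix (Fin d) (Fin d) ℝ).trace := fun _ _ => rfl
  have hesum : ∑ j : Fin d, (Pi.single j 1 : Fin d → ℝ) ⬝ᵥ Pi.single j 1 = d := by simp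
  have hlow : ∀ A ∈ S.logHolderCone, ∀ x v, c₁ * S.traceAt x₀ A * (v ⬝ᵥ v) ≤
      quad (S.ruelle A x : Matrix (Fin d) (Fin d) ℝ) v := fun A hA x v =>
    le_quad_ruelle hb.le hN hA x x₀ v
  have hup : ∀ A ∈ S.logHolderCone, ∀ x v, quad (S.ruelle A x : Matrix (Fin d) (Fin d) ℝ) v ≤
      c₂ * S.traceAt x₀ A * (v ⬝ᵥ v) := fun A hA x v => quad_ruelle_le hη hA x x₀ v
  have hnn : ∀ A ∈ S.logHolderCone, 0 ≤ S.traceAt x₀ A := fun A hA =>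
    trace_nonneg_of_quad (hA.1 x₀)
  have htlow : ∀ A ∈ S.logHolderCone, c₁ * d * S.traceAt x₀ A ≤ S.traceAt x₀ (S.ruelle A) :=
    fun A hA => by
      rw [htr (S.ruelle A), trace_eq_sum_quad]
      refine le_trans (le_of_eq ?_) (Finset.sum_le_sum fun j _ => hlow A hA x₀ (Pi.single j 1))
      rw [← Finset.mul_sum, hesum]; ring
  have htup : ∀ A ∈ S.logHolderCone, S.traceAt x₀ (S.ruelle A) ≤ c₂ * d * S.traceAt x₀ A :=
    fun A hA => by
      rw [htr (S.ruelle A), trace_eq_sum_quad]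
      refine le_trans (Finset.sum_le_sum fun j _ => hup A hA x₀ (Pi.single j 1)) (le_of_eq ?_)
      rw [← Finset.mul_sum, hesum]; ring
  have hruelle : ∀ A ∈ S.logHolderCone, ∀ x v,
      0 ≤ quad (S.ruelle A x : Matrix (Fin d) (Fin d) ℝ) v := fun A hA x v =>
    le_trans (mul_nonneg (mul_nonneg hc₁0.le (hnn A hA)) (dotProduct_self_nonneg' v))
      (hlow A hA x v)
  have hhol : ∀ A ∈ S.logHolderCone, ∀ x y v, quad (S.ruelle A x : Matrix (Fin d) (Fin d) ℝ) v ≤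
      Real.exp (θ * S.relDist x y) * quad (S.ruelle A y : Matrix (Fin d) (Fin d) ℝ) v :=
    fun A hA x y v => quad_ruelle_le_exp_mul hη hb hN hω0 hω1 hω hs hA x y v
  have he1 : 1 ≤ Real.exp 1 := Real.one_le_exp zero_le_one
  have hε0 : 0 < (1 - θ) / (2 * Real.exp 1 * R) := div_pos (by linarith) (by positivity)
  -- This keeps the difference in `gap` positive semidefinite; its Hölder inequality is
  -- `sub_le_exp_mul_sub`.
  have hεR : (1 - θ) / (2 * Real.exp 1 * R) * R ≤ 1 / 2 := by
    rw [div_mul_eq_mul_div, div_le_div_iff₀ (by positivity) (by norm_num)]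
    nlinarith
  refine ⟨4 * Real.exp 1, c₁ * d, (1 - θ) / (2 * Real.exp 1 * R), isClosed_logHolderCone,
    fun U hU V hV => ⟨fun x v => ?_, fun x y v => ?_⟩,
    fun c hc U hU => ⟨fun x v => ?_, fun x y v => ?_⟩,
    fun U hU => ⟨hruelle U hU, fun x y v => ?_⟩, by positivity, fun U hU => ?_, by positivity, htlow,
    hε0, ?_, fun U hU V hV => ?_⟩
  · exact (quad_add _ _ v).symm ▸ add_nonneg (hU.1 x v) (hV.1 x v)
  · change quad ((U x : Matrix (Fin d) (Fin d) ℝ) + (V x : Matrix (Fin d) (Fin d) ℝ)) v ≤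
      _ * quad ((U y : Matrix (Fin d) (Fin d) ℝ) + (V y : Matrix (Fin d) (Fin d) ℝ)) v
    rw [quad_add, quad_add, mul_add]
    exact add_le_add (hU.2 x y v) (hV.2 x y v)
  · exact (quad_smul c _ v).symm ▸ mul_nonneg hc (hU.1 x v)
  · change quad (c • (U x : Matrix (Fin d) (Fin d) ℝ)) v ≤
      _ * quad (c • (U y : Matrix (Fin d) (Fin d) ℝ)) v
    rw [quad_smul, quad_smul, mul_left_comm]
    exact mul_le_mul_of_nonneg_left (hU.2 x y v) hc
  · refine (hhol U hU x y v).trans (mul_le_mul_of_nonneg_right ?_ (hruelle U hU y v))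
    refine Real.exp_le_exp.2 ?_
    have := S.relDist_nonneg x y
    nlinarith
  · have h0 := hnn U hU
    refine (ContinuousMap.norm_le _ (by positivity)).2 fun x => ?_
    refine (symMat_norm_le_iff (by positivity)).2 fun j k => ?_
    rw [mul_assoc]
    refine abs_entry_le_of_quad (S.isSymm_apply U x) (fun v => ?_) j k
    rw [abs_of_nonneg (hU.1 x v)]
    refine (quad_le_trace_mul (S.isSymm_apply U x) (hU.1 x) v).trans ?_
    exact mul_le_mul_of_nonneg_right (trace_le_exp_one_mul hU x x₀) (dotProduct_self_nonneg' v)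
  · nlinarith
  · rw [ruelleCLM_apply, ruelleCLM_apply]
    set ε := (1 - θ) / (2 * Real.exp 1 * R) with hε
    set p := S.traceAt x₀ (S.ruelle V) with hp
    set q := S.traceAt x₀ (S.ruelle U) with hq
    have hp0 : 0 ≤ p := le_trans (by have := hnn V hV; positivity) (htlow V hV)
    have hq0 : 0 ≤ q := le_trans (by have := hnn U hU; positivity) (htlow U hU)
    have e : ∀ x v, quad ((p • S.ruelle U - (ε * q) • S.ruelle V) x : Matrix (Fin d) (Fin d) ℝ) v =
        p * quad (S.ruelle U x : Matrix (Fin d) (Fin d) ℝ) v -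
          ε * (q * quad (S.ruelle V x : Matrix (Fin d) (Fin d) ℝ) v) := fun x v => by
      change quad (p • (S.ruelle U x : Matrix (Fin d) (Fin d) ℝ) -
        (ε * q) • (S.ruelle V x : Matrix (Fin d) (Fin d) ℝ)) v = _
      rw [quad_sub, quad_smul, quad_smul, mul_assoc]
    have hcmp : ∀ x v, q * quad (S.ruelle V x : Matrix (Fin d) (Fin d) ℝ) v ≤
        R * (p * quad (S.ruelle U x : Matrix (Fin d) (Fin d) ℝ) v) := fun x v => by
      have hv := dotProduct_self_nonneg' v
      have hU0 := hnn U hU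
      have hV0 := hnn V hV
      set u := S.traceAt x₀ U
      set w := S.traceAt x₀ V
      have a1 : q * quad (S.ruelle V x : Matrix (Fin d) (Fin d) ℝ) v ≤
          (c₂ * d * u) * (c₂ * w * (v ⬝ᵥ v)) :=
        mul_le_mul (htup U hU) (hup V hV x v) (hruelle V hV x v) (by positivity)
      have a2 : (c₁ * d * w) * (c₁ * u * (v ⬝ᵥ v)) ≤
          p * quad (S.ruelle U x : Matrix (Fin d) (Fin d) ℝ) v :=
        mul_le_mul (htlow V hV) (hlow U hU x v) (by positivity) hp0
      have a3 : c₂ ^ 2 ≤ R * c₁ ^ 2 := by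
        rw [hR, add_mul, div_mul_cancel₀ _ (by positivity)]
        have := sq_nonneg c₁; linarith
      calc _ ≤ _ := a1
        _ = c₂ ^ 2 * (d * u * w * (v ⬝ᵥ v)) := by ring
        _ ≤ R * c₁ ^ 2 * (d * u * w * (v ⬝ᵥ v)) :=
          mul_le_mul_of_nonneg_right a3 (by positivity)
        _ = R * ((c₁ * d * w) * (c₁ * u * (v ⬝ᵥ v))) := by ring
        _ ≤ _ := mul_le_mul_of_nonneg_left a2 (by positivity)
    refine ⟨fun x v => ?_, fun x y v => ?_⟩
    · rw [e]
      have h1 := mul_le_mul_of_nonneg_left (hcmp x v) hε0.le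
      have h2 := mul_nonneg hp0 (hruelle U hU x v)
      nlinarith
    · rw [e, e]
      refine sub_le_exp_mul_sub (mul_nonneg hp0 (hruelle U hU y v))
        (mul_nonneg hq0 (hruelle V hV y v)) (S.relDist_nonneg x y) (S.relDist_le_one x y) hθ0 hs1
        (by positivity) ?_ ?_ (hcmp y v)
      · rw [mul_left_comm]
        exact mul_le_mul_of_nonneg_left (hhol U hU x y v) hp0
      · rw [mul_left_comm, S.relDist_comm]
        exact mul_le_mul_of_nonneg_left (hhol V hV y x v) hq0

end FractalSystem

end Convergence


/-! ### The spectral projection of the Ruelle operator -/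

section SpectralGap

open Filter Topology

namespace FractalSystem

variable {d n : ℕ} {ν η : ℝ≥0} (S : FractalSystem d n ν η)

/-- The eigenfunction `Q` of the Ruelle operator for the eigenvalue `β`, with the functional `c`
such that `β⁻ᵏ Lᵏ A → c(A) Q`. -/
structure IsSpectralData (β : ℝ) (Q : C(S.G, symMat d)) (c : C(S.G, symMat d) →ₗ[ℝ] ℝ) :
    Prop where
  pos : 0 < β
  mem : Q ∈ S.logHolderCone
  eigen : S.ruelle Q = β • Q
  exists_le_quad : ∃ m : ℝ, 0 < m ∧ ∀ x v, m * (v ⬝ᵥ v) ≤ quad (Q x : Matrix (Fin d) (Fin d) ℝ) v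
  map_Q : c Q = 1
  map_nonneg : ∀ A : C(S.G, symMat d),
    (∀ x v, 0 ≤ quad (A x : Matrix (Fin d) (Fin d) ℝ) v) → 0 ≤ c A
  tendsto : ∀ A, Tendsto (fun k : ℕ => (β ^ k)⁻¹ • (S.ruelle ^ k) A) atTop (𝓝 (c A • Q))

attribute [local instance] symMatNormedAddCommGroup symMatNormedSpace

/-- The entries of a matrix function. -/
def entryFun (A : C(S.G, symMat d)) (j k : Fin d) : C(S.G, ℝ) where
  toFun x := (A x : Matrix (Fin d) (Fin d) ℝ) j k
  continuous_toFun := (continuous_entryHom j k).comp A.continuous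

theorem eq_sum_smulConst (A : C(S.G, symMat d)) :
    A = ∑ j, ∑ k, S.smulConst (S.entryFun A j k) (symUnit j k) := by
  ext x : 1
  have h : (∑ j, ∑ k, S.smulConst (S.entryFun A j k) (symUnit j k)) x =
      ∑ j, ∑ k, (A x : Matrix (Fin d) (Fin d) ℝ) j k • symUnit j k := by
    simp only [ContinuousMap.sum_apply]
    rfl
  rw [h]
  refine Subtype.ext (Matrix.ext fun p q => ?_)
  exact (sum_smul_symUnit (fun j k => ((S.isSymm_apply A x).apply j k).symm) p q).symm

variable {S}

/-- The order interval -rQ ≤ A ≤ rQ is invariant under β⁻¹ L, which is positive and fixes Q. This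
gives the uniform bound on the normalized iterates. -/
theorem abs_quad_ruelle_pow_le {β r : ℝ} (hβ : 0 < β) {Q A : C(S.G, symMat d)}
    (hQ : S.ruelle Q = β • Q)
    (h : ∀ x v, |quad (A x : Matrix (Fin d) (Fin d) ℝ) v| ≤
      r * quad (Q x : Matrix (Fin d) (Fin d) ℝ) v) (k : ℕ) (x : S.G) (v : Fin d → ℝ) :
    |quad (((β ^ k)⁻¹ • (S.ruelle ^ k) A) x : Matrix (Fin d) (Fin d) ℝ) v| ≤
      r * quad (Q x : Matrix (Fin d) (Fin d) ℝ) v := by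
  induction k generalizing x v with
  | zero => simpa using h x v
  | succ k ih =>
    have e : (β ^ (k + 1))⁻¹ • (S.ruelle ^ (k + 1)) A =
        β⁻¹ • S.ruelle ((β ^ k)⁻¹ • (S.ruelle ^ k) A) := by
      rw [map_smul, smul_smul, pow_succ' S.ruelle, Module.End.mul_apply, pow_succ, mul_inv,
        mul_comm]
    rw [e]
    set B := (β ^ k)⁻¹ • (S.ruelle ^ k) A
    change |quad (β⁻¹ • (S.ruelle B x : Matrix (Fin d) (Fin d) ℝ)) v| ≤ _
    have e2 : quad (Q x : Matrix (Fin d) (Fin d) ℝ) v =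
        β⁻¹ * quad (S.ruelle Q x : Matrix (Fin d) (Fin d) ℝ) v := by
      rw [hQ]
      change _ = β⁻¹ * quad (β • (Q x : Matrix (Fin d) (Fin d) ℝ)) v
      rw [quad_smul, ← mul_assoc, inv_mul_cancel₀ hβ.ne', one_mul]
    rw [quad_smul, abs_mul, abs_of_pos (inv_pos.2 hβ), e2, mul_left_comm, quad_ruelle, quad_ruelle,
      Finset.mul_sum Finset.univ _ r]
    refine mul_le_mul_of_nonneg_left ?_ (inv_pos.2 hβ).le
    exact (Finset.abs_sum_le_sum_abs _ _).trans (Finset.sum_le_sum fun i _ => ih _ _)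

theorem quad_ruelle_pow_nonneg {A : C(S.G, symMat d)}
    (h : ∀ x v, 0 ≤ quad (A x : Matrix (Fin d) (Fin d) ℝ) v) (k : ℕ) (x : S.G) (v : Fin d → ℝ) :
    0 ≤ quad ((S.ruelle ^ k) A x : Matrix (Fin d) (Fin d) ℝ) v := by
  induction k generalizing x v with
  | zero => exact h x v
  | succ k ih =>
    rw [pow_succ', Module.End.mul_apply, quad_ruelle]
    exact Finset.sum_nonneg fun i _ => ih _ _

/-- The normalized iterates of the Ruelle operator converge to a projection of rank one. -/
theorem exists_isSpectralData (hd : 0 < d) (hν1 : ν ≤ 1) (hη : η ≤ 1) {b ω s : ℝ} (hb : 0 < b)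
    (hN : S.Nondegenerate b) (hω0 : 0 ≤ ω) (hω1 : ω ≤ 1) (hω : S.HolderSmall ω)
    (hs : 3 * n * ω * Real.exp 2 ≤ s * b ^ 2) (hs0 : 0 ≤ s)
    (hs1 : (η : ℝ) ^ (ν : ℝ) + s < 1) : ∃ β Q c, S.IsSpectralData β Q c := by
  obtain ⟨x₀⟩ := S.nonempty_G
  obtain ⟨C, b', ε, hK⟩ := exists_contractsCone hd hη hb hN hω0 hω1 hω hs hs0 hs1 x₀
  have hd' : (0 : ℝ) < d := by exact_mod_cast hd
  obtain ⟨β, hβ, Q, hQK, hQ1, hQL⟩ := hK.exists_eigenvector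
    (smulConst_one_mem_logHolderCone (S := S) zero_le_one) (by
      change 0 < ((1 : ℝ) • (1 : Matrix (Fin d) (Fin d) ℝ)).trace
      simpa using hd)
  have hQL' : S.ruelle Q = β • Q := hQL
  -- Q = β⁻¹ L Q with trace one at x₀, so the lower bound for images of the cone makes Q uniformly
  -- definite.
  have hlow : ∀ x v, β⁻¹ * (Real.exp (-1) * b ^ 2) * (v ⬝ᵥ v) ≤
      quad (Q x : Matrix (Fin d) (Fin d) ℝ) v := fun x v => by
    have h1 := le_quad_ruelle hb.le hN hQK x x₀ v
    rw [hQL'] at h1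
    change _ ≤ quad (β • (Q x : Matrix (Fin d) (Fin d) ℝ)) v at h1
    have h2 : (Q x₀ : Matrix (Fin d) (Fin d) ℝ).trace = 1 := hQ1
    rw [quad_smul, h2, mul_one] at h1
    rw [mul_assoc, inv_mul_le_iff₀ hβ]
    exact h1
  set m := β⁻¹ * (Real.exp (-1) * b ^ 2) with hm
  have hm0 : 0 < m := by positivity
  have hup : ∀ x v, quad (Q x : Matrix (Fin d) (Fin d) ℝ) v ≤ Real.exp 1 * (v ⬝ᵥ v) := fun x v => by
    refine (quad_le_trace_mul (S.isSymm_apply Q x) (hQK.1 x) v).trans ?_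
    refine mul_le_mul_of_nonneg_right ((trace_le_exp_one_mul hQK x x₀).trans (le_of_eq ?_))
      (dotProduct_self_nonneg' v)
    have h2 : (Q x₀ : Matrix (Fin d) (Fin d) ℝ).trace = 1 := hQ1
    rw [h2, mul_one]
  set p : ℕ → C(S.G, symMat d) →L[ℝ] C(S.G, symMat d) :=
    fun k => (β ^ k)⁻¹ • S.ruelleCLM ^ k with hp
  have hpa : ∀ k A, p k A = (β ^ k)⁻¹ • (S.ruelle ^ k) A := fun k A => by
    rw [← ruelleCLM_pow_apply]; rfl
  have hbound : ∀ k A, ‖p k A‖ ≤ 4 * (d / m * Real.exp 1) * ‖A‖ := fun k A => by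
    have h1 : ∀ x v, |quad (A x : Matrix (Fin d) (Fin d) ℝ) v| ≤
        d * ‖A‖ / m * quad (Q x : Matrix (Fin d) (Fin d) ℝ) v := fun x v => by
      have h2 : |quad (A x : Matrix (Fin d) (Fin d) ℝ) v| ≤ d * ‖A‖ * (v ⬝ᵥ v) :=
        abs_quad_le_of_entry
          ((symMat_norm_le_iff (norm_nonneg A)).1 (A.norm_coe_le_norm x)) v
      refine h2.trans ?_
      rw [div_mul_eq_mul_div, le_div_iff₀ hm0, mul_assoc]
      refine mul_le_mul_of_nonneg_left ?_ (by positivity)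
      rw [mul_comm]; exact hlow x v
    rw [hpa]
    refine (ContinuousMap.norm_le _ (by positivity)).2 fun x => ?_
    refine (symMat_norm_le_iff (by positivity)).2 fun j k' => ?_
    rw [mul_assoc]
    refine abs_entry_le_of_quad (S.isSymm_apply _ x) (fun v => ?_) j k'
    refine (abs_quad_ruelle_pow_le hβ hQL' h1 k x v).trans ?_
    calc d * ‖A‖ / m * quad (Q x : Matrix (Fin d) (Fin d) ℝ) v
        ≤ d * ‖A‖ / m * (Real.exp 1 * (v ⬝ᵥ v)) :=
          mul_le_mul_of_nonneg_left (hup x v) (by positivity)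
      _ = _ := by ring
  let W : Submodule ℝ C(S.G, symMat d) :=
    { carrier := {A | ∃ c : ℝ, Tendsto (fun k => p k A) atTop (𝓝 (c • Q))}
      add_mem' := by
        rintro A B ⟨a, ha⟩ ⟨b, hb⟩
        refine ⟨a + b, ?_⟩
        rw [show (a + b) • Q = a • Q + b • Q from add_smul a b Q]
        simpa only [map_add] using ha.add hb
      zero_mem' := ⟨0, by
        rw [show (0 : ℝ) • Q = 0 from zero_smul ℝ Q]
        simp only [map_zero, tendsto_const_nhds]⟩
      smul_mem' := by
        rintro r A ⟨a, ha⟩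
        refine ⟨r * a, ?_⟩
        rw [show (r * a) • Q = r • a • Q from mul_smul r a Q]
        simpa only [map_smul] using ha.const_smul r }
  have hKW : ∀ A ∈ S.logHolderCone, A ∈ W := fun A hA =>
    hK.exists_tendsto hQK hQ1 hβ hQL hA
  -- Such a field is the cone element f M + t I minus the cone element t I.
  have hlip : ∀ f ∈ lipschitzSubalgebra S.G, ∀ M, S.smulConst f M ∈ W := fun f hf M => by
    obtain ⟨t, ht, h⟩ := exists_smulConst_add_mem_logHolderCone hν1 hf M
    have := W.sub_mem (hKW _ h) (hKW _ (smulConst_one_mem_logHolderCone ht))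
    rwa [add_sub_cancel_right] at this
  have hcl : ∀ f M, S.smulConst f M ∈ W.topologicalClosure := fun f M => by
    have h1 : IsClosed {f | S.smulConst f M ∈ W.topologicalClosure} :=
      W.isClosed_topologicalClosure.preimage (S.continuous_smulConst M)
    have h2 : (lipschitzSubalgebra S.G : Set C(S.G, ℝ)) ⊆
        {f | S.smulConst f M ∈ W.topologicalClosure} :=
      fun f hf => W.le_topologicalClosure (hlip f hf M)
    exact h1.closure_subset_iff.2 h2 (dense_lipschitzSubalgebra S.G f)
  have hdense : Dense (W : Set C(S.G, symMat d)) := fun A => by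
    have h1 : A ∈ W.topologicalClosure := by
      rw [S.eq_sum_smulConst A]
      exact Submodule.sum_mem _ fun j _ => Submodule.sum_mem _ fun k _ => hcl _ _
    exact h1
  have hall : ∀ A, ∃ c : ℝ, Tendsto (fun k => p k A) atTop (𝓝 (c • Q)) :=
    exists_tendsto_smul_of_dense hbound hdense fun A hA => hA
  choose c hc using hall
  -- As Q has trace one at x₀, the trace there reads off the coefficient. Linearity of c follows
  -- from uniqueness of limits.
  have hct : ∀ A a, Tendsto (fun k => p k A) atTop (𝓝 (a • Q)) → c A = a := fun A a ha => by
    have := congrArg (S.traceAt x₀) (tendsto_nhds_unique (hc A) ha)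
    rwa [map_smul, map_smul, hQ1, smul_eq_mul, smul_eq_mul, mul_one, mul_one] at this
  refine ⟨β, Q, ⟨⟨c, fun A B => hct _ _ ?_⟩, fun r A => hct _ _ ?_⟩, hβ, hQK, hQL', ⟨m, hm0, hlow⟩,
    hct _ _ ?_, fun A hA => ?_, fun A => ?_⟩
  · rw [show (c A + c B) • Q = c A • Q + c B • Q from add_smul _ _ Q]
    simpa only [map_add] using (hc A).add (hc B)
  · rw [show ((RingHom.id ℝ) r • c A) • Q = r • c A • Q from mul_smul _ _ Q]
    simpa only [map_smul] using (hc A).const_smul r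
  · rw [one_smul]
    refine tendsto_const_nhds.congr fun k => ?_
    rw [hpa]
    induction k with
    | zero => simp
    | succ k ih =>
      rw [pow_succ S.ruelle, Module.End.mul_apply, hQL', map_smul, smul_smul, pow_succ, mul_inv, mul_assoc,
        inv_mul_cancel₀ hβ.ne', mul_one]
      exact ih
  · have h1 := ((S.traceAt x₀).continuous.tendsto _).comp (hc A)
    rw [map_smul, hQ1, smul_eq_mul, mul_one] at h1
    refine ge_of_tendsto' h1 fun k => ?_
    simp only [Function.comp_apply, hpa, map_smul, smul_eq_mul]
    exact mul_nonneg (by positivity) (trace_nonneg_of_quad (quad_ruelle_pow_nonneg hA k x₀))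
  · exact (hc A).congr fun k => hpa k A

end FractalSystem

end SpectralGap


/-! ### Consequences for the eigenvalue -/

namespace FractalSystem.IsSpectralData

open Filter Topology

variable {d n : ℕ} {ν η : ℝ≥0} {S : FractalSystem d n ν η} {β : ℝ} {Q : C(S.G, symMat d)}
  {c : C(S.G, symMat d) →ₗ[ℝ] ℝ}

/-- The normalized orbit of L A is β times the normalized orbit of A, shifted by one. -/
theorem map_ruelle (h : S.IsSpectralData β Q c) (A : C(S.G, symMat d)) :
    c (S.ruelle A) = β * c A := by
  have h1 : Tendsto (fun k : ℕ => β • (β ^ (k + 1))⁻¹ • (S.ruelle ^ (k + 1)) A) atTop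
      (𝓝 (β • c A • Q)) := ((h.tendsto A).comp (tendsto_add_atTop_nat 1)).const_smul β
  have h2 := tendsto_nhds_unique (h.tendsto (S.ruelle A)) (h1.congr fun k => by
    rw [pow_succ S.ruelle, Module.End.mul_apply, smul_smul, pow_succ', mul_inv, ← mul_assoc,
      mul_inv_cancel₀ h.pos.ne', one_mul])
  have h3 := congrArg c h2
  rwa [map_smul, map_smul, map_smul, h.map_Q, smul_eq_mul, smul_eq_mul, smul_eq_mul, mul_one,
    mul_one] at h3

theorem eq_smul_of_eigen (h : S.IsSpectralData β Q c) {A : C(S.G, symMat d)}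
    (hA : S.ruelle A = β • A) : A = c A • Q := by
  refine tendsto_nhds_unique (tendsto_const_nhds.congr fun k => ?_) (h.tendsto A)
  induction k with
  | zero => simp
  | succ k ih =>
    rw [pow_succ S.ruelle, Module.End.mul_apply, hA, map_smul, smul_smul, pow_succ, mul_inv,
      mul_assoc, inv_mul_cancel₀ h.pos.ne', mul_one]
    exact ih

/-- There is no Jordan block: c vanishes on the range of L - β but c(Q) = 1, so that range meets the
line through Q only in zero. -/
theorem maxGenEigenspace_eq (h : S.IsSpectralData β Q c) :
    Module.End.maxGenEigenspace S.ruelle β = Submodule.span ℝ {Q} := by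
  have key : ∀ k : ℕ, ∀ A, ((S.ruelle - β • (1 : Module.End ℝ C(S.G, symMat d))) ^ k) A = 0 →
      A ∈ Submodule.span ℝ {Q} := fun k => by
    induction k with
    | zero => intro A hA; rw [pow_zero] at hA; rw [show A = 0 from hA]; exact Submodule.zero_mem _
    | succ k ih =>
      intro A hA
      rw [pow_succ, Module.End.mul_apply] at hA
      obtain ⟨a, ha⟩ := Submodule.mem_span_singleton.1 (ih _ hA)
      have e : (S.ruelle - β • (1 : Module.End ℝ C(S.G, symMat d))) A = S.ruelle A - β • A := rfl
      rw [e] at ha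
      have h0 : a = 0 := by
        have := congrArg c ha
        rw [map_smul, map_sub, map_smul, h.map_ruelle, h.map_Q] at this
        simpa using this
      rw [h0, zero_smul] at ha
      rw [h.eq_smul_of_eigen (sub_eq_zero.1 ha.symm)]
      exact Submodule.smul_mem _ _ (Submodule.mem_span_singleton_self Q)
  refine le_antisymm (fun A hA => ?_) ?_
  · obtain ⟨k, hk⟩ := (Module.End.mem_maxGenEigenspace _ _ _).1 hA
    exact key k A hk
  · rw [Submodule.span_singleton_le_iff_mem, Module.End.mem_maxGenEigenspace]
    refine ⟨1, ?_⟩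
    rw [pow_one]
    exact sub_eq_zero.2 h.eigen

theorem posDef (h : S.IsSpectralData β Q c) (x : S.G) :
    (Q x : Matrix (Fin d) (Fin d) ℝ).PosDef := by
  obtain ⟨m, hm, hQ⟩ := h.exists_le_quad
  refine posDef_of_quad (S.isSymm_apply Q x) fun v hv => lt_of_lt_of_le ?_ (hQ x v)
  refine mul_pos hm ((dotProduct_self_nonneg' v).lt_of_ne' ?_)
  rwa [Ne, dotProduct_self_eq_zero]

/-- The eigenfunction is Hölder. -/
theorem holder (h : S.IsSpectralData β Q c) : ∃ C : ℝ, ∀ x y : S.G,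
    hsNorm ((Q x : Matrix (Fin d) (Fin d) ℝ) - (Q y : Matrix (Fin d) (Fin d) ℝ)) ≤
      C * dist x y ^ (ν : ℝ) := by
  obtain ⟨x₀⟩ := S.nonempty_G
  set t := (Q x₀ : Matrix (Fin d) (Fin d) ℝ).trace with ht
  have ht0 : 0 ≤ t := trace_nonneg_of_quad (h.mem.1 x₀)
  have he : (0 : ℝ) < Real.exp 1 := Real.exp_pos 1
  have hup : ∀ x v, quad (Q x : Matrix (Fin d) (Fin d) ℝ) v ≤ Real.exp 1 * t * (v ⬝ᵥ v) :=
    fun x v => (quad_le_trace_mul (S.isSymm_apply Q x) (h.mem.1 x) v).trans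
      (mul_le_mul_of_nonneg_right (trace_le_exp_one_mul h.mem x x₀) (dotProduct_self_nonneg' v))
  -- On [0, 1] the exponential is linearly bounded; this turns the multiplicative cone condition
  -- into an additive Hölder bound.
  have hexp : ∀ x y, Real.exp (S.relDist x y) - 1 ≤ Real.exp 1 * S.relDist x y := fun x y => by
    have b0 := S.relDist_nonneg x y
    have b1 := Real.add_one_le_exp (-S.relDist x y)
    have b2 : Real.exp (S.relDist x y) * Real.exp (-S.relDist x y) = 1 := by
      rw [← Real.exp_add]; simp
    have b3 : Real.exp (S.relDist x y) ≤ Real.exp 1 := Real.exp_le_exp.2 (S.relDist_le_one x y)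
    have b4 := Real.exp_pos (S.relDist x y)
    nlinarith
  have hone : ∀ x y v, quad (Q x : Matrix (Fin d) (Fin d) ℝ) v -
      quad (Q y : Matrix (Fin d) (Fin d) ℝ) v ≤
        Real.exp 1 * S.relDist x y * (Real.exp 1 * t) * (v ⬝ᵥ v) := fun x y v => by
    have h1 := h.mem.2 x y v
    have h2 := mul_le_mul (hexp x y) (hup y v) (h.mem.1 y v)
      (mul_nonneg he.le (S.relDist_nonneg x y))
    linarith
  refine ⟨d * (4 * (Real.exp 1 * (Real.exp 1 * t))) / Metric.diam S.G ^ (ν : ℝ), fun x y => ?_⟩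
  have hr := S.relDist_nonneg x y
  have h1 : ∀ j k, |((Q x : Matrix (Fin d) (Fin d) ℝ) - (Q y : Matrix (Fin d) (Fin d) ℝ)) j k| ≤
      4 * (Real.exp 1 * S.relDist x y * (Real.exp 1 * t)) :=
    abs_entry_le_of_quad ((S.isSymm_apply Q x).sub (S.isSymm_apply Q y)) fun v => by
      rw [quad_sub, abs_le]
      constructor
      · have := hone y x v
        rw [S.relDist_comm] at this
        linarith
      · exact hone x y v
  refine (hsNorm_le_of_entry (by positivity) h1).trans (le_of_eq ?_)
  rw [relDist, Real.div_rpow dist_nonneg Metric.diam_nonneg]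
  ring

end FractalSystem.IsSpectralData

/-! ### Differences of finite measures as functionals -/

section SignedFunctional

variable {X : Type*} [MeasurableSpace X]

/-- Bounded measurable real functions. -/
def BddMeas (f : X → ℝ) : Prop := Measurable f ∧ ∃ C : ℝ, ∀ x, |f x| ≤ C

theorem BddMeas.integrable {f : X → ℝ} (hf : BddMeas f) (μ : Measure X) [IsFiniteMeasure μ] :
    Integrable f μ := by
  obtain ⟨C, hC⟩ := hf.2
  exact Integrable.of_bound hf.1.aestronglyMeasurable C (Filter.Eventually.of_forall hC)

theorem BddMeas.mul_integrable {f h : X → ℝ} (hf : BddMeas f) {μ : Measure X}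
    (hh : Integrable h μ) : Integrable (fun x => f x * h x) μ := by
  obtain ⟨C, hC⟩ := hf.2
  exact hh.bdd_mul hf.1.aestronglyMeasurable (Filter.Eventually.of_forall hC)

theorem BddMeas.comp {f : X → ℝ} (hf : BddMeas f) {φ : X → X} (hφ : Measurable φ) :
    BddMeas fun x => f (φ x) :=
  ⟨hf.1.comp hφ, hf.2.imp fun _ h _ => h _⟩

theorem BddMeas.mul {f g : X → ℝ} (hf : BddMeas f) (hg : BddMeas g) :
    BddMeas fun x => f x * g x := by
  obtain ⟨C, hC⟩ := hf.2
  obtain ⟨D, hD⟩ := hg.2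
  refine ⟨hf.1.mul hg.1, C * D, fun x => ?_⟩
  rw [abs_mul]
  exact mul_le_mul (hC x) (hD x) (abs_nonneg _) ((abs_nonneg _).trans (hC x))

open Classical in
theorem bddMeas_indicator {B : Set X} (hB : MeasurableSet B) :
    BddMeas (B.indicator fun _ => (1 : ℝ)) := by
  refine ⟨measurable_const.indicator hB, 1, fun x => ?_⟩
  rw [indicator_apply]; split_ifs <;> simp

theorem bddMeas_of_continuous [TopologicalSpace X] [CompactSpace X] [OpensMeasurableSpace X]
    {f : X → ℝ} (hf : Continuous f) : BddMeas f := by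
  obtain ⟨C, hC⟩ := isCompact_univ.exists_bound_of_continuousOn (f := f) hf.continuousOn
  exact ⟨hf.measurable, C, fun x => hC x (mem_univ x)⟩

/-- A functional on bounded measurable functions that is the difference of two finite measures. -/
def IsSignedFunctional (Λ : (X → ℝ) → ℝ) : Prop :=
  ∃ P N : Measure X, IsFiniteMeasure P ∧ IsFiniteMeasure N ∧
    ∀ f, BddMeas f → Λ f = ∫ x, f x ∂P - ∫ x, f x ∂N

namespace IsSignedFunctional

variable {Λ Λ' : (X → ℝ) → ℝ}

theorem integral (μ : Measure X) [IsFiniteMeasure μ] :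
    IsSignedFunctional fun f : X → ℝ => ∫ x, f x ∂μ :=
  ⟨μ, 0, inferInstance, inferInstance, fun f _ => by simp⟩

/-- The two measures have the positive and negative parts of h as densities and are pushed forward
by φ. -/
theorem integral_comp_mul {μ : Measure X} {φ : X → X} (hφ : Measurable φ) {h : X → ℝ}
    (hh : Integrable h μ) : IsSignedFunctional fun f : X → ℝ => ∫ x, f (φ x) * h x ∂μ := by
  have i1 : IsFiniteMeasure (μ.withDensity fun x => ENNReal.ofReal (h x)) :=
    isFiniteMeasure_withDensity_ofReal hh.2
  have i2 : IsFiniteMeasure (μ.withDensity fun x => ENNReal.ofReal (-h x)) :=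
    isFiniteMeasure_withDensity_ofReal hh.neg.2
  refine ⟨(μ.withDensity fun x => ENNReal.ofReal (h x)).map φ,
    (μ.withDensity fun x => ENNReal.ofReal (-h x)).map φ, inferInstance, inferInstance,
    fun f hf => ?_⟩
  have key : ∀ g : X → ℝ, Integrable g μ →
      ∫ x, f x ∂((μ.withDensity fun x => ENNReal.ofReal (g x)).map φ) =
        ∫ x, f (φ x) * max (g x) 0 ∂μ := fun g hg => by
    rw [integral_map hφ.aemeasurable hf.1.aestronglyMeasurable,
      integral_withDensity_eq_integral_toReal_smul₀ hg.1.aemeasurable.ennreal_ofReal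
        (Filter.Eventually.of_forall fun x => ENNReal.ofReal_lt_top)]
    refine integral_congr_ae (Filter.Eventually.of_forall fun x => ?_)
    simp only [ENNReal.toReal_ofReal', smul_eq_mul]
    ring
  rw [key h hh, key (fun x => -h x) hh.neg, ← integral_sub
    ((hf.comp hφ).mul_integrable hh.pos_part) ((hf.comp hφ).mul_integrable hh.neg_part)]
  refine integral_congr_ae (Filter.Eventually.of_forall fun x => ?_)
  change f (φ x) * h x = f (φ x) * max (h x) 0 - f (φ x) * max (-h x) 0
  have : h x = max (h x) 0 - max (-h x) 0 := (max_zero_sub_max_neg_zero_eq_self (h x)).symm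
  rw [← mul_sub, ← this]

theorem add (h : IsSignedFunctional Λ) (h' : IsSignedFunctional Λ') :
    IsSignedFunctional fun f => Λ f + Λ' f := by
  obtain ⟨P, N, _, _, hf⟩ := h
  obtain ⟨P', N', _, _, hf'⟩ := h'
  refine ⟨P + P', N + N', inferInstance, inferInstance, fun f hb => ?_⟩
  simp only [hf f hb, hf' f hb]
  rw [integral_add_measure (hb.integrable _) (hb.integrable _),
    integral_add_measure (hb.integrable _) (hb.integrable _)]
  ring

theorem neg (h : IsSignedFunctional Λ) : IsSignedFunctional fun f => -Λ f := by
  obtain ⟨P, N, _, _, hf⟩ := h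
  refine ⟨N, P, inferInstance, inferInstance, fun f hb => ?_⟩
  simp only [hf f hb]; ring

theorem const_mul (h : IsSignedFunctional Λ) (a : ℝ) : IsSignedFunctional fun f => a * Λ f := by
  have key : ∀ a : ℝ≥0, IsSignedFunctional fun f => (a : ℝ) * Λ f := fun a => by
    obtain ⟨P, N, _, _, hf⟩ := h
    refine ⟨a • P, a • N, inferInstance, inferInstance, fun f hb => ?_⟩
    simp only [hf f hb]
    rw [integral_smul_nnreal_measure, integral_smul_nnreal_measure, NNReal.smul_def,
      NNReal.smul_def, smul_eq_mul, smul_eq_mul, mul_sub]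
  rcases le_total 0 a with ha | ha
  · exact key ⟨a, ha⟩
  · have := (key (-a).toNNReal).neg
    simpa only [Real.coe_toNNReal _ (neg_nonneg.2 ha), neg_mul, neg_neg] using this

theorem sub (h : IsSignedFunctional Λ) (h' : IsSignedFunctional Λ') :
    IsSignedFunctional fun f => Λ f - Λ' f := by
  simpa only [sub_eq_add_neg] using h.add h'.neg

theorem sum {ι : Type*} (s : Finset ι) {Λ : ι → (X → ℝ) → ℝ} (h : ∀ i, IsSignedFunctional (Λ i)) :
    IsSignedFunctional fun f => ∑ i ∈ s, Λ i f := by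
  classical
  induction s using Finset.induction_on with
  | empty => exact ⟨0, 0, inferInstance, inferInstance, fun f _ => by simp⟩
  | insert i s hi ih => simpa [Finset.sum_insert hi] using (h i).add ih

/-- The purpose of the notion: an identity between integrals against signed densities needs checking
only on indicators or, by `eq_zero_of_continuous`, only on continuous functions. -/
theorem eq_zero_of_indicator (h : IsSignedFunctional Λ)
    (h0 : ∀ B, MeasurableSet B → Λ (B.indicator fun _ => 1) = 0) {f : X → ℝ} (hf : BddMeas f) :
    Λ f = 0 := by
  obtain ⟨P, N, _, _, hΛ⟩ := h
  have hPN : P = N := by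
    refine Measure.ext fun B hB => ?_
    have := h0 B hB
    rw [hΛ _ (bddMeas_indicator hB), integral_indicator_const _ hB, integral_indicator_const _ hB,
      smul_eq_mul, smul_eq_mul, mul_one, mul_one, sub_eq_zero] at this
    exact (measureReal_eq_measureReal_iff).1 this
  rw [hΛ f hf, hPN, sub_self]

theorem eq_zero_of_continuous [TopologicalSpace X] [HasOuterApproxClosed X] [BorelSpace X]
    [CompactSpace X] (h : IsSignedFunctional Λ) (h0 : ∀ f : C(X, ℝ), Λ f = 0) {f : X → ℝ}
    (hf : BddMeas f) : Λ f = 0 := by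
  obtain ⟨P, N, _, _, hΛ⟩ := h
  have hPN : P = N := by
    refine ext_of_forall_integral_eq_of_IsFiniteMeasure fun g => ?_
    have := h0 g.toContinuousMap
    rw [hΛ _ (bddMeas_of_continuous g.toContinuousMap.continuous), sub_eq_zero] at this
    exact this
  rw [hΛ f hf, hPN, sub_self]

end IsSignedFunctional

end SignedFunctional


/-! ### The polar decomposition of a matrix-valued measure -/

section Polar

variable {X : Type*} [MeasurableSpace X] {d : ℕ}

/-- The entries of a matrix-valued measure. -/
noncomputable def entryMeasure (τ : VectorMeasure X (symMat d)) (j k : Fin d) : SignedMeasure X :=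
  τ.mapRange (entryHom j k) (continuous_entryHom j k)

theorem entryMeasure_apply (τ : VectorMeasure X (symMat d)) (j k : Fin d) (B : Set X) :
    entryMeasure τ j k B = (τ B : Matrix (Fin d) (Fin d) ℝ) j k := rfl

/-- The Hilbert–Schmidt norm is at most the sum of the absolute values of the entries, and each
entry is a signed measure of finite total variation. -/
instance isFiniteMeasure_totalVar (τ : VectorMeasure X (symMat d)) :
    IsFiniteMeasure (totalVar τ) := by
  have hle : totalVar τ ≤ ∑ j, ∑ k, (entryMeasure τ j k).totalVariation := by
    refine VectorMeasure.variation_le_of_forall_enorm_le fun B hB => ?_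
    have h1 : ‖entriesHom d (τ B)‖ ≤ ∑ j, ∑ k, |entryMeasure τ j k B| := by
      rw [norm_entriesHom]
      refine abs_le_of_sq_le_sq' ?_ (by positivity) |>.2
      rw [hsNorm_sq]
      have h2 : ∀ j, ∑ k, (τ B : Matrix (Fin d) (Fin d) ℝ) j k ^ 2 ≤
          (∑ k, |entryMeasure τ j k B|) ^ 2 := fun j => by
        simp only [← sq_abs ((τ B : Matrix (Fin d) (Fin d) ℝ) j _)]
        exact Finset.sum_sq_le_sq_sum_of_nonneg fun k _ => abs_nonneg _
      refine (Finset.sum_le_sum fun j _ => h2 j).trans ?_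
      exact Finset.sum_sq_le_sq_sum_of_nonneg fun j _ =>
        Finset.sum_nonneg fun k _ => abs_nonneg _
    change ‖entriesHom d (τ B)‖ₑ ≤ _
    rw [← ofReal_norm]
    refine (ENNReal.ofReal_le_ofReal h1).trans ?_
    rw [ENNReal.ofReal_sum_of_nonneg fun j _ => Finset.sum_nonneg fun k _ => abs_nonneg _,
      Measure.finsetSum_apply]
    refine Finset.sum_le_sum fun j _ => ?_
    rw [ENNReal.ofReal_sum_of_nonneg fun k _ => abs_nonneg _, Measure.finsetSum_apply]
    refine Finset.sum_le_sum fun k _ => ?_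
    rw [← Real.norm_eq_abs, ofReal_norm]
    exact (entryMeasure τ j k).enorm_le_totalVariation B
  exact isFiniteMeasure_of_le _ hle

/-- Radon–Nikodym for each entry, which vanishes on ‖τ‖-null sets. All later facts about the polar
part are deduced from this formula. -/
theorem setIntegral_polar (τ : VectorMeasure X (symMat d)) (j k : Fin d) {B : Set X}
    (hB : MeasurableSet B) :
    ∫ x in B, polar τ x j k ∂totalVar τ = (τ B : Matrix (Fin d) (Fin d) ℝ) j k := by
  have hac : entryMeasure τ j k ≪ᵥ (totalVar τ).toENNRealVectorMeasure := by
    refine VectorMeasure.AbsolutelyContinuous.mk fun s hs h0 => ?_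
    rw [Measure.toENNRealVectorMeasure_apply_measurable hs] at h0
    have h1 := VectorMeasure.enorm_measure_le_variation
      (τ.mapRange (entriesHom d) continuous_entriesHom) s
    rw [show VectorMeasure.variation _ s = 0 from h0, nonpos_iff_eq_zero, enorm_eq_zero] at h1
    have h2 : entriesHom d (τ s) = 0 := h1
    have h3 := congrArg (fun w : EuclideanSpace ℝ (Fin d × Fin d) => w (j, k)) h2
    exact h3
  have h := (SignedMeasure.absolutelyContinuous_iff_withDensityᵥ_rnDeriv_eq _ _).1 hac
  have h2 := congrArg (fun s : SignedMeasure X => s B) h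
  rw [← entryMeasure_apply, ← h2]
  exact (withDensityᵥ_apply (SignedMeasure.integrable_rnDeriv _ _) hB).symm

theorem integrable_polar (τ : VectorMeasure X (symMat d)) (j k : Fin d) :
    Integrable (fun x => polar τ x j k) (totalVar τ) :=
  SignedMeasure.integrable_rnDeriv _ _

theorem measurable_polar (τ : VectorMeasure X (symMat d)) (j k : Fin d) :
    Measurable fun x => polar τ x j k :=
  SignedMeasure.measurable_rnDeriv _ _

theorem isSymm_polar (τ : VectorMeasure X (symMat d)) (x : X) : (polar τ x).IsSymm := by
  refine Matrix.IsSymm.ext fun j k => ?_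
  have : τ.mapRange (entryHom k j) (continuous_entryHom k j) =
      τ.mapRange (entryHom j k) (continuous_entryHom j k) := by
    ext B hB
    exact (τ B).2.apply j k
  simp only [polar, Matrix.of_apply, this]

/-- Matrix functions with bounded measurable entries. -/
def MatBddMeas (A : X → Matrix (Fin d) (Fin d) ℝ) : Prop := ∀ j k, BddMeas fun x => A x j k

theorem MatBddMeas.integrable_hsInner {A : X → Matrix (Fin d) (Fin d) ℝ} (hA : MatBddMeas A)
    (τ : VectorMeasure X (symMat d)) :
    Integrable (fun x => hsInner (A x) (polar τ x)) (totalVar τ) := by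
  simp only [hsInner_eq_sum]
  exact integrable_finsetSum _ fun j _ => integrable_finsetSum _ fun k _ =>
    (hA j k).mul_integrable (integrable_polar τ j k)

theorem MatBddMeas.integral_hsInner {A : X → Matrix (Fin d) (Fin d) ℝ} (hA : MatBddMeas A)
    (τ : VectorMeasure X (symMat d)) : ∫ x, hsInner (A x) (polar τ x) ∂totalVar τ =
      ∑ j, ∑ k, ∫ x, A x j k * polar τ x j k ∂totalVar τ := by
  simp only [hsInner_eq_sum]
  have h : ∀ j k, Integrable (fun x => A x j k * polar τ x j k) (totalVar τ) := fun j k =>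
    (hA j k).mul_integrable (integrable_polar τ j k)
  rw [integral_finsetSum _ fun j _ => integrable_finsetSum _ fun k _ => h j k]
  exact Finset.sum_congr rfl fun j _ => integral_finsetSum _ fun k _ => h j k

theorem integral_indicator_mul_polar (τ : VectorMeasure X (symMat d)) (j k : Fin d) {B : Set X}
    (hB : MeasurableSet B) : ∫ x, B.indicator (fun _ => 1) x * polar τ x j k ∂totalVar τ =
      (τ B : Matrix (Fin d) (Fin d) ℝ) j k := by
  rw [← setIntegral_polar τ j k hB, ← integral_indicator hB]
  refine integral_congr_ae (Filter.Eventually.of_forall fun x => ?_)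
  by_cases hx : x ∈ B <;> simp [hx]

theorem isSignedFunctional_polar (τ : VectorMeasure X (symMat d)) (j k : Fin d) :
    IsSignedFunctional fun f : X → ℝ => ∫ x, f x * polar τ x j k ∂totalVar τ :=
  IsSignedFunctional.integral_comp_mul measurable_id (integrable_polar τ j k)

/-- Scaling changes both the total variation and the polar part; testing on indicators avoids
computing either. -/
theorem integral_mul_polar_smul (a : ℝ) (τ : VectorMeasure X (symMat d)) (j k : Fin d) {f : X → ℝ}
    (hf : BddMeas f) : ∫ x, f x * polar (a • τ) x j k ∂totalVar (a • τ) =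
      a * ∫ x, f x * polar τ x j k ∂totalVar τ := by
  have h := (isSignedFunctional_polar (a • τ) j k).sub ((isSignedFunctional_polar τ j k).const_mul a)
  refine sub_eq_zero.1 (h.eq_zero_of_indicator (fun B hB => ?_) hf)
  rw [integral_indicator_mul_polar _ _ _ hB, integral_indicator_mul_polar _ _ _ hB]
  exact sub_self _

theorem hsIntegralOn_univ_smul (a : ℝ) (τ : VectorMeasure X (symMat d))
    {A : X → Matrix (Fin d) (Fin d) ℝ} (hA : MatBddMeas A) :
    hsIntegralOn univ A (a • τ) = a * hsIntegralOn univ A τ := by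
  simp only [hsIntegralOn, setIntegral_univ]
  rw [hA.integral_hsInner, hA.integral_hsInner, Finset.mul_sum]
  refine Finset.sum_congr rfl fun j _ => ?_
  rw [Finset.mul_sum]
  exact Finset.sum_congr rfl fun k _ => integral_mul_polar_smul a τ j k (hA j k)

/-- The polar part vanishes almost nowhere. -/
theorem ae_polar_ne_zero (τ : VectorMeasure X (symMat d)) : ∀ᵐ x ∂totalVar τ, polar τ x ≠ 0 := by
  have hm : MeasurableSet {x | polar τ x = 0} := by
    have : {x | polar τ x = 0} = ⋂ j, ⋂ k, {x | polar τ x j k = 0} := by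
      ext x
      simp only [mem_ofPred_eq, mem_iInter]
      exact ⟨fun h j k => by rw [h]; rfl, fun h => Matrix.ext h⟩
    rw [this]
    exact MeasurableSet.iInter fun j => MeasurableSet.iInter fun k =>
      measurable_polar τ j k (measurableSet_singleton 0)
  rw [ae_iff]
  simp only [not_not]
  -- Every measurable subset of the zero set of the polar part has τ-mass zero, hence that set has
  -- variation zero.
  refine (VectorMeasure.variation_apply_eq_zero hm).2 fun t ht htm => ?_
  have : τ t = 0 := by
    refine Subtype.ext (Matrix.ext fun j k => ?_)
    rw [← setIntegral_polar τ j k htm]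
    refine setIntegral_eq_zero_of_forall_eq_zero fun x hx => ?_
    rw [ht hx]; rfl
  change entriesHom d (τ t) = 0
  rw [this, map_zero]

end Polar


/-! ### The eigenmeasure -/

namespace FractalSystem

open Filter Topology

variable {d n : ℕ} {ν η : ℝ≥0} {S : FractalSystem d n ν η}

theorem matBddMeas_coe (A : C(S.G, symMat d)) :
    MatBddMeas fun x => (A x : Matrix (Fin d) (Fin d) ℝ) := fun j k =>
  bddMeas_of_continuous (S.entryFun A j k).continuous

theorem pairing_eq_integral (A : C(S.G, symMat d)) (τ : VectorMeasure S.G (symMat d)) :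
    S.pairing A τ =
      ∫ x, hsInner (A x : Matrix (Fin d) (Fin d) ℝ) (polar τ x) ∂totalVar τ := by
  rw [pairing, hsIntegralOn, setIntegral_univ]

theorem pairing_eq_sum (A : C(S.G, symMat d)) (τ : VectorMeasure S.G (symMat d)) :
    S.pairing A τ =
      ∑ j, ∑ k, ∫ x, (A x : Matrix (Fin d) (Fin d) ℝ) j k * polar τ x j k ∂totalVar τ := by
  rw [pairing_eq_integral]
  exact (matBddMeas_coe A).integral_hsInner τ

variable (S) in
/-- The pairing with a measure, as a linear functional. -/
noncomputable def pairingLM (τ : VectorMeasure S.G (symMat d)) : C(S.G, symMat d) →ₗ[ℝ] ℝ where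
  toFun A := S.pairing A τ
  map_add' A B := by
    rw [pairing_eq_integral, pairing_eq_integral, pairing_eq_integral, ← integral_add
      ((matBddMeas_coe A).integrable_hsInner τ) ((matBddMeas_coe B).integrable_hsInner τ)]
    exact integral_congr_ae (Eventually.of_forall fun x => hsInner_add_left _ _ _)
  map_smul' a A := by
    rw [pairing_eq_integral, pairing_eq_integral, RingHom.id_apply, smul_eq_mul,
      ← integral_const_mul]
    exact integral_congr_ae (Eventually.of_forall fun x => hsInner_smul_left _ _ _)

theorem pairing_smul_left (a : ℝ) (A : C(S.G, symMat d)) (τ : VectorMeasure S.G (symMat d)) :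
    S.pairing (a • A) τ = a * S.pairing A τ := (S.pairingLM τ).map_smul a A

theorem pairing_smul_right (a : ℝ) (A : C(S.G, symMat d)) (τ : VectorMeasure S.G (symMat d)) :
    S.pairing A (a • τ) = a * S.pairing A τ :=
  hsIntegralOn_univ_smul a τ (matBddMeas_coe A)

section Norm

attribute [local instance] symMatNormedAddCommGroup symMatNormedSpace

theorem continuous_pairing (τ : VectorMeasure S.G (symMat d)) :
    Continuous fun A => S.pairing A τ := by
  have h : ∀ A, ‖S.pairingLM τ A‖ ≤
      (∑ j, ∑ k, ∫ x, |polar τ x j k| ∂totalVar τ) * ‖A‖ := fun A => by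
    change ‖S.pairing A τ‖ ≤ _
    rw [pairing_eq_sum, Finset.sum_mul]
    refine (norm_sum_le _ _).trans (Finset.sum_le_sum fun j _ => ?_)
    rw [Finset.sum_mul]
    refine (norm_sum_le _ _).trans (Finset.sum_le_sum fun k _ => ?_)
    rw [← integral_mul_const]
    refine norm_integral_le_of_norm_le ((integrable_polar τ j k).abs.mul_const _)
      (Eventually.of_forall fun x => ?_)
    rw [Real.norm_eq_abs, abs_mul, mul_comm]
    refine mul_le_mul_of_nonneg_left ?_ (abs_nonneg _)
    exact (symMat_norm_le_iff (norm_nonneg A)).1 (A.norm_coe_le_norm x) j k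
  exact ((S.pairingLM τ).mkContinuous _ h).continuous

end Norm

/-! ### Polarization, and the measure that represents the functional. -/

/-- The rank one matrix `v ᵗv`. -/
def rankOne (v : Fin d → ℝ) : symMat d := ⟨Matrix.vecMulVec v v, by
  refine Matrix.IsSymm.ext fun j k => ?_
  simp [Matrix.vecMulVec_apply, mul_comm]⟩

theorem symUnit_eq (j k : Fin d) : symUnit j k = (1 / 2 : ℝ) •
    (rankOne (Pi.single j 1 + Pi.single k 1) - rankOne (Pi.single j 1) -
      rankOne (Pi.single k 1)) := by
  refine Subtype.ext ?_
  change (1 / 2 : ℝ) • (Matrix.single j k 1 + Matrix.single k j 1) = (1 / 2 : ℝ) •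
    (Matrix.vecMulVec (Pi.single j 1 + Pi.single k 1) (Pi.single j 1 + Pi.single k 1) -
      Matrix.vecMulVec (Pi.single j 1) (Pi.single j 1) -
        Matrix.vecMulVec (Pi.single k 1) (Pi.single k 1))
  congr 1
  rw [Matrix.add_vecMulVec, Matrix.vecMulVec_add, Matrix.vecMulVec_add,
    Matrix.single_eq_single_vecMulVec_single, Matrix.single_eq_single_vecMulVec_single]
  abel

theorem pairing_smulConst (f : C(S.G, ℝ)) (M : symMat d) (τ : VectorMeasure S.G (symMat d)) :
    S.pairing (S.smulConst f M) τ =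
      ∫ x, f x * hsInner (M : Matrix (Fin d) (Fin d) ℝ) (polar τ x) ∂totalVar τ := by
  rw [pairing_eq_integral]
  exact integral_congr_ae (Eventually.of_forall fun x => hsInner_smul_left _ _ _)

theorem pairing_smulConst_symUnit (f : C(S.G, ℝ)) (j k : Fin d)
    (τ : VectorMeasure S.G (symMat d)) :
    S.pairing (S.smulConst f (symUnit j k)) τ = ∫ x, f x * polar τ x j k ∂totalVar τ := by
  rw [pairing_smulConst]
  simp only [hsInner_symUnit (isSymm_polar τ _)]

/-- A matrix-valued measure is determined by its pairing with continuous functions. -/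
theorem eq_smul_of_pairing {σ τ : VectorMeasure S.G (symMat d)} {a : ℝ}
    (h : ∀ A, S.pairing A σ = a * S.pairing A τ) : σ = a • τ := by
  ext B hB : 1
  refine Subtype.ext (Matrix.ext fun j k => ?_)
  have h1 := ((isSignedFunctional_polar σ j k).sub
    ((isSignedFunctional_polar τ j k).const_mul a)).eq_zero_of_continuous (fun f => by
      rw [← pairing_smulConst_symUnit, ← pairing_smulConst_symUnit, h, sub_self])
    (bddMeas_indicator hB)
  rw [integral_indicator_mul_polar _ _ _ hB, integral_indicator_mul_polar _ _ _ hB,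
    sub_eq_zero] at h1
  exact h1

variable (S) in
/-- `f ↦ f M` as a linear map. -/
def smulConstLM (M : symMat d) : C(S.G, ℝ) →ₗ[ℝ] C(S.G, symMat d) where
  toFun f := S.smulConst f M
  map_add' f g := by ext x : 1; exact add_smul (f x) (g x) M
  map_smul' a f := by ext x : 1; exact mul_smul a (f x) M

variable {β : ℝ} {Q : C(S.G, symMat d)} {c : C(S.G, symMat d) →ₗ[ℝ] ℝ}

/-- For f ≥ 0 the field f v ᵗv is positive semidefinite, so c is a positive functional of f and
Riesz' theorem applies. -/
theorem IsSpectralData.exists_measure (h : S.IsSpectralData β Q c) (v : Fin d → ℝ) :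
    ∃ μ : Measure S.G, IsFiniteMeasure μ ∧
      ∀ f : C(S.G, ℝ), ∫ x, f x ∂μ = c (S.smulConst f (rankOne v)) := by
  have hpos : ∀ f : C(S.G, ℝ), 0 ≤ f → 0 ≤ c (S.smulConst f (rankOne v)) := fun f hf =>
    h.map_nonneg _ fun x w => by
      rw [coe_smulConst, quad_smul]
      refine mul_nonneg (hf x) ?_
      change 0 ≤ w ⬝ᵥ Matrix.vecMulVec v v *ᵥ w
      rw [Matrix.vecMulVec_mulVec, op_smul_eq_smul, dotProduct_smul, dotProduct_comm w v]
      exact mul_self_nonneg _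
  let Λ : CompactlySupportedContinuousMap S.G ℝ →ₚ[ℝ] ℝ :=
    { toFun := fun g => c (S.smulConst g.toContinuousMap (rankOne v))
      map_add' := fun g g' => by
        exact (c ∘ₗ S.smulConstLM (rankOne v)).map_add g.toContinuousMap g'.toContinuousMap
      map_smul' := fun a g => by
        exact (c ∘ₗ S.smulConstLM (rankOne v)).map_smul a g.toContinuousMap
      monotone' := fun g g' hgg' => by
        have h1 := hpos (g'.toContinuousMap - g.toContinuousMap)
          (fun x => sub_nonneg.2 (hgg' x))
        have h2 := (c ∘ₗ S.smulConstLM (rankOne v)).map_sub g'.toContinuousMap g.toContinuousMap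
        exact sub_nonneg.1 (h1.trans_eq h2) }
  refine ⟨RealRMK.rieszMeasure Λ, inferInstance, fun f => ?_⟩
  exact RealRMK.integral_rieszMeasure Λ ⟨f, HasCompactSupport.of_compactSpace _⟩

/-- The multiples of a symmetric matrix. -/
def lineHom (M : symMat d) : ℝ →+ symMat d where
  toFun r := r • M
  map_zero' := zero_smul ℝ M
  map_add' r s := add_smul r s M

theorem continuous_lineHom (M : symMat d) : Continuous (lineHom M) :=
  Continuous.subtype_mk
    (continuous_id.smul (continuous_const (y := (M : Matrix (Fin d) (Fin d) ℝ)))) _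

/-- The functional `c` is given by a positive matrix-valued measure. -/
theorem IsSpectralData.exists_eigenmeasure (h : S.IsSpectralData β Q c) :
    ∃ τ : VectorMeasure S.G (symMat d), (∀ A, S.pairing A τ = c A) ∧
      ∀ B, MeasurableSet B → (τ B : Matrix (Fin d) (Fin d) ℝ).PosSemidef := by
  choose μ hfin hμ using h.exists_measure
  let e : Fin d → Fin d → ℝ := fun j => Pi.single j 1
  -- The polarization of v ↦ μ v, which mirrors `symUnit_eq`.
  let s : Fin d → Fin d → SignedMeasure S.G := fun j k => (1 / 2 : ℝ) •
    ((μ (e j + e k)).toSignedMeasure - (μ (e j)).toSignedMeasure - (μ (e k)).toSignedMeasure)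
  have hsymm : ∀ j k, s j k = s k j := fun j k => by
    simp only [s, add_comm (e j) (e k)]
    congr 1
    abel
  let τ : VectorMeasure S.G (symMat d) :=
    ∑ j, ∑ k, (s j k).mapRange (lineHom (symUnit j k)) (continuous_lineHom _)
  have hτ : ∀ B j k, (τ B : Matrix (Fin d) (Fin d) ℝ) j k = s j k B := fun B j k => by
    have h1 : τ B = ∑ j, ∑ k, s j k B • symUnit j k := by
      simp only [τ, FunLike.coe_sum, Finset.sum_apply]
      rfl
    rw [h1]
    exact sum_smul_symUnit (fun j k => by rw [hsymm]) j k
  have hentry : ∀ f : C(S.G, ℝ), ∀ j k, ∫ x, f x * polar τ x j k ∂totalVar τ =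
      c (S.smulConst f (symUnit j k)) := fun f j k => by
    have h1 := ((isSignedFunctional_polar τ j k).sub
      ((((IsSignedFunctional.integral (μ (e j + e k))).sub
        (IsSignedFunctional.integral (μ (e j)))).sub
          (IsSignedFunctional.integral (μ (e k)))).const_mul (1 / 2))).eq_zero_of_indicator
      (fun B hB => by
        rw [integral_indicator_mul_polar _ _ _ hB, hτ, sub_eq_zero]
        simp only [integral_indicator_const _ hB, smul_eq_mul, mul_one]
        change (1 / 2 : ℝ) * ((μ (e j + e k)).toSignedMeasure B - (μ (e j)).toSignedMeasure B -
          (μ (e k)).toSignedMeasure B) = _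
        simp only [Measure.toSignedMeasure_apply_measurable hB])
      (bddMeas_of_continuous f.continuous)
    rw [sub_eq_zero.1 h1, hμ, hμ, hμ]
    have h2 : S.smulConst f (symUnit j k) = (1 / 2 : ℝ) • (S.smulConst f (rankOne (e j + e k)) -
        S.smulConst f (rankOne (e j)) - S.smulConst f (rankOne (e k))) := by
      ext x : 1
      change f x • symUnit j k = (1 / 2 : ℝ) • (f x • rankOne (e j + e k) -
        f x • rankOne (e j) - f x • rankOne (e k))
      rw [symUnit_eq]
      module
    rw [h2, map_smul, map_sub, map_sub, smul_eq_mul]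
  have hpair : ∀ A, S.pairing A τ = c A := fun A => by
    rw [pairing_eq_sum]
    conv_rhs => rw [S.eq_sum_smulConst A]
    simp only [map_sum]
    exact Finset.sum_congr rfl fun j _ => Finset.sum_congr rfl fun k _ =>
      hentry (S.entryFun A j k) j k
  refine ⟨τ, hpair, fun B hB => posSemidef_of_quad (τ B).2 fun v => ?_⟩
  have hquad : ∀ T : Matrix (Fin d) (Fin d) ℝ, quad T v = ∑ j, ∑ k, v j * v k * T j k := fun T => by
    rw [← hsInner_vecMulVec, hsInner_eq_sum]
    simp only [Matrix.vecMulVec_apply]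
  -- The quadratic form of τ(B) at an arbitrary v is μ v (B): both sides represent f ↦ c(f v ᵗv).
  -- Hence it is nonnegative.
  have h1 := ((IsSignedFunctional.sum Finset.univ fun j => IsSignedFunctional.sum Finset.univ
    fun k => (isSignedFunctional_polar τ j k).const_mul (v j * v k)).sub
      (IsSignedFunctional.integral (μ v))).eq_zero_of_continuous (fun f => by
        rw [sub_eq_zero, hμ, ← hpair, pairing_eq_sum]
        refine Finset.sum_congr rfl fun j _ => Finset.sum_congr rfl fun k _ => ?_
        rw [← integral_const_mul]
        refine integral_congr_ae (Eventually.of_forall fun x => ?_)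
        change v j * v k * (f x * polar τ x j k) = f x * (v j * v k) * polar τ x j k
        ring) (bddMeas_indicator hB)
  simp only [integral_indicator_mul_polar _ _ _ hB, sub_eq_zero, integral_indicator_const _ hB,
    smul_eq_mul, mul_one] at h1
  rw [hquad, h1]
  exact measureReal_nonneg

end FractalSystem


/-! ### Positivity of the polar part and the adjoint identity for Borel functions -/

section PolarPositive

variable {X : Type*} [MeasurableSpace X] {d : ℕ}

/-- The polar part of a positive matrix-valued measure is positive. -/
theorem ae_quad_polar_nonneg {τ : VectorMeasure X (symMat d)}
    (h : ∀ B, MeasurableSet B → (τ B : Matrix (Fin d) (Fin d) ℝ).PosSemidef) :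
    ∀ᵐ x ∂totalVar τ, ∀ v, 0 ≤ quad (polar τ x) v := by
  have hq : ∀ v (T : Matrix (Fin d) (Fin d) ℝ), quad T v = ∑ j, ∑ k, v j * v k * T j k :=
    fun v T => by
      rw [← hsInner_vecMulVec, hsInner_eq_sum]
      simp only [Matrix.vecMulVec_apply]
  have h1 : ∀ v, ∀ᵐ x ∂totalVar τ, 0 ≤ quad (polar τ x) v := fun v => by
    have hi : ∀ j k, Integrable (fun x => v j * v k * polar τ x j k) (totalVar τ) := fun j k =>
      (integrable_polar τ j k).const_mul _
    have hi' : Integrable (fun x => quad (polar τ x) v) (totalVar τ) := by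
      simp only [hq]
      exact integrable_finsetSum _ fun j _ => integrable_finsetSum _ fun k _ => hi j k
    refine ae_nonneg_of_forall_setIntegral_nonneg hi' fun B hB _ => ?_
    have h2 : ∫ x in B, quad (polar τ x) v ∂totalVar τ =
        quad (τ B : Matrix (Fin d) (Fin d) ℝ) v := by
      simp only [hq]
      rw [integral_finsetSum _ fun j _ => integrable_finsetSum _ fun k _ => (hi j k).integrableOn]
      refine Finset.sum_congr rfl fun j _ => ?_
      rw [integral_finsetSum _ fun k _ => (hi j k).integrableOn]
      refine Finset.sum_congr rfl fun k _ => ?_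
      rw [integral_const_mul, setIntegral_polar τ j k hB]
    rw [h2]
    have := (h B hB).dotProduct_mulVec_nonneg v
    simpa [quad] using this
  -- A countable dense set of vectors gives one null set for all v, by continuity of the form.
  have h3 : ∀ᵐ x ∂totalVar τ, ∀ i, 0 ≤ quad (polar τ x) (TopologicalSpace.denseSeq _ i) :=
    ae_all_iff.2 fun i => h1 _
  filter_upwards [h3] with x hx v
  have hcl : IsClosed {v | 0 ≤ quad (polar τ x) v} :=
    isClosed_le continuous_const (continuous_quad.comp (continuous_const.prodMk continuous_id))
  have := (TopologicalSpace.denseRange_denseSeq (Fin d → ℝ)).closure_eq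
  have hsub : closure (range (TopologicalSpace.denseSeq (Fin d → ℝ))) ⊆
      {v | 0 ≤ quad (polar τ x) v} := hcl.closure_subset_iff.2 (by
        rintro _ ⟨i, rfl⟩
        exact hx i)
  exact hsub (this ▸ mem_univ v)

theorem ae_trace_polar_pos {τ : VectorMeasure X (symMat d)}
    (h : ∀ B, MeasurableSet B → (τ B : Matrix (Fin d) (Fin d) ℝ).PosSemidef) :
    ∀ᵐ x ∂totalVar τ, 0 < (polar τ x).trace := by
  filter_upwards [ae_quad_polar_nonneg h, ae_polar_ne_zero τ] with x hx h0
  refine (trace_nonneg_of_quad hx).lt_of_ne' fun ht => h0 ?_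
  exact (posSemidef_of_quad (isSymm_polar τ x) hx).trace_eq_zero_iff.1 ht

theorem MatBddMeas.smul {A : X → Matrix (Fin d) (Fin d) ℝ} (hA : MatBddMeas A)
    {f : X → ℝ} (hf : BddMeas f) : MatBddMeas fun x => f x • A x := fun j k => hf.mul (hA j k)

end PolarPositive

namespace FractalSystem

open Filter Topology

variable {d n : ℕ} {ν η : ℝ≥0} {S : FractalSystem d n ν η}

variable (S) in
/-- The matrix field `Dψ_i T ᵗDψ_i`, where `T` is the polar part of `τ`. -/
noncomputable def pushPolar (τ : VectorMeasure S.G (symMat d)) (i : Fin n) (x : S.G) :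
    Matrix (Fin d) (Fin d) ℝ := jac (S.ψ i) x * polar τ x * (jac (S.ψ i) x)ᵀ

theorem isSymm_pushPolar (τ : VectorMeasure S.G (symMat d)) (i : Fin n) (x : S.G) :
    (S.pushPolar τ i x).IsSymm := by
  change (_ : Matrix (Fin d) (Fin d) ℝ)ᵀ = _
  rw [pushPolar, Matrix.transpose_mul, Matrix.transpose_mul, Matrix.transpose_transpose,
    (isSymm_polar τ x).eq, Matrix.mul_assoc]

theorem integrable_pushPolar (τ : VectorMeasure S.G (symMat d)) (i : Fin n) (j k : Fin d) :
    Integrable (fun x => S.pushPolar τ i x j k) (totalVar τ) := by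
  have hD : ∀ j k, BddMeas fun x : S.G => jac (S.ψ i) x j k := fun j k =>
    bddMeas_of_continuous ((S.continuous_jac i).matrix_elem j k)
  simp only [pushPolar, Matrix.mul_apply, Matrix.transpose_apply]
  refine integrable_finsetSum _ fun l _ => ?_
  simp only [mul_comm _ (jac (S.ψ i) _ k l)]
  exact (hD k l).mul_integrable (integrable_finsetSum _ fun l' _ =>
    (hD j l').mul_integrable (integrable_polar τ l' l))

theorem integrable_hsInner_pushPolar (τ : VectorMeasure S.G (symMat d)) (i : Fin n)
    {A : S.G → Matrix (Fin d) (Fin d) ℝ} (hA : MatBddMeas A) :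
    Integrable (fun x => hsInner (A (S.ψG i x)) (S.pushPolar τ i x)) (totalVar τ) := by
  simp only [hsInner_eq_sum]
  exact integrable_finsetSum _ fun j _ => integrable_finsetSum _ fun k _ =>
    ((hA j k).comp (S.continuous_ψG i).measurable).mul_integrable (integrable_pushPolar τ i j k)

theorem hsInner_ruelle (A : C(S.G, symMat d)) (τ : VectorMeasure S.G (symMat d)) (x : S.G) :
    hsInner (S.ruelle A x : Matrix (Fin d) (Fin d) ℝ) (polar τ x) =
      ∑ i, hsInner (A (S.ψG i x) : Matrix (Fin d) (Fin d) ℝ) (S.pushPolar τ i x) := by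
  rw [coe_ruelle, hsInner_sum_left]
  exact Finset.sum_congr rfl fun i _ => hsInner_conj _ _ _

variable {β : ℝ} {Q : C(S.G, symMat d)} {c : C(S.G, symMat d) →ₗ[ℝ] ℝ}
  {τ : VectorMeasure S.G (symMat d)}

/-- An eigenmeasure of the adjoint operator, tested entry by entry against Borel functions. -/
theorem IsAdjointImage.mul_integral_polar (h : S.IsAdjointImage τ (β • τ)) (j k : Fin d)
    {f : S.G → ℝ} (hf : BddMeas f) : β * ∫ x, f x * polar τ x j k ∂totalVar τ =
      ∑ i, ∫ x, f (S.ψG i x) * S.pushPolar τ i x j k ∂totalVar τ := by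
  have h1 := ((isSignedFunctional_polar τ j k).const_mul β).sub
    (IsSignedFunctional.sum Finset.univ fun i => IsSignedFunctional.integral_comp_mul
      (S.continuous_ψG i).measurable (integrable_pushPolar τ i j k))
  refine sub_eq_zero.1 (h1.eq_zero_of_continuous (fun f => ?_) hf)
  rw [sub_eq_zero, ← pairing_smulConst_symUnit, ← pairing_smul_right, h, pairing_eq_integral]
  simp only [hsInner_ruelle]
  rw [integral_finsetSum _ fun i _ => integrable_hsInner_pushPolar τ i (matBddMeas_coe _)]
  refine Finset.sum_congr rfl fun i _ => integral_congr_ae (Eventually.of_forall fun x => ?_)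
  simp only [coe_smulConst]
  rw [hsInner_smul_left, hsInner_symUnit (isSymm_pushPolar τ i x)]

/-- An eigenmeasure of the adjoint operator, tested against Borel functions. -/
theorem IsAdjointImage.mul_integral (h : S.IsAdjointImage τ (β • τ))
    {A : S.G → Matrix (Fin d) (Fin d) ℝ} (hA : MatBddMeas A) :
    β * ∫ x, hsInner (A x) (polar τ x) ∂totalVar τ =
      ∑ i, ∫ x, hsInner (A (S.ψG i x)) (S.pushPolar τ i x) ∂totalVar τ := by
  have hi : ∀ i j k, Integrable (fun x => A (S.ψG i x) j k * S.pushPolar τ i x j k)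
      (totalVar τ) := fun i j k =>
    ((hA j k).comp (S.continuous_ψG i).measurable).mul_integrable (integrable_pushPolar τ i j k)
  rw [hA.integral_hsInner, Finset.mul_sum]
  simp only [hsInner_eq_sum]
  have h1 : ∀ i, ∫ x, ∑ j, ∑ k, A (S.ψG i x) j k * S.pushPolar τ i x j k ∂totalVar τ =
      ∑ j, ∑ k, ∫ x, A (S.ψG i x) j k * S.pushPolar τ i x j k ∂totalVar τ := fun i => by
    rw [integral_finsetSum _ fun j _ => integrable_finsetSum _ fun k _ => hi i j k]
    exact Finset.sum_congr rfl fun j _ => integral_finsetSum _ fun k _ => hi i j k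
  simp only [h1]
  rw [Finset.sum_comm]
  refine Finset.sum_congr rfl fun j _ => ?_
  rw [Finset.mul_sum, Finset.sum_comm]
  exact Finset.sum_congr rfl fun k _ => h.mul_integral_polar j k (hA j k)

theorem IsSpectralData.isAdjointImage (h : S.IsSpectralData β Q c)
    (hτ : ∀ A, S.pairing A τ = c A) : S.IsAdjointImage τ (β • τ) := fun A => by
  rw [pairing_smul_right, hτ, hτ, h.map_ruelle]

theorem IsSpectralData.ne_zero (h : S.IsSpectralData β Q c)
    (hτ : ∀ A, S.pairing A τ = c A) : τ ≠ 0 := fun h0 => by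
  have h1 := pairing_smul_right 0 Q τ
  have e : (0 : ℝ) • τ = τ := by
    rw [h0]
    ext B hB : 1
    exact smul_zero (A := symMat d) (0 : ℝ)
  rw [e, zero_mul, hτ, h.map_Q] at h1
  exact one_ne_zero h1

/-- The eigenmeasure is unique up to multiples. -/
theorem IsSpectralData.eq_smul_of_isAdjointImage (h : S.IsSpectralData β Q c)
    (hτ : ∀ A, S.pairing A τ = c A) {σ : VectorMeasure S.G (symMat d)}
    (hσ : S.IsAdjointImage σ (β • σ)) : σ = S.pairing Q σ • τ := by
  refine eq_smul_of_pairing fun A => ?_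
  rw [hτ]
  -- The eigenvalue equation of σ makes these pairings constant in k; their limit is c(A) ⟨Q, σ⟩.
  have h1 : ∀ k : ℕ, S.pairing ((β ^ k)⁻¹ • (S.ruelle ^ k) A) σ = S.pairing A σ := fun k => by
    induction k with
    | zero => simp
    | succ k ih =>
      rw [← ih, pow_succ' S.ruelle, Module.End.mul_apply, pairing_smul_left, pairing_smul_left,
        ← hσ, pairing_smul_right, pow_succ, mul_inv, mul_assoc, ← mul_assoc β⁻¹,
        inv_mul_cancel₀ h.pos.ne', one_mul]
  have h2 := ((continuous_pairing σ).tendsto (c A • Q)).comp (h.tendsto A)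
  have h3 := tendsto_nhds_unique (tendsto_const_nhds.congr fun k => (h1 k).symm) h2
  rw [h3, pairing_smul_left, mul_comm]

end FractalSystem


/-! ### The scalar measure -/

theorem hsInner_le_mul_trace {d : ℕ} {A T : Matrix (Fin d) (Fin d) ℝ} {m : ℝ} (hT : T.IsSymm)
    (hT0 : ∀ v, 0 ≤ quad T v) (hA : ∀ v, quad A v ≤ m * (v ⬝ᵥ v)) :
    hsInner A T ≤ m * T.trace := by
  have h := mul_trace_le_hsInner (A := (-1 : ℝ) • A) (m := -m) hT hT0 fun v => by
    rw [quad_smul]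
    linarith [hA v]
  rw [hsInner_smul_left] at h
  linarith

namespace FractalSystem

open Filter Topology

variable {d n : ℕ} {ν η : ℝ≥0} {S : FractalSystem d n ν η}

theorem injective_ψ (i : Fin n) : Function.Injective (S.ψ i) := by
  obtain ⟨φ, -, h, -⟩ := S.diffeo i
  exact h.injective

theorem injective_ψG (i : Fin n) : Function.Injective (S.ψG i) := fun _ _ h =>
  Subtype.ext (injective_ψ i (congrArg Subtype.val h))

-- The inverse of ψ_i is C¹, so its derivative is bounded on the compact set ψ_i(G).
variable (S) in
theorem exists_le_jac_mulVec : ∃ l : ℝ, 0 < l ∧ ∀ i (x : S.G) v,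
    l * (v ⬝ᵥ v) ≤ (jac (S.ψ i) x *ᵥ v) ⬝ᵥ (jac (S.ψ i) x *ᵥ v) := by
  have h : ∀ i, ∃ K : ℝ, ∀ (x : S.G) v,
      v ⬝ᵥ v ≤ K ^ 2 * ((jac (S.ψ i) x *ᵥ v) ⬝ᵥ (jac (S.ψ i) x *ᵥ v)) := fun i => by
    obtain ⟨φ, hφ, hl, -⟩ := S.diffeo i
    have hc : Continuous fun x : S.G => fderiv ℝ φ (S.ψ i x) :=
      (hφ.continuous_fderiv one_ne_zero).comp
        ((S.contDiff i).continuous.comp continuous_subtype_val)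
    obtain ⟨K, hK⟩ := isCompact_univ.exists_bound_of_continuousOn hc.continuousOn
    refine ⟨K, fun x v => ?_⟩
    have h1 : HasFDerivAt (φ ∘ S.ψ i)
        ((fderiv ℝ φ (S.ψ i x)).comp (fderiv ℝ (S.ψ i) x)) (x : Euc d) :=
      ((hφ.differentiable one_ne_zero _).hasFDerivAt).comp _
        (((S.contDiff i).differentiable one_ne_zero _).hasFDerivAt)
    rw [hl.comp_eq_id] at h1
    have h2 := h1.unique (hasFDerivAt_id _)
    set w : Euc d := WithLp.toLp 2 v
    have h3 : fderiv ℝ φ (S.ψ i x) (fderiv ℝ (S.ψ i) x w) = w := by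
      rw [← ContinuousLinearMap.comp_apply, h2]; rfl
    have h4 : ‖w‖ ≤ K * ‖fderiv ℝ (S.ψ i) x w‖ := by
      conv_lhs => rw [← h3]
      exact (ContinuousLinearMap.le_opNorm _ _).trans
        (mul_le_mul_of_nonneg_right (hK x (mem_univ x)) (norm_nonneg _))
    rw [jac_mulVec, dotProduct_self_eq_norm_sq, dotProduct_self_eq_norm_sq, ← mul_pow]
    exact pow_le_pow_left₀ (norm_nonneg _) h4 2
  choose K hK using h
  have hpos : 0 < ∑ i, K i ^ 2 + 1 := by positivity
  refine ⟨(∑ i, K i ^ 2 + 1)⁻¹, inv_pos.2 hpos, fun i x v => ?_⟩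
  rw [inv_mul_le_iff₀ hpos]
  refine (hK i x v).trans (mul_le_mul_of_nonneg_right ?_ (dotProduct_self_nonneg' _))
  have := Finset.single_le_sum (f := fun i => K i ^ 2) (fun i _ => sq_nonneg (K i))
    (Finset.mem_univ i)
  linarith

variable (S) in
theorem exists_quad_le (A : C(S.G, symMat d)) : ∃ C : ℝ, 0 < C ∧ ∀ x v,
    quad (A x : Matrix (Fin d) (Fin d) ℝ) v ≤ C * (v ⬝ᵥ v) := by
  have h : ∀ j k, ∃ C, ∀ x, |(A x : Matrix (Fin d) (Fin d) ℝ) j k| ≤ C := fun j k =>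
    (matBddMeas_coe A j k).2
  choose C hC using h
  have hC' : ∀ x j k, |(A x : Matrix (Fin d) (Fin d) ℝ) j k| ≤ ∑ j, ∑ k, |C j k| := fun x j k =>
    ((hC j k x).trans (le_abs_self _)).trans
      ((Finset.single_le_sum (f := fun k => |C j k|) (fun k _ => abs_nonneg _)
        (Finset.mem_univ k)).trans
        (Finset.single_le_sum (f := fun j => ∑ k, |C j k|)
          (fun j _ => Finset.sum_nonneg fun k _ => abs_nonneg _) (Finset.mem_univ j)))
  refine ⟨d * (∑ j, ∑ k, |C j k|) + 1, by positivity, fun x v => ?_⟩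
  have h1 := (le_abs_self _).trans (abs_quad_le_of_entry (hC' x) v)
  have h2 := dotProduct_self_nonneg' v
  nlinarith

variable (S) in
/-- The density of `(Q, τ)_HS` with respect to `‖τ‖`. -/
noncomputable def hsDensity (Q : C(S.G, symMat d)) (τ : VectorMeasure S.G (symMat d)) (x : S.G) :
    ℝ := hsInner (Q x : Matrix (Fin d) (Fin d) ℝ) (polar τ x)

variable (S) in
/-- The measure `(Q, τ)_HS`. -/
noncomputable def hsMeasure (Q : C(S.G, symMat d)) (τ : VectorMeasure S.G (symMat d)) :
    Measure S.G := (totalVar τ).withDensity fun x => ENNReal.ofReal (S.hsDensity Q τ x)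

variable (S) in
/-- The contribution of the branch `ψ_i` to the density of `(L Q, τ)_HS`. -/
noncomputable def branchDensity (Q : C(S.G, symMat d)) (τ : VectorMeasure S.G (symMat d))
    (i : Fin n) (x : S.G) : ℝ :=
  hsInner (Q (S.ψG i x) : Matrix (Fin d) (Fin d) ℝ) (S.pushPolar τ i x)

theorem integrable_hsDensity (Q : C(S.G, symMat d)) (τ : VectorMeasure S.G (symMat d)) :
    Integrable (S.hsDensity Q τ) (totalVar τ) := (matBddMeas_coe Q).integrable_hsInner τ

theorem integrable_branchDensity (Q : C(S.G, symMat d)) (τ : VectorMeasure S.G (symMat d))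
    (i : Fin n) : Integrable (S.branchDensity Q τ i) (totalVar τ) := by
  have h := integrable_hsInner_pushPolar (S := S)
    (A := fun x => (Q x : Matrix (Fin d) (Fin d) ℝ)) τ i (matBddMeas_coe Q)
  exact h

instance isFiniteMeasure_hsMeasure (Q : C(S.G, symMat d)) (τ : VectorMeasure S.G (symMat d)) :
    IsFiniteMeasure (S.hsMeasure Q τ) :=
  isFiniteMeasure_withDensity_ofReal (integrable_hsDensity Q τ).2

variable {β : ℝ} {Q : C(S.G, symMat d)} {c : C(S.G, symMat d) →ₗ[ℝ] ℝ}
  {τ : VectorMeasure S.G (symMat d)}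

namespace IsSpectralData

/-- If Q ≥ m I, the density is at least m times the trace of the polar part, which is positive
almost everywhere. Hence κ and ‖τ‖ have the same null sets. -/
theorem ae_hsDensity_pos (h : S.IsSpectralData β Q c)
    (hτ : ∀ B, MeasurableSet B → (τ B : Matrix (Fin d) (Fin d) ℝ).PosSemidef) :
    ∀ᵐ x ∂totalVar τ, 0 < S.hsDensity Q τ x := by
  obtain ⟨m, hm, hQ⟩ := h.exists_le_quad
  filter_upwards [ae_quad_polar_nonneg hτ, ae_trace_polar_pos hτ] with x h1 h2
  exact (mul_pos hm h2).trans_le (mul_trace_le_hsInner (isSymm_polar τ x) h1 (hQ x))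

theorem sum_branchDensity (h : S.IsSpectralData β Q c) (x : S.G) :
    ∑ i, S.branchDensity Q τ i x = β * S.hsDensity Q τ x := by
  simp only [branchDensity]
  rw [← hsInner_ruelle, h.eigen]
  exact hsInner_smul_left _ _ _

/-- Each branch contributes a definite proportion of the density. -/
theorem exists_le_branchDensity (h : S.IsSpectralData β Q c)
    (hτ : ∀ B, MeasurableSet B → (τ B : Matrix (Fin d) (Fin d) ℝ).PosSemidef) :
    ∃ ε : ℝ, 0 < ε ∧ ∀ i, ∀ᵐ x ∂totalVar τ, ε * S.hsDensity Q τ x ≤ S.branchDensity Q τ i x := by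
  obtain ⟨m, hm, hQ⟩ := h.exists_le_quad
  obtain ⟨l, hl, hD⟩ := S.exists_le_jac_mulVec
  obtain ⟨C, hC, hQC⟩ := S.exists_quad_le Q
  -- With T the polar part, the branch contributes at least m l tr T, while the density is at most C
  -- tr T.
  refine ⟨m * l / C, by positivity, fun i => ?_⟩
  filter_upwards [ae_quad_polar_nonneg hτ] with x h1
  have h2 : m * l * (polar τ x).trace ≤ S.branchDensity Q τ i x := by
    rw [branchDensity, pushPolar, ← hsInner_conj]
    refine mul_trace_le_hsInner (isSymm_polar τ x) h1 fun v => ?_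
    rw [quad_conj]
    refine le_trans ?_ (hQ _ _)
    rw [mul_assoc]
    exact mul_le_mul_of_nonneg_left (hD i x v) hm.le
  have h3 : S.hsDensity Q τ x ≤ C * (polar τ x).trace :=
    hsInner_le_mul_trace (isSymm_polar τ x) h1 (hQC x)
  calc m * l / C * S.hsDensity Q τ x ≤ m * l / C * (C * (polar τ x).trace) :=
        mul_le_mul_of_nonneg_left h3 (by positivity)
    _ = m * l * (polar τ x).trace := by field_simp
    _ ≤ _ := h2

theorem hsMeasure_real (h : S.IsSpectralData β Q c)
    (hτ : ∀ B, MeasurableSet B → (τ B : Matrix (Fin d) (Fin d) ℝ).PosSemidef)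
    {B : Set S.G} (hB : MeasurableSet B) :
    (S.hsMeasure Q τ).real B = ∫ x in B, S.hsDensity Q τ x ∂totalVar τ := by
  rw [measureReal_def, hsMeasure, withDensity_apply _ hB, integral_eq_lintegral_of_nonneg_ae
    (ae_restrict_of_ae ((h.ae_hsDensity_pos hτ).mono fun x hx => hx.le))
    (integrable_hsDensity Q τ).1.restrict]

theorem isHSMeasure (h : S.IsSpectralData β Q c)
    (hτ : ∀ B, MeasurableSet B → (τ B : Matrix (Fin d) (Fin d) ℝ).PosSemidef) :
    S.IsHSMeasure Q τ (S.hsMeasure Q τ) :=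
  ⟨inferInstance, fun _ hB => h.hsMeasure_real hτ hB⟩

theorem hsMeasure_absolutelyContinuous : S.hsMeasure Q τ ≪ totalVar τ :=
  withDensity_absolutelyContinuous _ _

theorem absolutelyContinuous_hsMeasure (h : S.IsSpectralData β Q c)
    (hτ : ∀ B, MeasurableSet B → (τ B : Matrix (Fin d) (Fin d) ℝ).PosSemidef) :
    totalVar τ ≪ S.hsMeasure Q τ :=
  withDensity_absolutelyContinuous' (integrable_hsDensity Q τ).1.aemeasurable.ennreal_ofReal
    ((h.ae_hsDensity_pos hτ).mono fun _ hx => ne_of_gt (ENNReal.ofReal_pos.2 hx))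

/-- The measure of a set as a sum over the branches. -/
theorem mul_hsMeasure_real (h : S.IsSpectralData β Q c)
    (hτ : ∀ B, MeasurableSet B → (τ B : Matrix (Fin d) (Fin d) ℝ).PosSemidef)
    (ha : S.IsAdjointImage τ (β • τ)) {B : Set S.G} (hB : MeasurableSet B) :
    β * (S.hsMeasure Q τ).real B =
      ∑ i, ∫ x in S.ψG i ⁻¹' B, S.branchDensity Q τ i x ∂totalVar τ := by
  have h1 := ha.mul_integral ((matBddMeas_coe Q).smul (bddMeas_indicator hB))
  rw [h.hsMeasure_real hτ hB, ← integral_indicator hB]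
  have e : ∀ x, B.indicator (S.hsDensity Q τ) x =
      hsInner (B.indicator (fun _ => (1 : ℝ)) x • (Q x : Matrix (Fin d) (Fin d) ℝ))
        (polar τ x) := fun x => by
    rw [hsInner_smul_left]
    by_cases hx : x ∈ B <;> simp [hx, hsDensity]
  simp only [e]
  rw [h1]
  refine Finset.sum_congr rfl fun i _ => ?_
  rw [← integral_indicator ((S.continuous_ψG i).measurable hB)]
  refine integral_congr_ae (Eventually.of_forall fun x => ?_)
  simp only [hsInner_smul_left]
  by_cases hx : S.ψG i x ∈ B <;> simp [hx, branchDensity]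

/-- The nonnegative branch contributions to β κ(B) = 0 all vanish, and each is at least ε κ(ψ_i⁻¹
B). -/
theorem hsMeasure_preimage_eq_zero (h : S.IsSpectralData β Q c)
    (hτ : ∀ B, MeasurableSet B → (τ B : Matrix (Fin d) (Fin d) ℝ).PosSemidef)
    (ha : S.IsAdjointImage τ (β • τ)) {B : Set S.G} (hB : MeasurableSet B)
    (h0 : S.hsMeasure Q τ B = 0) (i : Fin n) : S.hsMeasure Q τ (S.ψG i ⁻¹' B) = 0 := by
  obtain ⟨ε, hε, hle⟩ := h.exists_le_branchDensity hτ
  have hBi : ∀ j, MeasurableSet (S.ψG j ⁻¹' B) := fun j => (S.continuous_ψG j).measurable hB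
  have hle' : ∀ j, ε * (S.hsMeasure Q τ).real (S.ψG j ⁻¹' B) ≤
      ∫ x in S.ψG j ⁻¹' B, S.branchDensity Q τ j x ∂totalVar τ := fun j => by
    rw [h.hsMeasure_real hτ (hBi j), ← integral_const_mul]
    exact integral_mono_ae ((integrable_hsDensity Q τ).const_mul ε).integrableOn
      (integrable_branchDensity Q τ j).integrableOn (ae_restrict_of_ae (hle j))
  have h1 := h.mul_hsMeasure_real hτ ha hB
  rw [measureReal_def, h0, ENNReal.toReal_zero, mul_zero] at h1
  have h2 := (hle' i).trans (Finset.single_le_sum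
    (f := fun j => ∫ x in S.ψG j ⁻¹' B, S.branchDensity Q τ j x ∂totalVar τ)
    (fun j _ => (mul_nonneg hε.le measureReal_nonneg).trans (hle' j)) (Finset.mem_univ i))
  rw [← h1] at h2
  rw [← measureReal_eq_zero_iff]
  have := measureReal_nonneg (μ := S.hsMeasure Q τ) (s := S.ψG i ⁻¹' B)
  nlinarith

/-- With at least two branches, no branch carries all of the density. -/
theorem exists_hsMeasure_real_le (h : S.IsSpectralData β Q c)
    (hτ : ∀ B, MeasurableSet B → (τ B : Matrix (Fin d) (Fin d) ℝ).PosSemidef)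
    (ha : S.IsAdjointImage τ (β • τ)) (hn : Nontrivial (Fin n)) :
    ∃ r : ℝ, 0 ≤ r ∧ r < 1 ∧ ∀ B, MeasurableSet B →
      (S.hsMeasure Q τ).real B ≤ r * ∑ i, (S.hsMeasure Q τ).real (S.ψG i ⁻¹' B) := by
  obtain ⟨ε, hε, hle⟩ := h.exists_le_branchDensity hτ
  have hβ := h.pos
  -- A second branch takes at least ε of the total β, so each branch has at most β - ε. The maximum
  -- with 0 only records nonnegativity.
  refine ⟨max 0 (1 - ε / β), le_max_left _ _, max_lt one_pos (by linarith [div_pos hε hβ]),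
    fun B hB => ?_⟩
  have hall : ∀ᵐ x ∂totalVar τ, ∀ i, ε * S.hsDensity Q τ x ≤ S.branchDensity Q τ i x :=
    ae_all_iff.2 hle
  have h1 : ∀ i, ∫ x in S.ψG i ⁻¹' B, S.branchDensity Q τ i x ∂totalVar τ ≤
      (β - ε) * (S.hsMeasure Q τ).real (S.ψG i ⁻¹' B) := fun i => by
    rw [h.hsMeasure_real hτ ((S.continuous_ψG i).measurable hB), ← integral_const_mul]
    refine integral_mono_ae (integrable_branchDensity Q τ i).integrableOn
      ((integrable_hsDensity Q τ).const_mul _).integrableOn (ae_restrict_of_ae ?_)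
    filter_upwards [hall, h.ae_hsDensity_pos hτ] with x hx hq
    obtain ⟨j, hj⟩ := exists_ne i
    have h2 := Finset.add_le_sum (s := Finset.univ) (f := fun i => S.branchDensity Q τ i x)
      (fun i _ => (mul_nonneg hε.le hq.le).trans (hx i)) (Finset.mem_univ i) (Finset.mem_univ j)
      hj.symm
    rw [h.sum_branchDensity] at h2
    have h3 := hx j
    linarith
  have h4 := (h.mul_hsMeasure_real hτ ha hB).le.trans (Finset.sum_le_sum fun i _ => h1 i)
  rw [← Finset.mul_sum] at h4
  have hs : 0 ≤ ∑ i, (S.hsMeasure Q τ).real (S.ψG i ⁻¹' B) :=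
    Finset.sum_nonneg fun i _ => measureReal_nonneg
  refine le_trans ?_ (mul_le_mul_of_nonneg_right (le_max_right _ _) hs)
  have h5 : 1 - ε / β = (β - ε) / β := by field_simp
  rw [h5, div_mul_eq_mul_div, le_div_iff₀ hβ]
  linarith

end IsSpectralData

end FractalSystem


/-! ### Codes of points and the critical set -/

namespace FractalSystem

open Filter Topology

variable {d n : ℕ} {ν η : ℝ≥0} {S : FractalSystem d n ν η}

variable (S) in
/-- The codes of a point of the fractal. -/
def codes (x : S.G) : Set (ℕ → Fin n) := {w | (x : Euc d) ∈ codedSet S.ψ S.G w}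

/-- The sequence with first letter `i` followed by `w`. -/
def consSeq (i : Fin n) (w : ℕ → Fin n) : ℕ → Fin n
  | 0 => i
  | k + 1 => w k

theorem consSeq_injective (i : Fin n) : Function.Injective (consSeq i) := fun _ _ h =>
  funext fun k => congrFun h (k + 1)

theorem consSeq_shift (w : ℕ → Fin n) : consSeq (w 0) (shift w) = w := by
  funext k
  cases k <;> rfl

theorem consSeq_mem_codes (i : Fin n) {x : S.G} {w : ℕ → Fin n} (hw : w ∈ S.codes x) :
    consSeq i w ∈ S.codes (S.ψG i x) := by
  refine mem_iInter.2 fun l => ?_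
  rw [List.ofFn_succ]
  -- The prefix loses one letter. It is empty for l = 0, and its cell is then G itself.
  have h1 : (x : Euc d) ∈ cell S.ψ S.G (List.ofFn fun k : Fin l => w k) := by
    cases l with
    | zero => exact ⟨x, x.2, rfl⟩
    | succ l => exact mem_iInter.1 hw l
  obtain ⟨y, hy, hyx⟩ := h1
  exact ⟨y, hy, congrArg (S.ψ i) hyx⟩

theorem exists_eq_ψG (x : S.G) : ∃ (i : Fin n) (y : S.G), S.ψG i y = x := by
  have h : (x : Euc d) ∈ ⋃ i, S.ψ i '' S.G := S.self_similar ▸ x.2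
  obtain ⟨i, y, hy, hyx⟩ := mem_iUnion.1 h
  exact ⟨i, ⟨y, hy⟩, Subtype.ext hyx⟩

/-- Choose a branch and a preimage at every point, and record the branches along the resulting
backward orbit. -/
theorem codes_nonempty (x : S.G) : (S.codes x).Nonempty := by
  choose i y hy using exists_eq_ψG (S := S)
  refine ⟨fun k => i (y^[k] x), mem_iInter.2 fun l => ?_⟩
  have h : ∀ (l : ℕ) (x : S.G), wordMap S.ψ (List.ofFn fun k : Fin l => i (y^[k] x))
      (y^[l] x : S.G) = x := fun l => by
    induction l with
    | zero => intro x; rfl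
    | succ l ih =>
      intro x
      rw [List.ofFn_succ]
      change S.ψ (i x) (wordMap S.ψ (List.ofFn fun k : Fin l => i (y^[k] (y x)))
        (y^[l] (y x) : S.G)) = x
      rw [ih]
      exact congrArg Subtype.val (hy x)
  exact ⟨_, (y^[l + 1] x).2, h _ x⟩

-- The case j = 1 of post-critical finiteness: a critical code is one of finitely many shifted codes
-- preceded by one of n letters.
variable (S) in
theorem finite_critCodes : (critCodes S.ψ S.G).Finite := by
  have h : (shift '' critCodes S.ψ S.G).Finite :=
    S.pcf.subset fun w hw => mem_iUnion₂.2 ⟨1, le_rfl, hw⟩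
  refine (finite_iUnion fun i : Fin n => h.image (consSeq i)).subset fun w hw => ?_
  exact mem_iUnion.2 ⟨w 0, shift w, mem_image_of_mem _ hw, consSeq_shift w⟩

variable (S) in
/-- The critical set as a subset of the fractal. -/
def critPoints : Set S.G := {x | (x : Euc d) ∈ critSet S.ψ S.G}

variable (S) in
theorem finite_critPoints : S.critPoints.Finite := by
  have h : (critSet S.ψ S.G).Finite :=
    finite_iUnion fun i => finite_iUnion fun j => finite_iUnion fun hij => S.finite_inter i j hij
  exact h.preimage Subtype.val_injective.injOn

theorem mem_critPoints {i j : Fin n} (hij : i ≠ j) {x y : S.G}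
    (h : S.ψG i x = S.ψG j y) : S.ψG i x ∈ S.critPoints := by
  refine mem_iUnion.2 ⟨i, mem_iUnion.2 ⟨j, mem_iUnion.2 ⟨hij, ?_, ?_⟩⟩⟩
  · exact mem_image_of_mem _ x.2
  · rw [h]; exact mem_image_of_mem _ y.2

theorem finite_codes {x : S.G} (hx : x ∈ S.critPoints) : (S.codes x).Finite :=
  S.finite_critCodes.subset fun _ hw => ⟨x, hw, hx⟩

theorem nontrivial_of_mem_critPoints {x : S.G} (hx : x ∈ S.critPoints) :
    Nontrivial (Fin n) := by
  obtain ⟨i, hx⟩ := mem_iUnion.1 hx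
  obtain ⟨j, hx⟩ := mem_iUnion.1 hx
  obtain ⟨hij, -⟩ := mem_iUnion.1 hx
  exact ⟨i, j, hij⟩

/-! ### The expanding map -/

theorem F_ψG {i : Fin n} {x : S.G} (hx : S.ψG i x ∉ S.critPoints) : S.F (S.ψG i x) = x := by
  have h1 : (S.ψG i x : Euc d) ∈ S.G ∩ S.O i := by
    rw [S.inter_O]
    refine ⟨mem_image_of_mem _ x.2, fun h => hx ?_⟩
    obtain ⟨j, h⟩ := mem_iUnion.1 h
    obtain ⟨hij, h⟩ := mem_iUnion.1 h
    exact mem_iUnion.2 ⟨i, mem_iUnion.2 ⟨j, mem_iUnion.2 ⟨hij, h⟩⟩⟩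
  exact Subtype.ext (injective_ψ i (S.F_of_mem_O i _ h1.2))

-- Off the finite critical set, F⁻¹(B) is the union of the sets ψ_i(B). On a finite set the
-- arbitrary values of F do no harm.
variable (S) in
theorem measurable_F : Measurable S.F := fun B hB => by
  have h : S.F ⁻¹' B = (S.F ⁻¹' B ∩ S.critPoints) ∪ ⋃ i, S.ψG i '' B \ S.critPoints := by
    ext x
    by_cases hx : x ∈ S.critPoints
    · simp [hx]
    obtain ⟨i, y, rfl⟩ := exists_eq_ψG x
    simp only [mem_preimage, F_ψG hx, mem_union, mem_inter_iff, hx, and_false, false_or,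
      mem_iUnion, Set.mem_sdiff, not_false_eq_true, and_true]
    refine ⟨fun hy => ⟨i, mem_image_of_mem _ hy⟩, ?_⟩
    rintro ⟨j, z, hz, hzy⟩
    by_cases hij : i = j
    · subst hij
      rwa [← injective_ψG _ hzy]
    · exact absurd (mem_critPoints hij hzy.symm) hx
  rw [h]
  refine MeasurableSet.union (S.finite_critPoints.subset inter_subset_right).measurableSet
    (MeasurableSet.iUnion fun i => MeasurableSet.diff ?_ S.finite_critPoints.measurableSet)
  exact ((S.continuous_ψG i).isClosedEmbedding (injective_ψG i)).measurableEmbedding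
    |>.measurableSet_image.2 hB

variable {β : ℝ} {Q : C(S.G, symMat d)} {c : C(S.G, symMat d) →ₗ[ℝ] ℝ}
  {τ : VectorMeasure S.G (symMat d)}

namespace IsSpectralData

/-- Points with finitely many codes carry no mass. -/
theorem hsMeasure_singleton (h : S.IsSpectralData β Q c)
    (hτ : ∀ B, MeasurableSet B → (τ B : Matrix (Fin d) (Fin d) ℝ).PosSemidef)
    (ha : S.IsAdjointImage τ (β • τ)) (hn : Nontrivial (Fin n)) {x : S.G}
    (hx : (S.codes x).Finite) : S.hsMeasure Q τ {x} = 0 := by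
  obtain ⟨r, hr0, hr1, hr⟩ := h.exists_hsMeasure_real_le hτ ha hn
  set κ := S.hsMeasure Q τ
  -- Each backward step gains a factor r. The codes of x with first letter i include those of its
  -- preimage under ψ_i, preceded by i, so the preimages together have no more codes than x and the
  -- sums do not grow.
  have key : ∀ l : ℕ, ∀ x : S.G, (S.codes x).Finite →
      κ.real {x} ≤ r ^ l * ((S.codes x).ncard * κ.real univ) := fun l => by
    induction l with
    | zero =>
      intro x hx
      have h1 : (1 : ℝ) ≤ (S.codes x).ncard := by
        exact_mod_cast (ncard_pos hx).2 (codes_nonempty x)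
      have h2 : κ.real {x} ≤ κ.real univ := measureReal_mono (subset_univ _)
      have h3 : 0 ≤ κ.real univ := measureReal_nonneg
      nlinarith
    | succ l ih =>
      intro x hx
      let N : Fin n → ℕ := fun i => {w ∈ S.codes x | w 0 = i}.ncard
      have hN : ∑ i, N i = (S.codes x).ncard := by
        have h1 := Finset.card_eq_sum_card_fiberwise (s := hx.toFinset) (t := Finset.univ)
          (f := fun w : ℕ → Fin n => w 0) (fun w _ => Finset.mem_univ _)
        rw [ncard_eq_toFinset_card _ hx, h1]
        refine Finset.sum_congr rfl fun i _ => ?_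
        rw [← ncard_coe_finset]
        refine congrArg ncard (Set.ext fun w => ?_)
        simp
      have h1 : ∀ i, κ.real (S.ψG i ⁻¹' {x}) ≤ r ^ l * (N i * κ.real univ) := fun i => by
        by_cases hy : ∃ y, S.ψG i y = x
        · obtain ⟨y, rfl⟩ := hy
          have e : S.ψG i ⁻¹' {S.ψG i y} = {y} := by
            ext z
            exact (injective_ψG i).eq_iff
          have hsub : consSeq i '' S.codes y ⊆ {w ∈ S.codes (S.ψG i y) | w 0 = i} := by
            rintro _ ⟨w, hw, rfl⟩
            exact ⟨consSeq_mem_codes i hw, rfl⟩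
          have hfin := hx.subset (sep_subset (S.codes (S.ψG i y)) fun w => w 0 = i)
          have hfy : (S.codes y).Finite :=
            (hfin.subset hsub).of_finite_image (consSeq_injective i).injOn
          have hc : (S.codes y).ncard ≤ N i := by
            rw [← ncard_image_of_injective _ (consSeq_injective i)]
            exact ncard_le_ncard hsub hfin
          rw [e]
          refine (ih y hfy).trans ?_
          have hc' : ((S.codes y).ncard : ℝ) ≤ N i := by exact_mod_cast hc
          gcongr
        · have e : S.ψG i ⁻¹' {x} = ∅ := eq_empty_of_forall_notMem fun y hy' => hy ⟨y, hy'⟩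
          rw [e, measureReal_empty]
          positivity
      refine (hr _ (measurableSet_singleton x)).trans ?_
      refine (mul_le_mul_of_nonneg_left (Finset.sum_le_sum fun i _ => h1 i) hr0).trans
        (le_of_eq ?_)
      rw [← Finset.mul_sum, ← Finset.sum_mul, ← hN]
      push_cast
      ring
  have h1 : Tendsto (fun l : ℕ => r ^ l * ((S.codes x).ncard * κ.real univ)) atTop (𝓝 0) := by
    simpa using (tendsto_pow_atTop_nhds_zero_of_lt_one hr0 hr1).mul_const
      ((S.codes x).ncard * κ.real univ)
  have h2 := ge_of_tendsto' h1 fun l => key l x hx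
  rw [← measureReal_eq_zero_iff]
  exact le_antisymm h2 measureReal_nonneg

theorem hsMeasure_critPoints (h : S.IsSpectralData β Q c)
    (hτ : ∀ B, MeasurableSet B → (τ B : Matrix (Fin d) (Fin d) ℝ).PosSemidef)
    (ha : S.IsAdjointImage τ (β • τ)) : S.hsMeasure Q τ S.critPoints = 0 := by
  rw [← biUnion_of_singleton S.critPoints]
  refine (measure_biUnion_null_iff S.finite_critPoints.countable).2 fun x hx => ?_
  exact h.hsMeasure_singleton hτ ha (nontrivial_of_mem_critPoints hx) (finite_codes hx)

theorem ae_notMem_critPoints (h : S.IsSpectralData β Q c)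
    (hτ : ∀ B, MeasurableSet B → (τ B : Matrix (Fin d) (Fin d) ℝ).PosSemidef)
    (ha : S.IsAdjointImage τ (β • τ)) (i : Fin n) :
    ∀ᵐ x ∂totalVar τ, S.ψG i x ∉ S.critPoints := by
  have h1 := h.absolutelyContinuous_hsMeasure hτ (h.hsMeasure_preimage_eq_zero hτ ha
    S.finite_critPoints.measurableSet (h.hsMeasure_critPoints hτ ha) i)
  rw [ae_iff]
  simp only [not_not]
  exact h1

theorem ae_F_ψG (h : S.IsSpectralData β Q c)
    (hτ : ∀ B, MeasurableSet B → (τ B : Matrix (Fin d) (Fin d) ℝ).PosSemidef)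
    (ha : S.IsAdjointImage τ (β • τ)) (i : Fin n) :
    ∀ᵐ x ∂totalVar τ, S.F (S.ψG i x) = x :=
  (h.ae_notMem_critPoints hτ ha i).mono fun _ hx => F_ψG hx

/-! ### Invariance and ergodicity -/

/-- Almost everywhere ψ_i⁻¹ F⁻¹ B = B, so β κ(F⁻¹ B) is the integral over B of all branch densities,
which sum to β times the density of κ. -/
theorem measurePreserving (h : S.IsSpectralData β Q c)
    (hτ : ∀ B, MeasurableSet B → (τ B : Matrix (Fin d) (Fin d) ℝ).PosSemidef)
    (ha : S.IsAdjointImage τ (β • τ)) : MeasurePreserving S.F (S.hsMeasure Q τ) (S.hsMeasure Q τ) := by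
  refine ⟨S.measurable_F, Measure.ext fun B hB => ?_⟩
  rw [Measure.map_apply S.measurable_F hB, ← measureReal_eq_measureReal_iff]
  refine mul_left_cancel₀ h.pos.ne' ?_
  rw [h.mul_hsMeasure_real hτ ha (S.measurable_F hB), h.hsMeasure_real hτ hB,
    ← integral_const_mul]
  simp only [← h.sum_branchDensity]
  rw [integral_finsetSum _ fun i _ => (integrable_branchDensity Q τ i).integrableOn]
  refine Finset.sum_congr rfl fun i _ => setIntegral_congr_set ?_
  filter_upwards [h.ae_F_ψG hτ ha i] with x hx
  exact propext (show S.F (S.ψG i x) ∈ B ↔ x ∈ B by rw [hx])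

end IsSpectralData

theorem pairing_restrict (A : C(S.G, symMat d)) (τ : VectorMeasure S.G (symMat d)) {B : Set S.G}
    (hB : MeasurableSet B) : S.pairing A (τ.restrict B) =
      ∫ x, hsInner (B.indicator (fun _ => (1 : ℝ)) x • (A x : Matrix (Fin d) (Fin d) ℝ))
        (polar τ x) ∂totalVar τ := by
  rw [((matBddMeas_coe A).smul (bddMeas_indicator hB)).integral_hsInner, pairing_eq_sum]
  refine Finset.sum_congr rfl fun j _ => Finset.sum_congr rfl fun k _ => ?_
  have h1 := (isSignedFunctional_polar (τ.restrict B) j k).sub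
    (IsSignedFunctional.integral_comp_mul measurable_id
      ((bddMeas_indicator hB).mul_integrable (integrable_polar τ j k)))
  have h2 := sub_eq_zero.1 (h1.eq_zero_of_indicator (fun E hE => by
    rw [integral_indicator_mul_polar _ _ _ hE, VectorMeasure.restrict_apply _ hB hE, sub_eq_zero,
      ← integral_indicator_mul_polar τ j k (hE.inter hB)]
    refine integral_congr_ae (Eventually.of_forall fun x => ?_)
    by_cases h1 : x ∈ E <;> by_cases h2 : x ∈ B <;> simp [h1, h2]) (matBddMeas_coe A j k))
  rw [h2]
  refine integral_congr_ae (Eventually.of_forall fun x => ?_)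
  simp only [id, Matrix.smul_apply, smul_eq_mul]
  ring

namespace IsSpectralData

/-- The restriction of the eigenmeasure to an invariant set is an eigenmeasure. -/
theorem isAdjointImage_restrict (h : S.IsSpectralData β Q c)
    (hτ : ∀ B, MeasurableSet B → (τ B : Matrix (Fin d) (Fin d) ℝ).PosSemidef)
    (ha : S.IsAdjointImage τ (β • τ)) {B : Set S.G} (hB : MeasurableSet B)
    (hF : S.F ⁻¹' B = B) : S.IsAdjointImage (τ.restrict B) (β • τ.restrict B) := fun A => by
  rw [pairing_smul_right, pairing_restrict A τ hB, pairing_restrict _ τ hB,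
    ha.mul_integral ((matBddMeas_coe A).smul (bddMeas_indicator hB))]
  simp only [hsInner_smul_left, hsInner_ruelle, Finset.mul_sum]
  rw [integral_finsetSum _ fun i _ => (bddMeas_indicator hB).mul_integrable
    (integrable_hsInner_pushPolar τ i (matBddMeas_coe A))]
  refine Finset.sum_congr rfl fun i _ => integral_congr_ae ?_
  filter_upwards [h.ae_F_ψG hτ ha i] with x hx
  -- Invariance of B under F becomes invariance under the branches, so the indicator of B commutes
  -- with L almost everywhere.
  have e : S.ψG i x ∈ B ↔ x ∈ B := by
    conv_lhs => rw [← hF, mem_preimage, hx]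
  by_cases hxB : x ∈ B
  · simp only [indicator_of_mem hxB, indicator_of_mem (e.2 hxB)]
  · simp only [indicator_of_notMem hxB, indicator_of_notMem fun h' => hxB (e.1 h')]

theorem hsMeasure_real_eq_pairing (h : S.IsSpectralData β Q c)
    (hτ : ∀ B, MeasurableSet B → (τ B : Matrix (Fin d) (Fin d) ℝ).PosSemidef)
    {B : Set S.G} (hB : MeasurableSet B) :
    (S.hsMeasure Q τ).real B = S.pairing Q (τ.restrict B) := by
  rw [h.hsMeasure_real hτ hB, pairing_restrict Q τ hB, ← integral_indicator hB]
  refine integral_congr_ae (Eventually.of_forall fun x => ?_)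
  simp only [hsInner_smul_left]
  by_cases hx : x ∈ B <;> simp [hx, hsDensity]

/-- For invariant B the restriction of τ is an eigenmeasure, hence equals κ(B) τ. If κ(B) ≠ 0,
evaluation on subsets of the complement shows that τ vanishes there. -/
theorem ergodic (h : S.IsSpectralData β Q c) (hp : ∀ A, S.pairing A τ = c A)
    (hτ : ∀ B, MeasurableSet B → (τ B : Matrix (Fin d) (Fin d) ℝ).PosSemidef) :
    Ergodic S.F (S.hsMeasure Q τ) := by
  have ha := h.isAdjointImage hp
  refine ⟨h.measurePreserving hτ ha, ⟨fun B hB hF => ?_⟩⟩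
  have h1 := h.eq_smul_of_isAdjointImage hp (h.isAdjointImage_restrict hτ ha hB hF)
  rw [← h.hsMeasure_real_eq_pairing hτ hB] at h1
  rw [eventuallyConst_set']
  by_cases h0 : (S.hsMeasure Q τ).real B = 0
  · exact Or.inl (ae_eq_empty.2 ((measureReal_eq_zero_iff).1 h0))
  refine Or.inr (ae_eq_univ.2 ?_)
  rw [← measureReal_eq_zero_iff, h.hsMeasure_real_eq_pairing hτ hB.compl]
  have h2 : τ.restrict Bᶜ = (0 : ℝ) • τ := by
    ext E hE : 1
    have h3 := congrArg (fun σ : VectorMeasure S.G (symMat d) => σ (E ∩ Bᶜ)) h1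
    simp only [VectorMeasure.restrict_apply _ hB (hE.inter hB.compl), inter_assoc,
      compl_inter_self, inter_empty, VectorMeasure.empty] at h3
    have h4 : (0 : symMat d) = (S.hsMeasure Q τ).real B • τ (E ∩ Bᶜ) := h3
    rw [VectorMeasure.restrict_apply _ hB.compl hE,
      (smul_eq_zero.1 h4.symm).resolve_left h0]
    exact (zero_smul ℝ (τ E)).symm
  rw [h2, pairing_smul_right, zero_mul]

end IsSpectralData

end FractalSystem


/-! ### Self-similarity of the form -/

section SymProd

variable {d : ℕ}

/-- The symmetric product `(u ᵗv + v ᵗu) / 2`. -/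
noncomputable def symProd (u v : Fin d → ℝ) : symMat d :=
  ⟨(1 / 2 : ℝ) • (Matrix.vecMulVec u v + Matrix.vecMulVec v u), by
    refine Matrix.IsSymm.ext fun j k => ?_
    simp only [Matrix.smul_apply, Matrix.add_apply, Matrix.vecMulVec_apply, smul_eq_mul]
    ring⟩

theorem coe_symProd (u v : Fin d → ℝ) : (symProd u v : Matrix (Fin d) (Fin d) ℝ) =
    (1 / 2 : ℝ) • (Matrix.vecMulVec u v + Matrix.vecMulVec v u) := rfl

theorem hsInner_symProd {T : Matrix (Fin d) (Fin d) ℝ} (hT : T.IsSymm) (u v : Fin d → ℝ) :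
    hsInner (symProd u v : Matrix (Fin d) (Fin d) ℝ) T = u ⬝ᵥ T *ᵥ v := by
  have h : ∀ u v : Fin d → ℝ, hsInner (Matrix.vecMulVec u v) T = u ⬝ᵥ T *ᵥ v := fun u v => by
    simp only [hsInner_eq_sum, Matrix.vecMulVec_apply, dotProduct, Matrix.mulVec, Finset.mul_sum]
    exact Finset.sum_congr rfl fun j _ => Finset.sum_congr rfl fun k _ => by ring
  have h2 : v ⬝ᵥ T *ᵥ u = u ⬝ᵥ T *ᵥ v := by
    rw [Matrix.dotProduct_mulVec, ← Matrix.mulVec_transpose, hT.eq, dotProduct_comm]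
  rw [coe_symProd, hsInner_smul_left, hsInner_add_left, h, h, h2]
  ring

theorem transpose_mul_symProd_mul (D : Matrix (Fin d) (Fin d) ℝ) (u v : Fin d → ℝ) :
    Dᵀ * (symProd u v : Matrix (Fin d) (Fin d) ℝ) * D = symProd (Dᵀ *ᵥ u) (Dᵀ *ᵥ v) := by
  have h : ∀ u v : Fin d → ℝ, Dᵀ * Matrix.vecMulVec u v * D =
      Matrix.vecMulVec (Dᵀ *ᵥ u) (Dᵀ *ᵥ v) := fun u v => by
    rw [Matrix.mul_vecMulVec, Matrix.vecMulVec_mul, Matrix.mulVec_transpose D v]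
  rw [coe_symProd, coe_symProd, Matrix.mul_smul, Matrix.smul_mul, Matrix.mul_add, Matrix.add_mul,
    h, h]

theorem gradient_dotProduct (f : Euc d → ℝ) (x : Euc d) (v : Fin d → ℝ) :
    (gradient f x).ofLp ⬝ᵥ v = fderiv ℝ f x (WithLp.toLp 2 v) := by
  have h : inner ℝ (gradient f x) (WithLp.toLp 2 v) = fderiv ℝ f x (WithLp.toLp 2 v) := by
    rw [gradient, InnerProductSpace.toDual_symm_apply]
  rw [← h, EuclideanSpace.inner_eq_star_dotProduct, dotProduct_comm]
  simp

theorem gradient_comp {f : Euc d → ℝ} {ψ : Euc d → Euc d} {x : Euc d}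
    (hf : DifferentiableAt ℝ f (ψ x)) (hψ : DifferentiableAt ℝ ψ x) :
    (gradient (f ∘ ψ) x).ofLp = (jac ψ x)ᵀ *ᵥ (gradient f (ψ x)).ofLp := by
  refine dotProduct_eq _ _ fun v => ?_
  rw [gradient_dotProduct, fderiv_comp x hf hψ, Matrix.mulVec_transpose,
    ← Matrix.dotProduct_mulVec, gradient_dotProduct, FractalSystem.jac_mulVec]
  rfl

theorem jac_comp {f g : Euc d → Euc d} {x : Euc d} (hf : DifferentiableAt ℝ f (g x))
    (hg : DifferentiableAt ℝ g x) : jac (f ∘ g) x = jac f (g x) * jac g x := by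
  rw [jac, jac, jac, ← map_mul, fderiv_comp x hf hg]
  rfl

theorem jac_id (x : Euc d) : jac id x = 1 := by
  rw [jac, fderiv_id]
  exact map_one _

end SymProd

namespace FractalSystem

open Filter Topology

variable {d n : ℕ} {ν η : ℝ≥0} {S : FractalSystem d n ν η}

variable (S) in
/-- The symmetric product of two gradients, as a continuous field on the fractal. -/
noncomputable def gradField {f g : Euc d → ℝ} (hf : ContDiff ℝ 1 f) (hg : ContDiff ℝ 1 g) :
    C(S.G, symMat d) where
  toFun x := symProd (gradient f x).ofLp (gradient g x).ofLp
  continuous_toFun := by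
    have h : ∀ {f : Euc d → ℝ}, ContDiff ℝ 1 f →
        Continuous fun x : S.G => (gradient f (x : Euc d)).ofLp := fun hf =>
      (PiLp.continuous_ofLp 2 _).comp
        ((InnerProductSpace.toDual ℝ (Euc d)).symm.continuous.comp
          ((hf.continuous_fderiv one_ne_zero).comp continuous_subtype_val))
    refine Continuous.subtype_mk (Continuous.const_smul (Continuous.add ?_ ?_) (1 / 2 : ℝ)) _
    · exact (h hf).matrix_vecMulVec (h hg)
    · exact (h hg).matrix_vecMulVec (h hf)

theorem gradField_apply {f g : Euc d → ℝ} (hf : ContDiff ℝ 1 f) (hg : ContDiff ℝ 1 g) (x : S.G) :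
    S.gradField hf hg x = symProd (gradient f x).ofLp (gradient g x).ofLp := rfl

/-- The polar part is symmetric, so only the symmetric product of the gradients matters. The form
thereby becomes the pairing with a continuous field, on which L acts by the chain rule
(`ruelle_gradField`). -/
theorem energy_eq_pairing (τ : VectorMeasure S.G (symMat d)) {f g : Euc d → ℝ}
    (hf : ContDiff ℝ 1 f) (hg : ContDiff ℝ 1 g) :
    S.energy τ f g = S.pairing (S.gradField hf hg) τ := by
  rw [pairing_eq_integral, energy, formIntegral]
  refine integral_congr_ae (Eventually.of_forall fun x => ?_)
  simp only [gradField_apply, hsInner_symProd (isSymm_polar τ x),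
    EuclideanSpace.inner_eq_star_dotProduct, Matrix.ofLp_toEuclideanCLM]
  rw [dotProduct_comm]
  simp

theorem ruelle_gradField {f g : Euc d → ℝ} (hf : ContDiff ℝ 1 f) (hg : ContDiff ℝ 1 g) :
    S.ruelle (S.gradField hf hg) =
      ∑ i, S.gradField (hf.comp (S.contDiff i)) (hg.comp (S.contDiff i)) := by
  ext x : 1
  refine Subtype.ext ?_
  rw [coe_ruelle, ContinuousMap.sum_apply, AddSubmonoidClass.coe_finsetSum]
  refine Finset.sum_congr rfl fun i _ => ?_
  have hψ := (S.contDiff i).differentiable one_ne_zero (x : Euc d)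
  rw [gradField_apply, gradField_apply, gradient_comp (hf.differentiable one_ne_zero _) hψ,
    gradient_comp (hg.differentiable one_ne_zero _) hψ, transpose_mul_symProd_mul]
  rfl

variable {β : ℝ} {Q : C(S.G, symMat d)} {c : C(S.G, symMat d) →ₗ[ℝ] ℝ}
  {τ : VectorMeasure S.G (symMat d)}

theorem IsAdjointImage.energy_eq (hβ : β ≠ 0) (h : S.IsAdjointImage τ (β • τ)) {f g : Euc d → ℝ}
    (hf : ContDiff ℝ 1 f) (hg : ContDiff ℝ 1 g) :
    S.energy τ f g = β⁻¹ * ∑ i, S.energy τ (f ∘ S.ψ i) (g ∘ S.ψ i) := by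
  have h1 := h (S.gradField hf hg)
  have h2 : S.pairing (∑ i, S.gradField (hf.comp (S.contDiff i)) (hg.comp (S.contDiff i))) τ =
      ∑ i, S.pairing (S.gradField (hf.comp (S.contDiff i)) (hg.comp (S.contDiff i))) τ :=
    map_sum (S.pairingLM τ) _ _
  rw [pairing_smul_right, ruelle_gradField, h2, ← energy_eq_pairing] at h1
  simp only [← energy_eq_pairing] at h1
  rw [← h1, inv_mul_cancel_left₀ hβ]

/-! ### Affine systems -/

theorem IsAffine.jac_eq (h : S.IsAffine) (i : Fin n) (x y : Euc d) :
    jac (S.ψ i) x = jac (S.ψ i) y := by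
  obtain ⟨f, hf⟩ := h i
  have h1 : ∀ x, fderiv ℝ (S.ψ i) x = LinearMap.toContinuousLinearMap f.linear := fun x => by
    rw [← hf, f.decomp]
    exact ((LinearMap.toContinuousLinearMap f.linear).hasFDerivAt.add_const _).fderiv
  rw [jac, jac, h1, h1]

theorem IsAffine.holderSmall (h : S.IsAffine) {ω : ℝ} (hω : 0 ≤ ω) : S.HolderSmall ω :=
  fun i x _ y _ => by
    have h0 : hsNorm (jac (S.ψ i) x - jac (S.ψ i) y) = 0 := by
      rw [h.jac_eq i x y, sub_self, hsNorm, hsInner, mul_zero, Matrix.trace_zero, Real.sqrt_zero]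
    rw [h0, mul_zero]
    positivity

variable (S) in
/-- A cell as a subset of the fractal. -/
def cellG (w : List (Fin n)) : Set S.G := {x | (x : Euc d) ∈ cell S.ψ S.G w}

variable (S) in
theorem differentiable_wordMap (w : List (Fin n)) : Differentiable ℝ (wordMap S.ψ w) := by
  induction w with
  | nil => exact differentiable_id
  | cons i w ih => exact ((S.contDiff i).differentiable one_ne_zero).comp ih

variable (S) in
theorem mapsTo_wordMap (w : List (Fin n)) : MapsTo (wordMap S.ψ w) S.G S.G := by
  induction w with
  | nil => exact mapsTo_id _
  | cons i w ih => exact (S.mapsTo i).comp ih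

variable (S) in
theorem measurableSet_cellG (w : List (Fin n)) : MeasurableSet (S.cellG w) :=
  ((S.isCompact.image (S.differentiable_wordMap w).continuous).isClosed.preimage
    continuous_subtype_val).measurableSet

variable (S) in
theorem cellG_nil : S.cellG [] = univ :=
  eq_univ_of_forall fun x => ⟨x, x.2, rfl⟩

variable (S) in
theorem cellG_cons (i : Fin n) (w : List (Fin n)) :
    S.cellG (i :: w) = S.ψG i '' S.cellG w := by
  ext x
  constructor
  · rintro ⟨y, hy, hyx⟩
    exact ⟨⟨wordMap S.ψ w y, S.mapsTo_wordMap w hy⟩, ⟨y, hy, rfl⟩, Subtype.ext hyx⟩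
  · rintro ⟨y, ⟨z, hz, hzy⟩, rfl⟩
    exact ⟨z, hz, congrArg (S.ψ i) hzy⟩

/-- The mass of the image of a set under a branch. -/
theorem IsSpectralData.mul_apply_image (h : S.IsSpectralData β Q c)
    (hτ : ∀ B, MeasurableSet B → (τ B : Matrix (Fin d) (Fin d) ℝ).PosSemidef)
    (ha : S.IsAdjointImage τ (β • τ)) {B : Set S.G} (hB : MeasurableSet B) (i : Fin n)
    (j k : Fin d) : β * (τ (S.ψG i '' B) : Matrix (Fin d) (Fin d) ℝ) j k =
      ∫ x in B, S.pushPolar τ i x j k ∂totalVar τ := by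
  have hB' : MeasurableSet (S.ψG i '' B) :=
    ((S.continuous_ψG i).isClosedEmbedding (injective_ψG i)).measurableEmbedding
      |>.measurableSet_image.2 hB
  rw [← integral_indicator_mul_polar τ j k hB',
    ha.mul_integral_polar j k (bddMeas_indicator hB'), ← integral_indicator hB,
    -- Another branch meets ψ_i(G) only in critical points, whose preimages are null.
    Finset.sum_eq_single i]
  · refine integral_congr_ae (Eventually.of_forall fun x => ?_)
    have e : S.ψG i x ∈ S.ψG i '' B ↔ x ∈ B := (injective_ψG i).mem_set_image
    by_cases hx : x ∈ B
    · simp only [indicator_of_mem hx, indicator_of_mem (e.2 hx), one_mul]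
    · simp only [indicator_of_notMem hx, indicator_of_notMem fun h' => hx (e.1 h'), zero_mul]
  · intro i' _ hi
    refine integral_eq_zero_of_ae ?_
    filter_upwards [h.ae_notMem_critPoints hτ ha i'] with x hx
    rw [indicator_of_notMem, zero_mul]
    · rfl
    · rintro ⟨y, -, hy⟩
      exact hx (mem_critPoints hi hy.symm)
  · exact fun hi => absurd (Finset.mem_univ i) hi

/-- Induction on the word, removing its first letter with `mul_apply_image`: for affine maps the
constant derivative leaves the integral. -/
theorem IsSpectralData.apply_cellG (h : S.IsSpectralData β Q c)
    (hτ : ∀ B, MeasurableSet B → (τ B : Matrix (Fin d) (Fin d) ℝ).PosSemidef)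
    (ha : S.IsAdjointImage τ (β • τ)) (hS : S.IsAffine) (w : List (Fin n)) (p : Euc d) :
    (τ (S.cellG w) : Matrix (Fin d) (Fin d) ℝ) = (β ^ w.length)⁻¹ •
      (jac (wordMap S.ψ w) p * (τ univ : Matrix (Fin d) (Fin d) ℝ) *
        (jac (wordMap S.ψ w) p)ᵀ) := by
  induction w with
  | nil =>
    rw [cellG_nil]
    change _ = (β ^ 0)⁻¹ • (jac id p * _ * (jac id p)ᵀ)
    rw [jac_id]
    simp
  | cons i w ih =>
    set D := jac (S.ψ i) (wordMap S.ψ w p) with hD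
    have hB := S.measurableSet_cellG w
    have h1 : β • (τ (S.cellG (i :: w)) : Matrix (Fin d) (Fin d) ℝ) =
        D * (τ (S.cellG w) : Matrix (Fin d) (Fin d) ℝ) * Dᵀ := by
      ext j k
      rw [cellG_cons, Matrix.smul_apply, smul_eq_mul, h.mul_apply_image hτ ha hB]
      simp only [pushPolar, hS.jac_eq i _ (wordMap S.ψ w p), ← hD, Matrix.mul_apply]
      have hi : ∀ l l', Integrable (fun x => D j l' * polar τ x l' l)
          ((totalVar τ).restrict (S.cellG w)) := fun l l' =>
        ((integrable_polar τ l' l).const_mul _).integrableOn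
      rw [integral_finsetSum _ fun l _ => (integrable_finsetSum _ fun l' _ => hi l l').mul_const _]
      refine Finset.sum_congr rfl fun l _ => ?_
      rw [integral_mul_const, integral_finsetSum _ fun l' _ => hi l l']
      congr 1
      refine Finset.sum_congr rfl fun l' _ => ?_
      rw [integral_const_mul, setIntegral_polar τ l' l hB]
    have h2 : jac (wordMap S.ψ (i :: w)) p = D * jac (wordMap S.ψ w) p :=
      jac_comp ((S.contDiff i).differentiable one_ne_zero _) (S.differentiable_wordMap w p)
    rw [h2, ← inv_smul_smul₀ h.pos.ne' (τ (S.cellG (i :: w)) : Matrix (Fin d) (Fin d) ℝ), h1, ih,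
      List.length_cons, pow_succ', mul_inv, mul_smul, Matrix.transpose_mul]
    simp only [Matrix.mul_smul, Matrix.smul_mul, Matrix.mul_assoc]

end FractalSystem


theorem theorem1 (d n : ℕ) (hd : 0 < d) (ν η : ℝ≥0) (hν : 0 < ν) (hν1 : ν ≤ 1) (hη : η < 1)
    (b : ℝ) (hb : 0 < b) :
    ∃ ω : ℝ, 0 < ω ∧ ∀ S : FractalSystem d n ν η, S.Nondegenerate b →
      (S.IsAffine → S.HolderSmall ω) ∧
      (S.HolderSmall ω →
        ∃ (β : ℝ) (Q : C(S.G, symMat d)) (τ : VectorMeasure S.G (symMat d)) (κ : Measure S.G),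
          0 < β ∧
          -- the eigenfunction
          (S.ruelle Q = β • Q ∧
            (∀ A : C(S.G, symMat d), S.ruelle A = β • A → ∃ c : ℝ, A = c • Q) ∧
            Module.End.maxGenEigenspace S.ruelle β = Submodule.span ℝ {Q} ∧
            (∃ C : ℝ, ∀ x y : S.G,
              hsNorm ((Q x : Matrix (Fin d) (Fin d) ℝ) - (Q y : Matrix (Fin d) (Fin d) ℝ)) ≤
                C * dist x y ^ (ν : ℝ)) ∧
            (∀ x : S.G, (Q x : Matrix (Fin d) (Fin d) ℝ).PosDef)) ∧
          -- the eigenmeasure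
          (τ ≠ 0 ∧ S.IsAdjointImage τ (β • τ) ∧
            (∀ σ : VectorMeasure S.G (symMat d), S.IsAdjointImage σ (β • σ) →
              ∃ c : ℝ, σ = c • τ) ∧
            (∀ B : Set S.G, MeasurableSet B → (τ B : Matrix (Fin d) (Fin d) ℝ).PosSemidef)) ∧
          -- the scalar measure
          (S.IsHSMeasure Q τ κ ∧ totalVar τ ≪ κ ∧ κ ≪ totalVar τ ∧ Ergodic S.F κ) ∧
          -- self-similarity of the form
          (∀ f g : Euc d → ℝ, ContDiff ℝ 1 f → ContDiff ℝ 1 g →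
            S.energy τ f g = β⁻¹ * ∑ i, S.energy τ (f ∘ S.ψ i) (g ∘ S.ψ i)) ∧
          -- the Gibbs property
          (S.IsAffine → ∀ (w : List (Fin n)) (p : Euc d),
            (τ {x : S.G | (x : Euc d) ∈ cell S.ψ S.G w} : Matrix (Fin d) (Fin d) ℝ) =
              (β ^ w.length)⁻¹ •
                (jac (wordMap S.ψ w) p * (τ univ : Matrix (Fin d) (Fin d) ℝ) *
                  (jac (wordMap S.ψ w) p)ᵀ))) := by
  have hη' : (η : ℝ) < 1 := by exact_mod_cast hη
  have hην : (η : ℝ) ^ (ν : ℝ) < 1 := Real.rpow_lt_one η.2 hη' (by exact_mod_cast hν)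
  have he := Real.exp_pos 2
  -- Half of the gap 1 - η^ν is spent on the variation of the derivatives, so θ = η^ν + s < 1.
  set s := (1 - (η : ℝ) ^ (ν : ℝ)) / 2 with hs
  have hs0 : 0 < s := by linarith
  -- This solves the smallness condition on ω. Writing n + 1 for n keeps the denominator positive
  -- without assuming n > 0.
  set ω₀ := s * b ^ 2 / (3 * (n + 1) * Real.exp 2) with hω₀
  have hω₀0 : 0 < ω₀ := by positivity
  have hω0 : 0 < min 1 ω₀ := lt_min one_pos hω₀0
  refine ⟨min 1 ω₀, hω0, fun S hN => ⟨fun hS => hS.holderSmall hω0.le, fun hH => ?_⟩⟩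
  have hsω : 3 * n * min 1 ω₀ * Real.exp 2 ≤ s * b ^ 2 := by
    calc 3 * n * min 1 ω₀ * Real.exp 2 ≤ 3 * (n + 1) * ω₀ * Real.exp 2 := by
          gcongr
          · linarith
          · exact min_le_right _ _
      _ = s * b ^ 2 := by rw [hω₀]; field_simp
  obtain ⟨β, Q, c, h⟩ := FractalSystem.exists_isSpectralData hd hν1 hη.le hb hN hω0.le
    (min_le_left _ _) hH hsω hs0.le (by linarith)
  obtain ⟨τ, hp, hτ⟩ := h.exists_eigenmeasure
  have ha := h.isAdjointImage hp
  exact ⟨β, Q, τ, S.hsMeasure Q τ, h.pos,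
    ⟨h.eigen, fun A hA => ⟨c A, h.eq_smul_of_eigen hA⟩, h.maxGenEigenspace_eq, h.holder,
      h.posDef⟩,
    ⟨h.ne_zero hp, ha, fun σ hσ => ⟨_, h.eq_smul_of_isAdjointImage hp hσ⟩, hτ⟩,
    ⟨h.isHSMeasure hτ, h.absolutelyContinuous_hsMeasure hτ,
      FractalSystem.IsSpectralData.hsMeasure_absolutelyContinuous, h.ergodic hp hτ⟩,
    fun f g hf hg => ha.energy_eq h.pos.ne' hf hg,
    fun hS w p => h.apply_cellG hτ ha hS w p⟩
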